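/- Let $\Bbbk$ be an algebraically closed field of characteristic $0$, $\xi\in\Bbbk$ a primitive fourth root of unity and $\sqrt2\in\Bbbk$ a square root of $2$. Let $\mathcal K$ be the ($8$-dimensional) Hopf algebra generated as an algebra by $a,b,c,d$ with relations $$ab=\xi ba,\quad ac=\xi ca,\quad cb=bc=0,\quad cd=\xi dc,\quad bd=\xi db,\quad ad=da=1,\quad b^2=c^2=0,\quad a^2c=b,\quad a^4=1,$$ with $\Delta(a)=a\otimes a+b\otimes c$, $\Delta(b)=a\otimes b+b\otimes d$, $\Delta(c)=c\otimes a+d\otimes c$, $\Delta(d)=c\otimes b+d\otimes d$, $\varepsilon(a)=\varepsilon(d)=1$, $\varepsilon(b)=\varepsilon(c)=0$, and antipode $\mathcal S(a)=d$, $\mathcal S(b)=\xi b$, $\mathcal S(c)=-\xi c$, $\mathcal S(d)=a$. Let $D=D(\mathcal K^{\mathrm{cop}})=\mathcal K^*\otimes\mathcal K$ be the Drinfeld double of $\mathcal K^{\mathrm{cop}}$; writing $f\bowtie h$ for $f\otimes h$, its unit is $\varepsilon\bowtie 1$, its product is $(f\bowtie h)(g\bowtie l)=\sum f\cdot g(\mathcal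 S(h_{(1)})\,?\,h_{(3)})\bowtie h_{(2)}l$ with $(f\cdot g)(m)=\sum f(m_{(2)})g(m_{(1)})$, and its coproduct is $\Delta(f\bowtie h)=\sum (f_{(2)}\bowtie h_{(2)})\otimes(f_{(1)}\bowtie h_{(1)})$, all Sweedler indices referring to $\mathcal K$ and to its dual coalgebra structure $f(xy)=\sum f_{(1)}(x)f_{(2)}(y)$. In terms of the basis of $\mathcal K^*$ dual to the basis $1,a,b,c,d,a^2,ab,ac$ of $\mathcal K$, let $g=1^*+\xi^{-1}a^*+\xi d^*-(a^2)^*$ and $x=\sqrt2\,\xi\,(b^*+c^*+(ab)^*+(ac)^*)$. Identify $h\in\mathcal K$ with $\varepsilon\bowtie h\in D$, and $f\in\mathcal K^*$ with $f\bowtie 1\in D$. Then there are unique $D$-modules with the following actions of $a,b,c,d,x,g$ on a fixed basis. * For $\ell\in\mathbb Z_4$: the one-dimensional module $\Bbbk_{\chi^\ell}$ given by the character $\chi^\ell(a)=\xi^\ell$, $\chi^\ell(d)=\xi^{-\ell}$, $\chi^\ell(g)=(-1)^\ell$, $\chi^\ell(b)=\chi^\ell(c)=\chi^\ell(x)=0$.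 * For $(i,j)\in\Lambda=\{(i,j)\in\mathbb Z_4\times\mathbb Z_4 : 2i\ne j\}$: the two-dimensional module $V_{i,j}$ given by the matrices (acting on column vectors) $$a\mapsto\begin{pmatrix}\xi^i&0\\0&\xi^{i+3}\end{pmatrix},\quad b\mapsto\begin{pmatrix}0&(-1)^i\\0&0\end{pmatrix},\quad c\mapsto\begin{pmatrix}0&1\\0&0\end{pmatrix},\quad d\mapsto\begin{pmatrix}\xi^{-i}&0\\0&\xi^{-i+1}\end{pmatrix},$$ $$g\mapsto\begin{pmatrix}\xi^j&0\\0&\xi^{j+2}\end{pmatrix},\quad x\mapsto\begin{pmatrix}0&\frac{\sqrt2}2\xi(\xi^i+\xi^{3i+j})\\\sqrt2\,\xi(\xi^{3i}-\xi^{i+j})&0\end{pmatrix}.$$ * The four-dimensional module $P$ with basis $p_1,p_2,p_3,p_4$ on which $a$, $d$, $g$ act by the diagonal matrices $\mathrm{diag}(1,-\xi,\xi,1)$, $\mathrm{diag}(1,\xi,-\xi,1)$, $\mathrm{diag}(1,-1,-1,1)$, and $$b:\ p_1\mapsto p_3,\ p_2\mapsto\xi p_4,\ p_3,p_4\mapsto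 0;\qquad c:\ p_1\mapsto -p_3,\ p_2\mapsto \xi p_4,\ p_3,p_4\mapsto0;$$ $$x:\ p_1\mapsto p_2+\sqrt2\,p_3,\ p_2\mapsto-\sqrt2\,p_4,\ p_3\mapsto p_4,\ p_4\mapsto0.$$ Moreover $P_1(\Bbbk_{\chi^\ell}):=P\otimes\Bbbk_{\chi^\ell}$, with $D$ acting through its coproduct, is a $D$-module for every $\ell\in\mathbb Z_4$. The modules $P_1(\Bbbk_{\chi^\ell})$ ($\ell\in\mathbb Z_4$) and $V_{i,j}$ ($(i,j)\in\Lambda$) are the projective covers of the simple $D$-modules. Precisely: each $\Bbbk_{\chi^\ell}$ is simple with projective cover $P_1(\Bbbk_{\chi^\ell})$; each $V_{i,j}$ is simple and is its own projective cover; and every simple $D$-module has exactly one of these sixteen modules as its projective cover. In particular, as left $D$-modules, $${}_DD\;\simeq\;\bigoplus_{\ell\in\mathbb Z_4}P_1(\Bbbk_{\chi^\ell})\;\oplus\bigoplus_{(i,j)\in\Lambda}V_{i,j}^{\,2}.$$ -/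

import Mathlib

universe u v w

open scoped TensorProduct

noncomputable section

/-! ## The Drinfeld double of `H^cop` -/

namespace DoubleCop

open Coalgebra HopfAlgebra

section General

variable {k : Type u} [Field k] {H : Type v} [Ring H] [HopfAlgebra k H]

/-- The iterated comultiplication `h ↦ ∑ h₍₁₎ ⊗ (h₍₂₎ ⊗ h₍₃₎)` of `H`. -/
def comul₃ : H →ₗ[k] H ⊗[k] (H ⊗[k] H) :=
  (comul (R := k) (A := H)).lTensor H ∘ₗ comul

/-- The product of the algebra `(H^cop)^*`: `(f · g)(m) = ∑ f(m₍₂₎) g(m₍₁₎)`, where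
`∑ m₍₁₎ ⊗ m₍₂₎` is the comultiplication of `H`. -/
def dualMul : Module.Dual k H →ₗ[k] Module.Dual k H →ₗ[k] Module.Dual k H :=
  LinearMap.mk₂ k
    (fun f g => LinearMap.mul' k k ∘ₗ TensorProduct.map f g ∘ₗ
      (TensorProduct.comm k H H).toLinearMap ∘ₗ comul)
    (fun f f' g => by ext; simp [TensorProduct.map_add_left])
    (fun c f g => by ext; simp [TensorProduct.map_smul_left])
    (fun f g g' => by ext; simp [TensorProduct.map_add_right])
    (fun c f g => by ext; simp [TensorProduct.map_smul_right])

lemma dualMul_apply (f g : Module.Dual k H) (m : H) :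
    dualMul f g m = LinearMap.mul' k k (TensorProduct.map f g
      (TensorProduct.comm k H H (comul m))) := rfl

/-- `coad x z g` is the functional `m ↦ g (S(x) m z)` on `H`. -/
def coad : H →ₗ[k] H →ₗ[k] Module.Dual k H →ₗ[k] Module.Dual k H :=
  LinearMap.mk₂ k
    (fun x z => Module.Dual.transpose
      (LinearMap.mulLeft k (antipode k x) ∘ₗ LinearMap.mulRight k z))
    (fun x x' z => by ext; simp [add_mul, Module.Dual.transpose_apply])
    (fun c x z => by ext; simp [Module.Dual.transpose_apply])
    (fun x z z' => by ext; simp [mul_add, Module.Dual.transpose_apply])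
    (fun c x z => by ext; simp [Module.Dual.transpose_apply])

@[simp] lemma coad_apply (x z : H) (g : Module.Dual k H) (m : H) :
    coad x z g m = g (antipode k x * (m * z)) := rfl

/-- The linear map `x ⊗ (y ⊗ z) ↦ g(S(x) ? z) ⊗ y`. -/
def twistCore (g : Module.Dual k H) : H ⊗[k] (H ⊗[k] H) →ₗ[k] Module.Dual k H ⊗[k] H :=
  TensorProduct.map ((TensorProduct.lift coad).flip g) LinearMap.id ∘ₗ
    (TensorProduct.assoc k H H H).symm.toLinearMap ∘ₗ
      (TensorProduct.comm k H H).toLinearMap.lTensor H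

@[simp] lemma twistCore_tmul (g : Module.Dual k H) (x y z : H) :
    twistCore g (x ⊗ₜ (y ⊗ₜ z)) = coad x z g ⊗ₜ[k] y := by
  simp [twistCore]

/-- `twist h g = ∑ g(S(h₍₁₎) ? h₍₃₎) ⊗ h₍₂₎`. -/
def twist : H →ₗ[k] Module.Dual k H →ₗ[k] Module.Dual k H ⊗[k] H :=
  LinearMap.mk₂ k (fun h g => twistCore g (comul₃ h))
    (fun h h' g => by simp)
    (fun c h g => by simp)
    (fun h g g' => by simp [twistCore, TensorProduct.map_add_left])
    (fun c h g => by simp [twistCore, TensorProduct.map_smul_left])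

lemma twist_apply (h : H) (g : Module.Dual k H) : twist h g = twistCore g (comul₃ h) := rfl

lemma mulRight_add (l l' : H) : LinearMap.mulRight k (l + l') =
    LinearMap.mulRight k l + LinearMap.mulRight k l' := by ext; simp [mul_add]

lemma mulRight_smul (c : k) (l : H) : LinearMap.mulRight k (c • l) =
    c • LinearMap.mulRight k l := by ext; simp

/-- The product of the Drinfeld double of `H^cop`, as a bilinear map on `H^* ⊗ H`:
`(f ⋈ h) (g ⋈ l) = ∑ f · g(S(h₍₁₎) ? h₍₃₎) ⋈ h₍₂₎ l`. -/
def doubleMul : Module.Dual k H ⊗[k] H →ₗ[k]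
    Module.Dual k H ⊗[k] H →ₗ[k] Module.Dual k H ⊗[k] H :=
  TensorProduct.lift <| LinearMap.mk₂ k
    (fun f h => TensorProduct.lift <| LinearMap.mk₂ k
      (fun g l => TensorProduct.map (dualMul f) (LinearMap.mulRight k l) (twist h g))
      (fun g g' l => by simp)
      (fun c g l => by simp)
      (fun g l l' => by rw [mulRight_add, TensorProduct.map_add_right]; rfl)
      (fun c g l => by rw [mulRight_smul, TensorProduct.map_smul_right]; rfl))
    (fun f f' h => by ext; simp [TensorProduct.map_add_left])
    (fun c f h => by ext; simp [TensorProduct.map_smul_left])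
    (fun f h h' => by ext; simp)
    (fun c f h => by ext; simp)

@[simp] lemma doubleMul_tmul (f g : Module.Dual k H) (h l : H) :
    doubleMul (f ⊗ₜ[k] h) (g ⊗ₜ[k] l) =
      TensorProduct.map (dualMul f) (LinearMap.mulRight k l) (twist h g) := rfl

lemma dualMul_eq_conv (f g : Module.Dual k H) :
    dualMul f g = (WithConv.toConv g * WithConv.toConv f).ofConv := by
  ext m
  rw [dualMul_apply, LinearMap.convMul_def]
  simp only [LinearMap.comp_apply]
  induction comul (R := k) m using TensorProduct.induction_on with
  | zero => simp
  | tmul x y => simp [mul_comm]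
  | add x y hx hy => simp_all

lemma dualMul_assoc (f g e : Module.Dual k H) :
    dualMul (dualMul f g) e = dualMul f (dualMul g e) := by
  simp only [dualMul_eq_conv, WithConv.toConv_ofConv, mul_assoc]

lemma counit_eq_conv : (counit : Module.Dual k H) =
    (1 : WithConv (H →ₗ[k] k)).ofConv := by
  ext; simp [LinearMap.convOne_def]

lemma counit_dualMul (f : Module.Dual k H) : dualMul counit f = f := by
  rw [dualMul_eq_conv, counit_eq_conv]; simp

lemma dualMul_counit (f : Module.Dual k H) : dualMul f counit = f := by
  rw [dualMul_eq_conv, counit_eq_conv]; simp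

section antipode
open WithConv LinearMap

lemma aux_coassoc : TensorProduct.map (comul (R := k) (A := H)) (comul (R := k) (A := H)) ∘ₗ comul =
    (TensorProduct.assoc k H H (H ⊗[k] H)).symm.toLinearMap ∘ₗ
    TensorProduct.map id ((TensorProduct.assoc k H H H).toLinearMap ∘ₗ
      TensorProduct.map comul id) ∘ₗ comul₃ := by
  simp only [comul₃, coassoc_simps]

lemma comul_antipode (x : H) : comul (R := k) (antipode k x) =
    TensorProduct.map (antipode k) (antipode k) (TensorProduct.comm k H H (comul x)) := by
  have key : toConv (TensorProduct.map (antipode k) (antipode k) ∘ₗ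
      (TensorProduct.comm k H H).toLinearMap ∘ₗ comul) = toConv (comul ∘ₗ antipode k) := by
    refine left_inv_eq_right_inv (a := toConv (comul (R := k) (A := H))) ?_ comul_right_inv
    apply WithConv.ext
    let T := LinearMap.mul' k (H ⊗[k] H) ∘ₗ TensorProduct.map (TensorProduct.map (antipode k) (antipode k) ∘ₗ
      (TensorProduct.comm k H H).toLinearMap) LinearMap.id
    have h1 : (toConv (TensorProduct.map (antipode k) (antipode k) ∘ₗ
      (TensorProduct.comm k H H).toLinearMap ∘ₗ comul) * toConv (comul (R := k) (A := H))).ofConv =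
       T ∘ₗ TensorProduct.map (comul (R := k) (A := H)) (comul (R := k) (A := H)) ∘ₗ comul := by
      simp only [LinearMap.convMul_def, ofConv_toConv, T, coassoc_simps]
    rw [h1, aux_coassoc]
    have h2 : T ∘ₗ (TensorProduct.assoc k H H (H ⊗[k] H)).symm.toLinearMap ∘ₗ
        TensorProduct.map id ((TensorProduct.assoc k H H H).toLinearMap ∘ₗ
          TensorProduct.map comul id) =
        (TensorProduct.mk k H H 1) ∘ₗ LinearMap.mul' k H ∘ₗ
          TensorProduct.map (antipode k) ((TensorProduct.lid k H).toLinearMap ∘ₗ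
            TensorProduct.map counit id) := by
      ext x y z
      have : ∀ Y : H ⊗[k] H, T ((TensorProduct.assoc k H H (H ⊗[k] H)).symm
          (x ⊗ₜ (TensorProduct.assoc k H H H (Y ⊗ₜ z)))) =
          LinearMap.mul' k H ((antipode k).rTensor H Y) ⊗ₜ (antipode k x * z) := by
        intro Y
        induction Y using TensorProduct.induction_on with
        | zero => simp
        | tmul a b => simp [T]
        | add a b ha hb => simp_all [TensorProduct.add_tmul, TensorProduct.tmul_add]
      simp [this, Algebra.algebraMap_eq_smul_one, TensorProduct.smul_tmul]
    have h3 : TensorProduct.map (antipode k) ((TensorProduct.lid k H).toLinearMap ∘ₗ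
            TensorProduct.map counit id) ∘ₗ comul₃ (k := k) (H := H) =
        TensorProduct.map (antipode k) id ∘ₗ comul := by
      have := Coalgebra.rTensor_counit_comp_comul (R := k) (A := H)
      rw [comul₃, LinearMap.lTensor_def, ← LinearMap.comp_assoc, ← TensorProduct.map_comp,
        LinearMap.comp_assoc, ← LinearMap.rTensor_def, this]
      congr 2
      ext; simp
    calc _ = (TensorProduct.mk k H H 1) ∘ₗ LinearMap.mul' k H ∘ₗ
          (TensorProduct.map (antipode k) ((TensorProduct.lid k H).toLinearMap ∘ₗ
            TensorProduct.map counit id) ∘ₗ comul₃ (k := k) (H := H)) := by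
            exact LinearMap.ext fun a => LinearMap.congr_fun h2 (comul₃ a)
      _ = _ := by
        rw [h3]
        ext a
        have := mul_antipode_rTensor_comul_apply (R := k) a
        rw [LinearMap.rTensor_def] at this
        simp [this, Algebra.algebraMap_eq_smul_one, Algebra.TensorProduct.one_def]
  exact LinearMap.congr_fun (WithConv.toConv_injective key.symm) x

end antipode

lemma twistCore_mul_tmul (X : H ⊗[k] (H ⊗[k] H)) (x' y' z' : H) (e : Module.Dual k H) :
    twistCore e (X * (x' ⊗ₜ[k] (y' ⊗ₜ[k] z'))) =
      TensorProduct.map LinearMap.id (LinearMap.mulRight k y') (twistCore (coad x' z' e) X) := by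
  induction X using TensorProduct.induction_on with
  | zero => simp
  | add a b ha hb => rw [add_mul, map_add, ha, hb, map_add, map_add]
  | tmul x b =>
    induction b using TensorProduct.induction_on with
    | zero => simp
    | add a b ha hb =>
      rw [TensorProduct.tmul_add, add_mul, map_add, ha, hb, map_add, map_add]
    | tmul y z =>
      simp only [Algebra.TensorProduct.tmul_mul_tmul, twistCore_tmul, TensorProduct.map_tmul,
        LinearMap.id_apply, LinearMap.mulRight_apply]
      congr 1
      ext m
      simp [antipode_mul_antidistrib, mul_assoc]

lemma comul₃_mul (h h' : H) : comul₃ (k := k) (h * h') = comul₃ (k := k) h * comul₃ (k := k) h' := by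
  have : ∀ X, (comul (R := k) (A := H)).lTensor H X =
      (Algebra.TensorProduct.map (AlgHom.id k H) (Bialgebra.comulAlgHom k H)) X := fun X => rfl
  simp only [comul₃, LinearMap.comp_apply, this, Bialgebra.comul_mul, map_mul]

lemma twist_mul (h h' : H) (e : Module.Dual k H) :
    twist (h * h') e = doubleMul (counit ⊗ₜ[k] h) (twist h' e) := by
  rw [twist_apply, comul₃_mul, twist_apply h']
  generalize comul₃ (k := k) h' = Y
  induction Y using TensorProduct.induction_on with
  | zero => simp only [mul_zero, map_zero]
  | add a b ha hb => rw [mul_add, map_add, ha, hb, map_add, map_add]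
  | tmul x' b =>
    induction b using TensorProduct.induction_on with
    | zero => simp only [TensorProduct.tmul_zero, mul_zero, map_zero]
    | add a b ha hb => rw [TensorProduct.tmul_add, mul_add, map_add, ha, hb, map_add, map_add]
    | tmul y' z' =>
      rw [twistCore_mul_tmul, twistCore_tmul, doubleMul_tmul, ← twist_apply]
      congr 2
      ext1 f
      rw [counit_dualMul, LinearMap.id_apply]

/-- The linear map `x₁ ⊗ ((x₂ ⊗ (y ⊗ z₁)) ⊗ z₂) ↦ (coad x₁ z₂ g) · (coad x₂ z₁ e) ⊗ y`. -/
def twistPair (g e : Module.Dual k H) :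
    H ⊗[k] ((H ⊗[k] (H ⊗[k] H)) ⊗[k] H) →ₗ[k] Module.Dual k H ⊗[k] H :=
  TensorProduct.lift <| LinearMap.mk₂ k
    (fun x₁ Y => TensorProduct.lift (LinearMap.mk₂ k
      (fun W z₂ => TensorProduct.map (dualMul (coad x₁ z₂ g)) LinearMap.id (twistCore e W))
      (by simp) (by simp) (by simp [TensorProduct.map_add_left])
      (by simp [TensorProduct.map_smul_left])) Y)
    (fun x x' Y => by
      rw [← LinearMap.add_apply]; congr 1; ext; simp [TensorProduct.add_tmul])
    (fun c x Y => by
      rw [← LinearMap.smul_apply]; congr 1; ext; simp [TensorProduct.smul_tmul'])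
    (by simp) (by simp)

@[simp] lemma twistPair_tmul (g e : Module.Dual k H) (x₁ z₂ : H) (W : H ⊗[k] (H ⊗[k] H)) :
    twistPair g e (x₁ ⊗ₜ (W ⊗ₜ z₂)) =
      TensorProduct.map (dualMul (coad x₁ z₂ g)) LinearMap.id (twistCore e W) := rfl

/-- `x ⊗ (y ⊗ z) ↦ x₁ ⊗ ((x₂ ⊗ (y ⊗ z₁)) ⊗ z₂)`. -/
def spread : H ⊗[k] (H ⊗[k] H) →ₗ[k] H ⊗[k] ((H ⊗[k] (H ⊗[k] H)) ⊗[k] H) :=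
  ((TensorProduct.assoc k H (H ⊗[k] H) H).symm.toLinearMap ∘ₗ
    ((TensorProduct.assoc k H H H).symm.toLinearMap.lTensor H)).lTensor H ∘ₗ
  (TensorProduct.assoc k H H (H ⊗[k] (H ⊗[k] H))).toLinearMap ∘ₗ
  TensorProduct.map (comul (R := k) (A := H)) ((comul (R := k) (A := H)).lTensor H)

lemma spread_comul₃ : spread ∘ₗ comul₃ (k := k) (H := H) =
    (TensorProduct.map LinearMap.id (TensorProduct.map comul₃ LinearMap.id)) ∘ₗ comul₃ := by
  simp only [spread, comul₃, coassoc_simps]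

/-- The functional `m ↦ (g · e)(S(x) m z)`, in terms of `X = ∑ x₍₁₎ ⊗ x₍₂₎` and
`Z = ∑ z₍₁₎ ⊗ z₍₂₎`. -/
def pairing (g e : Module.Dual k H) (X Z : H ⊗[k] H) : Module.Dual k H :=
  LinearMap.mul' k k ∘ₗ TensorProduct.map g e ∘ₗ (TensorProduct.comm k H H).toLinearMap ∘ₗ
    LinearMap.mulLeft k (TensorProduct.map (antipode k) (antipode k)
      (TensorProduct.comm k H H X)) ∘ₗ LinearMap.mulRight k Z ∘ₗ comul

lemma coad_dualMul (x z : H) (g e : Module.Dual k H) :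
    coad x z (dualMul g e) = pairing g e (comul x) (comul z) := by
  ext m
  simp only [coad_apply, dualMul_apply, Bialgebra.comul_mul, comul_antipode]
  rfl

lemma pairing_tmul (g e : Module.Dual k H) (x₁ x₂ z₁ z₂ : H) :
    pairing g e (x₁ ⊗ₜ x₂) (z₁ ⊗ₜ z₂) = dualMul (coad x₁ z₂ g) (coad x₂ z₁ e) := by
  ext m
  simp only [pairing, dualMul_apply, LinearMap.comp_apply]
  induction comul (R := k) m using TensorProduct.induction_on with
  | zero => simp
  | add a b ha hb => simp only [map_add, ha, hb]
  | tmul a b => simp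

lemma twistCore_dualMul (g e : Module.Dual k H) :
    twistCore (dualMul g e) = twistPair g e ∘ₗ spread := by
  ext x y z : 5
  have key : ∀ X Z : H ⊗[k] H, pairing g e X Z ⊗ₜ[k] y = twistPair g e
      (((TensorProduct.assoc k H (H ⊗[k] H) H).symm.toLinearMap ∘ₗ
        ((TensorProduct.assoc k H H H).symm.toLinearMap.lTensor H)).lTensor H
        (TensorProduct.assoc k H H (H ⊗[k] (H ⊗[k] H)) (X ⊗ₜ (y ⊗ₜ Z)))) := by
    intro X Z
    induction X using TensorProduct.induction_on with
    | zero => simp [pairing]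
    | add a b ha hb =>
      simp only [TensorProduct.add_tmul, map_add, ← ha, ← hb]
      rw [← TensorProduct.add_tmul]
      congr 1
      ext m
      simp [pairing, add_mul]
    | tmul x₁ x₂ =>
      induction Z using TensorProduct.induction_on with
      | zero => simp [pairing]
      | add a b ha hb =>
        simp only [TensorProduct.tmul_add, map_add, ← ha, ← hb]
        rw [← TensorProduct.add_tmul]
        congr 1
        ext m
        simp [pairing, mul_add]
      | tmul z₁ z₂ => simp [pairing_tmul]
  simp only [TensorProduct.AlgebraTensorModule.curry_apply, TensorProduct.curry_apply,
    LinearMap.coe_restrictScalars, LinearMap.comp_apply, twistCore_tmul, coad_dualMul]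
  exact key (comul x) (comul z)

lemma mulRight_one : LinearMap.mulRight k (1 : H) = LinearMap.id := by ext; simp

lemma twist_dualMul (h : H) (g e : Module.Dual k H) :
    twist h (dualMul g e) = doubleMul (twist h g) (e ⊗ₜ[k] 1) := by
  rw [twist_apply, twistCore_dualMul, LinearMap.comp_apply, ← LinearMap.comp_apply spread comul₃,
    spread_comul₃, LinearMap.comp_apply, twist_apply]
  generalize comul₃ (k := k) h = X
  induction X using TensorProduct.induction_on with
  | zero => simp only [map_zero, LinearMap.zero_apply]
  | add a b ha hb => simp only [map_add, ha, hb, LinearMap.add_apply]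
  | tmul x b =>
    induction b using TensorProduct.induction_on with
    | zero => simp only [TensorProduct.tmul_zero, map_zero, LinearMap.zero_apply]
    | add a b ha hb =>
      simp only [TensorProduct.tmul_add, map_add, ha, hb, LinearMap.add_apply]
    | tmul y z =>
      simp only [TensorProduct.map_tmul, LinearMap.id_apply, twistPair_tmul, twistCore_tmul,
        doubleMul_tmul, mulRight_one, twist_apply]

lemma doubleMul_left (f : Module.Dual k H) (X Y : Module.Dual k H ⊗[k] H) :
    doubleMul (TensorProduct.map (dualMul f) LinearMap.id X) Y =
      TensorProduct.map (dualMul f) LinearMap.id (doubleMul X Y) := by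
  induction X using TensorProduct.induction_on with
  | zero => simp only [map_zero, LinearMap.zero_apply]
  | add a b ha hb => simp only [map_add, ha, hb, LinearMap.add_apply]
  | tmul g h =>
  induction Y using TensorProduct.induction_on with
  | zero => simp only [map_zero]
  | add a b ha hb => simp only [map_add, ha, hb]
  | tmul e m =>
    simp only [doubleMul_tmul, TensorProduct.map_tmul, LinearMap.id_apply]
    induction twist h e using TensorProduct.induction_on with
    | zero => simp only [map_zero]
    | add a b ha hb => simp only [map_add, ha, hb]
    | tmul a b => simp [dualMul_assoc]

lemma doubleMul_right (X Y : Module.Dual k H ⊗[k] H) (l : H) :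
    doubleMul X (TensorProduct.map LinearMap.id (LinearMap.mulRight k l) Y) =
      TensorProduct.map LinearMap.id (LinearMap.mulRight k l) (doubleMul X Y) := by
  induction X using TensorProduct.induction_on with
  | zero => simp only [map_zero, LinearMap.zero_apply]
  | add a b ha hb => simp only [map_add, ha, hb, LinearMap.add_apply]
  | tmul g h =>
  induction Y using TensorProduct.induction_on with
  | zero => simp only [map_zero]
  | add a b ha hb => simp only [map_add, ha, hb]
  | tmul e m =>
    simp only [doubleMul_tmul, TensorProduct.map_tmul, LinearMap.id_apply]
    induction twist h e using TensorProduct.induction_on with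
    | zero => simp only [map_zero]
    | add a b ha hb => simp only [map_add, ha, hb]
    | tmul a b => simp [mul_assoc]

lemma doubleMul_tmul' (f g : Module.Dual k H) (h l : H) :
    doubleMul (f ⊗ₜ[k] h) (g ⊗ₜ[k] l) =
      TensorProduct.map (dualMul f) LinearMap.id
        (TensorProduct.map LinearMap.id (LinearMap.mulRight k l) (twist h g)) := by
  rw [doubleMul_tmul]
  generalize twist h g = S
  rw [← LinearMap.comp_apply, ← TensorProduct.map_comp, LinearMap.id_comp,
    LinearMap.comp_id]

lemma tmul_eq_left (f : Module.Dual k H) (h : H) :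
    f ⊗ₜ[k] h = TensorProduct.map (dualMul f) LinearMap.id (counit (R := k) ⊗ₜ[k] h) := by
  rw [TensorProduct.map_tmul, dualMul_counit, LinearMap.id_apply]

lemma tmul_eq_right (f : Module.Dual k H) (h : H) :
    f ⊗ₜ[k] h = TensorProduct.map LinearMap.id (LinearMap.mulRight k h) (f ⊗ₜ[k] 1) := by
  simp

lemma aux_left (S : Module.Dual k H ⊗[k] H) (l : H) (e : Module.Dual k H) :
    doubleMul (TensorProduct.map LinearMap.id (LinearMap.mulRight k l) S) (e ⊗ₜ[k] 1) =
      doubleMul S (twist l e) := by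
  induction S using TensorProduct.induction_on with
  | zero => simp only [map_zero, LinearMap.zero_apply]
  | add a b ha hb => simp only [map_add, ha, hb, LinearMap.add_apply]
  | tmul g y =>
    rw [TensorProduct.map_tmul, LinearMap.mulRight_apply, LinearMap.id_apply, tmul_eq_left g y,
      doubleMul_left, ← twist_mul, doubleMul_tmul, mulRight_one]

lemma aux_right (T : Module.Dual k H ⊗[k] H) (h : H) (g : Module.Dual k H) :
    doubleMul (counit ⊗ₜ[k] h) (TensorProduct.map (dualMul g) LinearMap.id T) =
      doubleMul (twist h g) T := by
  induction T using TensorProduct.induction_on with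
  | zero => simp only [map_zero]
  | add a b ha hb => simp only [map_add, ha, hb]
  | tmul e y =>
    rw [TensorProduct.map_tmul, LinearMap.id_apply, tmul_eq_right e y, doubleMul_right,
      ← twist_dualMul, tmul_eq_right (dualMul g e) y, doubleMul_right, doubleMul_tmul,
      mulRight_one]
    congr 1
    have : dualMul (counit (R := k) (A := H)) = LinearMap.id := by
      ext1 f; rw [counit_dualMul, LinearMap.id_apply]
    rw [this, TensorProduct.map_id, LinearMap.id_apply]

lemma comul₃_one : comul₃ (1 : H) = (1 : H) ⊗ₜ[k] ((1 : H) ⊗ₜ[k] (1 : H)) := by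
  simp [comul₃, Algebra.TensorProduct.one_def]

lemma coad_one_one (g : Module.Dual k H) : coad 1 1 g = g := by
  ext; simp

lemma twist_one_left (g : Module.Dual k H) : twist 1 g = g ⊗ₜ[k] (1 : H) := by
  simp [twist_apply, comul₃_one, coad_one_one]

lemma coad_counit (x z : H) : coad x z (counit (R := k)) =
    (counit (R := k) x * counit (R := k) z) • counit := by
  ext m; simp; ring

lemma twist_counit (h : H) : twist h (counit (R := k)) = counit (R := k) ⊗ₜ[k] h := by
  have h1 : twistCore (counit (R := k) (A := H)) =
      TensorProduct.mk k (Module.Dual k H) H counit ∘ₗ (TensorProduct.lid k H).toLinearMap ∘ₗ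
        TensorProduct.map counit
          ((TensorProduct.rid k H).toLinearMap ∘ₗ TensorProduct.map LinearMap.id counit) := by
    ext x y z : 5
    simp [coad_counit, TensorProduct.smul_tmul', mul_smul]
    rw [smul_comm]
  have h2 : (TensorProduct.lid k H).toLinearMap ∘ₗ
        TensorProduct.map counit
          ((TensorProduct.rid k H).toLinearMap ∘ₗ TensorProduct.map LinearMap.id counit) ∘ₗ
          comul₃ (k := k) (H := H) = LinearMap.id := by
    have e1 : (TensorProduct.rid k H).toLinearMap ∘ₗ TensorProduct.map LinearMap.id counit ∘ₗ
        comul (R := k) (A := H) = LinearMap.id := by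
      rw [← LinearMap.lTensor_def, Coalgebra.lTensor_counit_comp_comul]; ext; simp
    have e2 : (TensorProduct.lid k H).toLinearMap ∘ₗ TensorProduct.map counit LinearMap.id ∘ₗ
        comul (R := k) (A := H) = LinearMap.id := by
      rw [← LinearMap.rTensor_def, Coalgebra.rTensor_counit_comp_comul]; ext; simp
    rw [comul₃, LinearMap.lTensor_def, ← LinearMap.comp_assoc _ _ (TensorProduct.map _ _),
      ← TensorProduct.map_comp, LinearMap.comp_assoc, e1, LinearMap.comp_id, e2]
  rw [twist_apply, h1]
  exact congrArg (TensorProduct.mk k (Module.Dual k H) H counit) (LinearMap.congr_fun h2 h)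

lemma doubleMul_assoc (X Y Z : Module.Dual k H ⊗[k] H) :
    doubleMul (doubleMul X Y) Z = doubleMul X (doubleMul Y Z) := by
  induction X using TensorProduct.induction_on with
  | zero => simp only [map_zero, LinearMap.zero_apply]
  | add a b ha hb => simp only [map_add, ha, hb, LinearMap.add_apply]
  | tmul f h =>
  induction Y using TensorProduct.induction_on with
  | zero => simp only [map_zero, LinearMap.zero_apply]
  | add a b ha hb => simp only [map_add, ha, hb, LinearMap.add_apply]
  | tmul g l =>
  induction Z using TensorProduct.induction_on with
  | zero => simp only [map_zero]
  | add a b ha hb => simp only [map_add, ha, hb]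
  | tmul e m =>
    have comm' : ∀ (p : Module.Dual k H) (q : H) (S : Module.Dual k H ⊗[k] H),
        TensorProduct.map (dualMul p) LinearMap.id
          (TensorProduct.map LinearMap.id (LinearMap.mulRight k q) S) =
        TensorProduct.map LinearMap.id (LinearMap.mulRight k q)
          (TensorProduct.map (dualMul p) LinearMap.id S) := by
      intro p q S
      simp only [← LinearMap.comp_apply, ← TensorProduct.map_comp, LinearMap.id_comp,
        LinearMap.comp_id]
    rw [doubleMul_tmul' f g, doubleMul_left, tmul_eq_right e m, doubleMul_right, aux_left,
      doubleMul_right, doubleMul_right, doubleMul_tmul g e, mulRight_one, tmul_eq_left f h,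
      doubleMul_left, aux_right, comm']

lemma one_doubleMul (X : Module.Dual k H ⊗[k] H) :
    doubleMul (counit (R := k) ⊗ₜ[k] (1 : H)) X = X := by
  induction X using TensorProduct.induction_on with
  | zero => simp
  | add a b ha hb => simp_all
  | tmul f h => simp [twist_one_left, counit_dualMul]

lemma doubleMul_one (X : Module.Dual k H ⊗[k] H) :
    doubleMul X (counit (R := k) ⊗ₜ[k] (1 : H)) = X := by
  induction X using TensorProduct.induction_on with
  | zero => simp
  | add a b ha hb => simp_all
  | tmul f h => simp [twist_counit, dualMul_counit]

end General
end DoubleCop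

/-- The Drinfeld double `D(H^cop)` of the co-opposite of a Hopf algebra `H`. Its underlying vector
space is `H^* ⊗ H`; writing `f ⋈ h` for `f ⊗ h`, its product is
`(f ⋈ h) (g ⋈ l) = ∑ f · g(S(h₍₁₎) ? h₍₃₎) ⋈ h₍₂₎ l` and its unit is `ε ⋈ 1`. Here `S` and
`∑ h₍₁₎ ⊗ h₍₂₎ ⊗ h₍₃₎` are the antipode and the iterated comultiplication of `H` (so that `S` is
the inverse of the antipode of `H^cop`), and `f · g` is the product of `(H^cop)^*`. -/
def DoubleCop (k : Type u) [Field k] (H : Type v) [Ring H] [HopfAlgebra k H] : Type (max u v) :=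
  Module.Dual k H ⊗[k] H

namespace DoubleCop

open Coalgebra HopfAlgebra

variable {k : Type u} [Field k] {H : Type v} [Ring H] [HopfAlgebra k H]

instance : AddCommGroup (DoubleCop k H) :=
  inferInstanceAs (AddCommGroup (Module.Dual k H ⊗[k] H))

instance : Module k (DoubleCop k H) :=
  inferInstanceAs (Module k (Module.Dual k H ⊗[k] H))

/-- The identification of `H^* ⊗ H` with the Drinfeld double, as vector spaces. -/
def ofTensor : Module.Dual k H ⊗[k] H ≃ₗ[k] DoubleCop k H := LinearEquiv.refl k _

/-- The element `f ⋈ h` of the Drinfeld double. -/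
def bowtie (f : Module.Dual k H) (h : H) : DoubleCop k H := ofTensor (f ⊗ₜ[k] h)

instance : Ring (DoubleCop k H) :=
  { (inferInstance : AddCommGroup (DoubleCop k H)) with
    mul := fun X Y => ofTensor (doubleMul (ofTensor.symm X) (ofTensor.symm Y))
    one := bowtie counit 1
    mul_assoc := fun X Y Z => congrArg ofTensor
      (doubleMul_assoc (ofTensor.symm X) (ofTensor.symm Y) (ofTensor.symm Z))
    one_mul := fun X => congrArg ofTensor (one_doubleMul (ofTensor.symm X))
    mul_one := fun X => congrArg ofTensor (doubleMul_one (ofTensor.symm X))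
    left_distrib := fun X Y Z => congrArg ofTensor
      (map_add (doubleMul (ofTensor.symm X)) (ofTensor.symm Y) (ofTensor.symm Z))
    right_distrib := fun X Y Z => congrArg ofTensor
      (LinearMap.map_add₂ doubleMul (ofTensor.symm X) (ofTensor.symm Y) (ofTensor.symm Z))
    zero_mul := fun X => congrArg ofTensor (LinearMap.map_zero₂ doubleMul (ofTensor.symm X))
    mul_zero := fun X => congrArg ofTensor (map_zero (doubleMul (ofTensor.symm X))) }

lemma mul_def (X Y : DoubleCop k H) :
    X * Y = ofTensor (doubleMul (ofTensor.symm X) (ofTensor.symm Y)) := rfl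

lemma one_def : (1 : DoubleCop k H) = bowtie counit 1 := rfl

instance : Algebra k (DoubleCop k H) :=
  Algebra.ofModule
    (fun c X Y => congrArg ofTensor
      (LinearMap.map_smul₂ doubleMul c (ofTensor.symm X) (ofTensor.symm Y)))
    (fun c X Y => congrArg ofTensor
      (map_smul (doubleMul (ofTensor.symm X)) c (ofTensor.symm Y)))

/-- The comultiplication `f ↦ ∑ f₍₁₎ ⊗ f₍₂₎` of `H^*` for finite-dimensional `H`, characterized by
`f (x y) = ∑ f₍₁₎(x) f₍₂₎(y)`. -/
def dualComul [Module.Finite k H] :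
    Module.Dual k H →ₗ[k] Module.Dual k H ⊗[k] Module.Dual k H :=
  (TensorProduct.dualDistribEquiv k H H).symm.toLinearMap ∘ₗ
    Module.Dual.transpose (LinearMap.mul' k H)

lemma dualComul_spec [Module.Finite k H] (f : Module.Dual k H) (x y : H) :
    TensorProduct.dualDistrib k H H (dualComul f) (x ⊗ₜ[k] y) = f (x * y) := by
  have : TensorProduct.dualDistrib k H H (dualComul f) =
      TensorProduct.dualDistribEquiv k H H (dualComul f) := rfl
  rw [this, dualComul, LinearMap.comp_apply, LinearEquiv.coe_coe, LinearEquiv.apply_symm_apply]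
  rfl

/-- The comultiplication of the Drinfeld double `D(H^cop)`:
`Δ(f ⋈ h) = ∑ (f₍₂₎ ⋈ h₍₂₎) ⊗ (f₍₁₎ ⋈ h₍₁₎)`. -/
def doubleComul [Module.Finite k H] :
    DoubleCop k H →ₗ[k] DoubleCop k H ⊗[k] DoubleCop k H :=
  TensorProduct.map ofTensor.toLinearMap ofTensor.toLinearMap ∘ₗ
  (TensorProduct.tensorTensorTensorComm k
    (Module.Dual k H) (Module.Dual k H) H H).toLinearMap ∘ₗ
  TensorProduct.map
    ((TensorProduct.comm k (Module.Dual k H) (Module.Dual k H)).toLinearMap ∘ₗ dualComul)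
    ((TensorProduct.comm k H H).toLinearMap ∘ₗ comul) ∘ₗ
  ofTensor.symm.toLinearMap

/-- The diagonal action of the Drinfeld double on the tensor product `M ⊗ N` of two of its
representations: `X` acts by `∑ ρ(X₍₁₎) ⊗ σ(X₍₂₎)`. -/
def tensorAct [Module.Finite k H] {M N : Type*} [AddCommGroup M] [Module k M]
    [AddCommGroup N] [Module k N]
    (ρ : DoubleCop k H →ₐ[k] Module.End k M) (σ : DoubleCop k H →ₐ[k] Module.End k N) :
    DoubleCop k H →ₗ[k] Module.End k (M ⊗[k] N) :=
  TensorProduct.homTensorHomMap (RingHom.id k) M N M N ∘ₗ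
    TensorProduct.map ρ.toLinearMap σ.toLinearMap ∘ₗ doubleComul

end DoubleCop

/-! ## The Hopf algebra `𝒦` -/

namespace HopfK

/-- Names of the four algebra generators of `𝒦`. -/
inductive Gen : Type
  | a | b | c | d

variable {k : Type u} [Field k]

/-- The generators of the free algebra on `a, b, c, d`. -/
abbrev free (i : Gen) : FreeAlgebra k Gen := FreeAlgebra.ι k i

/-- The defining relations of `𝒦`. -/
inductive Rel (ξ : k) : FreeAlgebra k Gen → FreeAlgebra k Gen → Prop
  | ab : Rel ξ (free .a * free .b) (ξ • (free .b * free .a))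
  | ac : Rel ξ (free .a * free .c) (ξ • (free .c * free .a))
  | cb : Rel ξ (free .c * free .b) (0)
  | bc : Rel ξ (free .b * free .c) (0)
  | cd : Rel ξ (free .c * free .d) (ξ • (free .d * free .c))
  | bd : Rel ξ (free .b * free .d) (ξ • (free .d * free .b))
  | ad : Rel ξ (free .a * free .d) (free .d * free .a)
  | ad_one : Rel ξ (free .a * free .d) (1)
  | bb : Rel ξ (free .b * free .b) (0)
  | cc : Rel ξ (free .c * free .c) (0)
  | aac : Rel ξ (free .a ^ 2 * free .c) (free .b)
  | aaaa : Rel ξ (free .a ^ 4) (1)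

/-- The algebra `𝒦`: generated by `a, b, c, d` subject to the defining relations, for a primitive
fourth root of unity `ξ`. -/
def KAlg {ξ : k} (_ : IsPrimitiveRoot ξ 4) : Type u := RingQuot (Rel ξ)

variable {ξ : k} (hξ : IsPrimitiveRoot ξ 4)

instance : Ring (KAlg hξ) := inferInstanceAs (Ring (RingQuot _))
instance : Algebra k (KAlg hξ) := inferInstanceAs (Algebra k (RingQuot _))

/-- The projection from the free algebra onto `𝒦`. -/
def proj : FreeAlgebra k Gen →ₐ[k] KAlg hξ := RingQuot.mkAlgHom k (Rel ξ)

/-- The canonical generators of `𝒦`. -/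
def gen (i : Gen) : KAlg hξ := proj hξ (free i)

/-- The generator `a`. -/
def a : KAlg hξ := gen hξ Gen.a
/-- The generator `b`. -/
def b : KAlg hξ := gen hξ Gen.b
/-- The generator `c`. -/
def c : KAlg hξ := gen hξ Gen.c
/-- The generator `d`. -/
def d : KAlg hξ := gen hξ Gen.d

/-- Elements `a, b, c, d` of a `k`-algebra that satisfy the defining relations of `𝒦`. -/
structure Relations {R : Type w} [Ring R] [Algebra k R] (ξ : k) (A B C D : R) : Prop where
  ab : A * B = ξ • (B * A)
  ac : A * C = ξ • (C * A)
  cb : C * B = 0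
  bc : B * C = 0
  cd : C * D = ξ • (D * C)
  bd : B * D = ξ • (D * B)
  ad : A * D = D * A
  ad_one : A * D = 1
  bb : B * B = 0
  cc : C * C = 0
  aac : A ^ 2 * C = B
  aaaa : A ^ 4 = 1

lemma proj_rel {X Y : FreeAlgebra k Gen} (h : Rel ξ X Y) : proj hξ X = proj hξ Y :=
  RingQuot.mkAlgHom_rel k h

/-- Algebra maps out of `𝒦`. -/
def lift {R : Type w} [Ring R] [Algebra k R] {A B C D : R} (h : Relations ξ A B C D) :
    KAlg hξ →ₐ[k] R :=
  RingQuot.liftAlgHom k ⟨FreeAlgebra.lift k (fun i => Gen.rec A B C D i), by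
    intro X Y hXY
    cases hXY <;> simp only [free, map_mul, map_smul, map_pow, map_one, map_zero, FreeAlgebra.lift_ι_apply]
    exacts [h.ab, h.ac, h.cb, h.bc, h.cd, h.bd, h.ad, h.ad_one, h.bb, h.cc, h.aac, h.aaaa]⟩

section lift
variable {R : Type w} [Ring R] [Algebra k R] {A B C D : R} (h : Relations ξ A B C D)
lemma lift_gen (i : Gen) : lift hξ h (gen hξ i) = Gen.rec A B C D i := by
  refine (RingQuot.liftAlgHom_mkAlgHom_apply k _ _ _).trans ?_
  exact FreeAlgebra.lift_ι_apply _ _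
@[simp] lemma lift_a : lift hξ h (a hξ) = A := by
  simp [lift_gen, a]
@[simp] lemma lift_b : lift hξ h (b hξ) = B := by
  simp [lift_gen, b]
@[simp] lemma lift_c : lift hξ h (c hξ) = C := by
  simp [lift_gen, c]
@[simp] lemma lift_d : lift hξ h (d hξ) = D := by
  simp [lift_gen, d]
end lift

lemma relations : Relations ξ (a hξ) (b hξ) (c hξ) (d hξ) where
  ab := by simpa [a, b, c, d, gen] using proj_rel hξ Rel.ab
  ac := by simpa [a, b, c, d, gen] using proj_rel hξ Rel.ac
  cb := by simpa [a, b, c, d, gen] using proj_rel hξ Rel.cb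
  bc := by simpa [a, b, c, d, gen] using proj_rel hξ Rel.bc
  cd := by simpa [a, b, c, d, gen] using proj_rel hξ Rel.cd
  bd := by simpa [a, b, c, d, gen] using proj_rel hξ Rel.bd
  ad := by simpa [a, b, c, d, gen] using proj_rel hξ Rel.ad
  ad_one := by simpa [a, b, c, d, gen] using proj_rel hξ Rel.ad_one
  bb := by simpa [a, b, c, d, gen] using proj_rel hξ Rel.bb
  cc := by simpa [a, b, c, d, gen] using proj_rel hξ Rel.cc
  aac := by simpa [a, b, c, d, gen] using proj_rel hξ Rel.aac
  aaaa := by simpa [a, b, c, d, gen] using proj_rel hξ Rel.aaaa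

variable {hξ} in
@[ext high] lemma hom_ext {R : Type w} [Ring R] [Algebra k R] {f g : KAlg hξ →ₐ[k] R}
    (ha : f (a hξ) = g (a hξ)) (hb : f (b hξ) = g (b hξ))
    (hc : f (c hξ) = g (c hξ)) (hd : f (d hξ) = g (d hξ)) : f = g := by
  refine RingQuot.ringQuot_ext' _ _ _ (FreeAlgebra.hom_ext ?_)
  funext i
  cases i
  exacts [ha, hb, hc, hd]

variable {hξ} in
lemma induction {P : KAlg hξ → Prop} (h1 : P 1) (hadd : ∀ x y, P x → P y → P (x + y))
    (hsmul : ∀ (r : k) x, P x → P (r • x)) 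
    (ha : ∀ x, P x → P (a hξ * x)) (hb : ∀ x, P x → P (b hξ * x))
    (hc : ∀ x, P x → P (c hξ * x)) (hd : ∀ x, P x → P (d hξ * x)) (x : KAlg hξ) : P x := by
  obtain ⟨X, rfl⟩ : ∃ X, proj hξ X = x := RingQuot.mkAlgHom_surjective k _ x
  suffices ∀ (X : FreeAlgebra k Gen) (y : KAlg hξ), P y →
      P (proj hξ X * y) by
    simpa using this X 1 h1
  intro X
  induction X using FreeAlgebra.induction with
  | grade0 r => intro y hy; simpa [← Algebra.smul_def] using hsmul r y hy
  | grade1 i => intro y hy; cases i; exacts [ha y hy, hb y hy, hc y hy, hd y hy]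
  | mul X Y hX hY => intro y hy; rw [map_mul, mul_assoc]; exact hX _ (hY _ hy)
  | add X Y hX hY => intro y hy; rw [map_add, add_mul]; exact hadd _ _ (hX _ hy) (hY _ hy)

lemma xi_sq {ξ : k} (hξ : IsPrimitiveRoot ξ 4) : ξ ^ 2 = -1 := by
  have h4 : ξ ^ 4 = 1 := hξ.pow_eq_one
  have h2 : ξ ^ 2 ≠ 1 := hξ.pow_ne_one_of_pos_of_lt (by norm_num) (by norm_num)
  have : (ξ ^ 2 - 1) * (ξ ^ 2 + 1) = 0 := by linear_combination h4
  rcases mul_eq_zero.mp this with h | h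
  · exact absurd (by linear_combination h) h2
  · linear_combination h

lemma b_eq : b hξ = a hξ * (a hξ * c hξ) := by
  rw [← (relations hξ).aac, pow_two, mul_assoc]

lemma d_eq : d hξ = a hξ * (a hξ * a hξ) := by
  have h1 := (relations hξ).ad_one
  have h2 := (relations hξ).aaaa
  calc d hξ = a hξ ^ 4 * d hξ := by rw [h2, one_mul]
    _ = a hξ * (a hξ * (a hξ * (a hξ * d hξ))) := by noncomm_ring
    _ = _ := by rw [h1, mul_one]

lemma c_mul_a : c hξ * a hξ = (-ξ) • (a hξ * c hξ) := by
  rw [(relations hξ).ac, smul_smul]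
  have : -ξ * ξ = 1 := by linear_combination -(xi_sq hξ)
  rw [this, one_smul]

lemma c_mul_a_mul (x : KAlg hξ) : c hξ * (a hξ * x) = (-ξ) • (a hξ * (c hξ * x)) := by
  rw [← mul_assoc, c_mul_a, smul_mul_assoc, mul_assoc]

lemma c_mul_c_mul (x : KAlg hξ) : c hξ * (c hξ * x) = 0 := by
  rw [← mul_assoc, (relations hξ).cc, zero_mul]

lemma a_four : a hξ * (a hξ * (a hξ * a hξ)) = 1 := by
  rw [← (relations hξ).aaaa]; noncomm_ring

lemma a_four_mul (x : KAlg hξ) : a hξ * (a hξ * (a hξ * (a hξ * x))) = x := by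
  conv_rhs => rw [← one_mul x, ← a_four hξ]
  simp only [mul_assoc]

lemma comul_relations : Relations ξ
    (a hξ ⊗ₜ[k] a hξ + b hξ ⊗ₜ[k] c hξ) (a hξ ⊗ₜ[k] b hξ + b hξ ⊗ₜ[k] d hξ)
    (c hξ ⊗ₜ[k] a hξ + d hξ ⊗ₜ[k] c hξ) (c hξ ⊗ₜ[k] b hξ + d hξ ⊗ₜ[k] d hξ) := by
  have h2 := xi_sq hξ
  constructor
  all_goals
    simp only [b_eq, d_eq, pow_succ, pow_zero, one_mul, mul_add, add_mul, mul_assoc,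
      Algebra.TensorProduct.tmul_mul_tmul, c_mul_a, c_mul_a_mul, (relations hξ).cc,
      a_four, a_four_mul, mul_smul_comm, smul_mul_assoc, smul_smul, TensorProduct.tmul_smul, smul_add,
      ← TensorProduct.smul_tmul', mul_zero, smul_zero, TensorProduct.zero_tmul,
      TensorProduct.tmul_zero, add_zero, zero_add, Algebra.TensorProduct.one_def, mul_one]
  all_goals try (match_scalars <;> grind)

lemma counit_relations : Relations ξ (1 : k) 0 0 1 := by
  constructor <;> simp

open MulOpposite in
lemma antipode_relations : Relations (R := (KAlg hξ)ᵐᵒᵖ) ξ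
    (op (d hξ)) (op (ξ • b hξ)) (op (-ξ • c hξ)) (op (a hξ)) := by
  have h2 := xi_sq hξ
  constructor
  all_goals
    apply unop_injective
    simp only [b_eq, d_eq, pow_succ, pow_zero, one_mul, unop_mul, unop_op, unop_smul, unop_one,
      unop_zero, mul_assoc, c_mul_a, c_mul_a_mul, (relations hξ).cc,
      a_four, a_four_mul, mul_smul_comm, smul_mul_assoc, smul_smul, mul_zero, smul_zero, mul_one]
  all_goals try (match_scalars; grind)

/-- The comultiplication of `𝒦`. -/
def comulHom : KAlg hξ →ₐ[k] KAlg hξ ⊗[k] KAlg hξ := lift hξ (comul_relations hξ)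

/-- The counit of `𝒦`. -/
def counitHom : KAlg hξ →ₐ[k] k := lift hξ counit_relations

/-- The antipode of `𝒦`, as an algebra map to the opposite algebra. -/
def antipodeHom : KAlg hξ →ₐ[k] (KAlg hξ)ᵐᵒᵖ := lift hξ (antipode_relations hξ)

/-- The bialgebra structure of `𝒦`: `Δ(a) = a ⊗ a + b ⊗ c`, `Δ(b) = a ⊗ b + b ⊗ d`,
`Δ(c) = c ⊗ a + d ⊗ c`, `Δ(d) = c ⊗ b + d ⊗ d`, `ε(a) = ε(d) = 1`, `ε(b) = ε(c) = 0`. -/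
instance : Bialgebra k (KAlg hξ) :=
  Bialgebra.ofAlgHom (comulHom hξ) (counitHom hξ)
    (by
      apply hom_ext <;>
      simp [comulHom, TensorProduct.add_tmul, TensorProduct.tmul_add] <;> abel)
    (by apply hom_ext <;> simp [comulHom, counitHom])
    (by apply hom_ext <;> simp [comulHom, counitHom])

open Coalgebra

lemma comul_a : comul (R := k) (a hξ) = a hξ ⊗ₜ a hξ + b hξ ⊗ₜ c hξ :=
  lift_a hξ (comul_relations hξ)
lemma comul_b : comul (R := k) (b hξ) = a hξ ⊗ₜ b hξ + b hξ ⊗ₜ d hξ :=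
  lift_b hξ (comul_relations hξ)
lemma comul_c : comul (R := k) (c hξ) = c hξ ⊗ₜ a hξ + d hξ ⊗ₜ c hξ :=
  lift_c hξ (comul_relations hξ)
lemma comul_d : comul (R := k) (d hξ) = c hξ ⊗ₜ b hξ + d hξ ⊗ₜ d hξ :=
  lift_d hξ (comul_relations hξ)
lemma counit_a : counit (R := k) (a hξ) = 1 := lift_a hξ counit_relations
lemma counit_b : counit (R := k) (b hξ) = 0 := lift_b hξ counit_relations
lemma counit_c : counit (R := k) (c hξ) = 0 := lift_c hξ counit_relations
lemma counit_d : counit (R := k) (d hξ) = 1 := lift_d hξ counit_relations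

/-- The antipode of `𝒦`, as a linear map. -/
def antipodeMap : KAlg hξ →ₗ[k] KAlg hξ :=
  (MulOpposite.opLinearEquiv k).symm.toLinearMap ∘ₗ (antipodeHom hξ).toLinearMap

lemma antipodeMap_a : antipodeMap hξ (a hξ) = d hξ := by simp [antipodeMap, antipodeHom]
lemma antipodeMap_b : antipodeMap hξ (b hξ) = ξ • b hξ := by simp [antipodeMap, antipodeHom]
lemma antipodeMap_c : antipodeMap hξ (c hξ) = -ξ • c hξ := by simp [antipodeMap, antipodeHom]
lemma antipodeMap_d : antipodeMap hξ (d hξ) = a hξ := by simp [antipodeMap, antipodeHom]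
lemma antipodeMap_one : antipodeMap hξ 1 = 1 := by simp [antipodeMap]
lemma antipodeMap_mul (x y : KAlg hξ) :
    antipodeMap hξ (x * y) = antipodeMap hξ y * antipodeMap hξ x := by simp [antipodeMap]

lemma antipode_left_step {X Y : KAlg hξ ⊗[k] KAlg hξ} {r : k}
    (hX : LinearMap.mul' k (KAlg hξ) ((antipodeMap hξ).rTensor _ X) = algebraMap k _ r) :
    LinearMap.mul' k (KAlg hξ) ((antipodeMap hξ).rTensor _ (X * Y)) =
      r • LinearMap.mul' k (KAlg hξ) ((antipodeMap hξ).rTensor _ Y) := by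
  induction Y using TensorProduct.induction_on with
  | zero => simp
  | add y z hy hz => rw [mul_add, map_add, map_add, hy, hz, map_add, map_add, smul_add]
  | tmul y z =>
    have : ∀ X : KAlg hξ ⊗[k] KAlg hξ,
        LinearMap.mul' k (KAlg hξ) ((antipodeMap hξ).rTensor _ (X * y ⊗ₜ z)) =
        antipodeMap hξ y * LinearMap.mul' k (KAlg hξ) ((antipodeMap hξ).rTensor _ X) * z := by
      intro X
      induction X using TensorProduct.induction_on with
      | zero => simp
      | add u v hu hv =>
        rw [add_mul, map_add, map_add, hu, hv, map_add, map_add, mul_add, add_mul]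
      | tmul u v => simp [antipodeMap_mul, mul_assoc]
    rw [this, hX]
    simp [Algebra.algebraMap_eq_smul_one]

lemma antipode_right_step {X Y : KAlg hξ ⊗[k] KAlg hξ} {r : k}
    (hY : LinearMap.mul' k (KAlg hξ) ((antipodeMap hξ).lTensor _ Y) = algebraMap k _ r) :
    LinearMap.mul' k (KAlg hξ) ((antipodeMap hξ).lTensor _ (X * Y)) =
      r • LinearMap.mul' k (KAlg hξ) ((antipodeMap hξ).lTensor _ X) := by
  induction X using TensorProduct.induction_on with
  | zero => simp
  | add y z hy hz => rw [add_mul, map_add, map_add, hy, hz, map_add, map_add, smul_add]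
  | tmul y z =>
    have : ∀ Y : KAlg hξ ⊗[k] KAlg hξ,
        LinearMap.mul' k (KAlg hξ) ((antipodeMap hξ).lTensor _ (y ⊗ₜ z * Y)) =
        y * LinearMap.mul' k (KAlg hξ) ((antipodeMap hξ).lTensor _ Y) * antipodeMap hξ z := by
      intro Y
      induction Y using TensorProduct.induction_on with
      | zero => simp
      | add u v hu hv =>
        rw [mul_add, map_add, map_add, hu, hv, map_add, map_add, mul_add, add_mul]
      | tmul u v => simp [antipodeMap_mul, mul_assoc]
    rw [this, hY]
    simp [Algebra.algebraMap_eq_smul_one]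

lemma antipode_left (x : KAlg hξ) :
    LinearMap.mul' k (KAlg hξ) ((antipodeMap hξ).rTensor _ (comul x)) =
      algebraMap k _ (counit (R := k) x) := by
  have h2 := xi_sq hξ
  have one : LinearMap.mul' k (KAlg hξ) ((antipodeMap hξ).rTensor _ (comul 1)) =
      algebraMap k _ (counit (R := k) (1 : KAlg hξ)) := by
    simp [Algebra.TensorProduct.one_def, antipodeMap_one]
  have step : ∀ g y : KAlg hξ,
      LinearMap.mul' k (KAlg hξ) ((antipodeMap hξ).rTensor _ (comul g)) =
        algebraMap k _ (counit (R := k) g) →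
      LinearMap.mul' k (KAlg hξ) ((antipodeMap hξ).rTensor _ (comul y)) =
        algebraMap k _ (counit (R := k) y) →
      LinearMap.mul' k (KAlg hξ) ((antipodeMap hξ).rTensor _ (comul (g * y))) =
        algebraMap k _ (counit (R := k) (g * y)) := by
    intro g y hg hy
    rw [Bialgebra.comul_mul, antipode_left_step hξ hg, hy, Bialgebra.counit_mul, map_mul,
      Algebra.smul_def]
  induction x using HopfK.induction with
  | h1 => exact one
  | hadd x y hx hy => simp only [map_add, hx, hy]
  | hsmul r x hx =>
    rw [map_smul, map_smul, map_smul, hx, map_smul, smul_eq_mul, map_mul, Algebra.smul_def]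
  | ha x hx =>
    refine step _ _ ?_ hx
    simp only [comul_a, counit_a, map_add, LinearMap.rTensor_tmul, LinearMap.mul'_apply,
      antipodeMap_a, antipodeMap_b, map_one, smul_mul_assoc, (relations hξ).bc]
    rw [← (relations hξ).ad, (relations hξ).ad_one]; simp
  | hb x hx =>
    refine step _ _ ?_ hx
    simp only [comul_b, counit_b, map_add, LinearMap.rTensor_tmul, LinearMap.mul'_apply,
      antipodeMap_a, antipodeMap_b, map_zero, smul_mul_assoc, (relations hξ).bd, smul_smul]
    rw [← pow_two, h2]; simp
  | hc x hx =>
    refine step _ _ ?_ hx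
    simp only [comul_c, counit_c, map_add, LinearMap.rTensor_tmul, LinearMap.mul'_apply,
      antipodeMap_c, antipodeMap_d, map_zero, smul_mul_assoc, (relations hξ).ac]
    rw [← add_smul]; simp
  | hd x hx =>
    refine step _ _ ?_ hx
    simp only [comul_d, counit_d, map_add, LinearMap.rTensor_tmul, LinearMap.mul'_apply,
      antipodeMap_c, antipodeMap_d, map_one, smul_mul_assoc, (relations hξ).cb,
      (relations hξ).ad_one]
    simp

lemma antipode_right (x : KAlg hξ) :
    LinearMap.mul' k (KAlg hξ) ((antipodeMap hξ).lTensor _ (comul x)) =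
      algebraMap k _ (counit (R := k) x) := by
  have h2 := xi_sq hξ
  have one : LinearMap.mul' k (KAlg hξ) ((antipodeMap hξ).lTensor _ (comul 1)) =
      algebraMap k _ (counit (R := k) (1 : KAlg hξ)) := by
    simp [Algebra.TensorProduct.one_def, antipodeMap_one]
  have step : ∀ g y : KAlg hξ,
      LinearMap.mul' k (KAlg hξ) ((antipodeMap hξ).lTensor _ (comul g)) =
        algebraMap k _ (counit (R := k) g) →
      LinearMap.mul' k (KAlg hξ) ((antipodeMap hξ).lTensor _ (comul y)) =
        algebraMap k _ (counit (R := k) y) →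
      LinearMap.mul' k (KAlg hξ) ((antipodeMap hξ).lTensor _ (comul (g * y))) =
        algebraMap k _ (counit (R := k) (g * y)) := by
    intro g y hg hy
    rw [Bialgebra.comul_mul, antipode_right_step hξ hy, hg, Bialgebra.counit_mul, mul_comm,
      map_mul, Algebra.smul_def]
  induction x using HopfK.induction with
  | h1 => exact one
  | hadd x y hx hy => simp only [map_add, hx, hy]
  | hsmul r x hx =>
    rw [map_smul, map_smul, map_smul, hx, map_smul, smul_eq_mul, map_mul, Algebra.smul_def]
  | ha x hx =>
    refine step _ _ ?_ hx
    simp only [comul_a, counit_a, map_add, LinearMap.lTensor_tmul, LinearMap.mul'_apply,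
      antipodeMap_a, antipodeMap_c, map_one, mul_smul_comm, (relations hξ).bc,
      (relations hξ).ad_one]
    simp
  | hb x hx =>
    refine step _ _ ?_ hx
    simp only [comul_b, counit_b, map_add, LinearMap.lTensor_tmul, LinearMap.mul'_apply,
      antipodeMap_b, antipodeMap_d, map_zero, mul_smul_comm, (relations hξ).ab, smul_smul]
    rw [← pow_two, h2]; simp
  | hc x hx =>
    refine step _ _ ?_ hx
    simp only [comul_c, counit_c, map_add, LinearMap.lTensor_tmul, LinearMap.mul'_apply,
      antipodeMap_c, antipodeMap_a, map_zero, mul_smul_comm, (relations hξ).cd]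
    rw [← add_smul]; simp
  | hd x hx =>
    refine step _ _ ?_ hx
    simp only [comul_d, counit_d, map_add, LinearMap.lTensor_tmul, LinearMap.mul'_apply,
      antipodeMap_b, antipodeMap_d, map_one, mul_smul_comm, (relations hξ).cb]
    rw [← (relations hξ).ad, (relations hξ).ad_one]; simp

/-- The Hopf algebra structure of `𝒦`; the antipode is given by `S(a) = d`, `S(b) = ξ b`,
`S(c) = -ξ c`, `S(d) = a`. -/
instance : HopfAlgebra k (KAlg hξ) where
  antipode := antipodeMap hξ
  mul_antipode_rTensor_comul := LinearMap.ext (antipode_left hξ)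
  mul_antipode_lTensor_comul := LinearMap.ext (antipode_right hξ)

/-- `𝒦` is spanned by `1, a, b, c, d, a², ab, ac`. -/
lemma span_eq_top : Submodule.span k {1, a hξ, b hξ, c hξ, d hξ, a hξ ^ 2, a hξ * b hξ,
    a hξ * c hξ} = ⊤ := by
  set S := Submodule.span k {1, a hξ, b hξ, c hξ, d hξ, a hξ ^ 2, a hξ * b hξ, a hξ * c hξ} with hS
  have m0 : (1 : KAlg hξ) ∈ S := Submodule.subset_span (by simp)
  have m1 : a hξ ∈ S := Submodule.subset_span (by simp)
  have m2 : a hξ * a hξ ∈ S := pow_two (a hξ) ▸ Submodule.subset_span (by simp)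
  have m3 : a hξ * (a hξ * a hξ) ∈ S := d_eq hξ ▸ Submodule.subset_span (by simp)
  have n0 : c hξ ∈ S := Submodule.subset_span (by simp)
  have n1 : a hξ * c hξ ∈ S := Submodule.subset_span (by simp)
  have n2 : a hξ * (a hξ * c hξ) ∈ S := b_eq hξ ▸ Submodule.subset_span (by simp)
  have n3 : a hξ * (a hξ * (a hξ * c hξ)) ∈ S := by
    rw [← b_eq]; exact Submodule.subset_span (by simp)
  have step : ∀ g : KAlg hξ, g = a hξ ∨ g = c hξ → ∀ y ∈ S, g * y ∈ S := by
    intro g hg y hy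
    rw [hS] at hy
    induction hy using Submodule.span_induction with
    | zero => rw [mul_zero]; exact S.zero_mem
    | add u v _ _ hu hv => rw [mul_add]; exact S.add_mem hu hv
    | smul r u _ hu => rw [mul_smul_comm]; exact S.smul_mem _ hu
    | mem u hu =>
      simp only [Set.mem_insert_iff, Set.mem_singleton_iff] at hu
      rcases hg with rfl | rfl <;> rcases hu with rfl | rfl | rfl | rfl | rfl | rfl | rfl | rfl <;>
      (try simp only [b_eq, d_eq, pow_two, mul_one, c_mul_a, c_mul_a_mul,
        (relations hξ).cc, a_four, a_four_mul, mul_smul_comm, smul_smul, mul_zero, smul_zero]) <;>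
      first
      | exact S.zero_mem
      | assumption
      | (refine S.smul_mem _ ?_; assumption)
  have sa := step _ (Or.inl rfl)
  have sc := step _ (Or.inr rfl)
  rw [eq_top_iff]
  intro x _
  induction x using HopfK.induction with
  | h1 => exact m0
  | hadd x y hx hy => exact S.add_mem (hx trivial) (hy trivial)
  | hsmul r x hx => exact S.smul_mem _ (hx trivial)
  | ha x hx => exact sa _ (hx trivial)
  | hb x hx =>
    rw [b_eq, mul_assoc, mul_assoc]
    exact sa _ (sa _ (sc _ (hx trivial)))
  | hc x hx => exact sc _ (hx trivial)
  | hd x hx =>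
    rw [d_eq, mul_assoc, mul_assoc]
    exact sa _ (sa _ (sa _ (hx trivial)))

instance : Module.Finite k (KAlg hξ) :=
  ⟨Submodule.fg_def.2 ⟨_, by simp, span_eq_top hξ⟩⟩

/-! ### The functionals `g` and `x` on `𝒦` -/

lemma gFun_relations {ξ : k} (hξ : IsPrimitiveRoot ξ 4) : Relations ξ (ξ ^ 3) 0 0 ξ := by
  have h2 := xi_sq hξ
  constructor <;> (try simp) <;> grind

/-- The functional `g ∈ 𝒦^*`: the algebra map with `a ↦ ξ⁻¹ = ξ³`, `b, c ↦ 0`, `d ↦ ξ`. -/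
def gFun : Module.Dual k (KAlg hξ) := (lift hξ (gFun_relations hξ)).toLinearMap

lemma xRep_relations {ξ : k} (hξ : IsPrimitiveRoot ξ 4) (r : k) :
    Relations ξ (R := Matrix (Fin 2) (Fin 2) k)
      !![1, 0; 0, ξ ^ 3] !![0, r * ξ; 0, 0] !![0, r * ξ; 0, 0] !![1, 0; 0, ξ] := by
  have h2 := xi_sq hξ
  constructor <;> ext i j <;> fin_cases i <;> fin_cases j <;>
    simp [pow_succ, Matrix.mul_apply, Fin.sum_univ_two] <;> grind

/-- The functional `x ∈ 𝒦^*`: the upper right coefficient of the representation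
`a ↦ diag(1, ξ⁻¹)`, `d ↦ diag(1, ξ)`, `b, c ↦ r ξ E₁₂`, where `r` is a square root of `2`.
In terms of the basis of `𝒦^*` dual to `1, a, b, c, d, a², ab, ac`, it is
`r ξ (b^* + c^* + (ab)^* + (ac)^*)`: see `xFun_values`. -/
def xFun (r : k) : Module.Dual k (KAlg hξ) :=
  Matrix.entryLinearMap k k 0 1 ∘ₗ (lift hξ (xRep_relations hξ r)).toLinearMap

lemma gFun_values : gFun hξ 1 = 1 ∧ gFun hξ (a hξ) = ξ⁻¹ ∧ gFun hξ (b hξ) = 0 ∧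
    gFun hξ (c hξ) = 0 ∧ gFun hξ (d hξ) = ξ ∧ gFun hξ (a hξ ^ 2) = -1 ∧
    gFun hξ (a hξ * b hξ) = 0 ∧ gFun hξ (a hξ * c hξ) = 0 := by
  have h2 := xi_sq hξ
  have hi : ξ⁻¹ = ξ ^ 3 :=
    inv_eq_of_mul_eq_one_right (by linear_combination (ξ ^ 2 - 1) * h2)
  simp [gFun, hi]
  linear_combination (ξ ^ 4 - ξ ^ 2 + 1) * h2

lemma xFun_values (r : k) : xFun hξ r 1 = 0 ∧ xFun hξ r (a hξ) = 0 ∧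
    xFun hξ r (b hξ) = r * ξ ∧ xFun hξ r (c hξ) = r * ξ ∧ xFun hξ r (d hξ) = 0 ∧
    xFun hξ r (a hξ ^ 2) = 0 ∧ xFun hξ r (a hξ * b hξ) = r * ξ ∧
    xFun hξ r (a hξ * c hξ) = r * ξ := by
  simp [xFun, pow_two]

end HopfK

/-! ## The Drinfeld double of `𝒦^cop` and its modules -/

namespace HopfK

variable {k : Type u} [Field k] {ξ : k}

/-- The Drinfeld double `D = D(𝒦^cop)`. -/
abbrev D (hξ : IsPrimitiveRoot ξ 4) : Type u := DoubleCop k (KAlg hξ)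

/-- The element of `D` given by an element of `𝒦`. -/
def D.ofK {hξ : IsPrimitiveRoot ξ 4} (h : KAlg hξ) : D hξ :=
  DoubleCop.bowtie (Coalgebra.counit (R := k)) h

/-- The element of `D` given by a functional on `𝒦`. -/
def D.ofDual {hξ : IsPrimitiveRoot ξ 4} (f : Module.Dual k (KAlg hξ)) : D hξ :=
  DoubleCop.bowtie f 1

/-- The power `ξ ^ i` of a fourth root of unity `ξ`, for `i ∈ ℤ/4`. -/
def rootPow (ξ : k) (i : ZMod 4) : k := ξ ^ i.val

/-- The index set `Λ = {(i, j) ∈ ℤ/4 × ℤ/4 | 2 i ≠ j}`. -/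
abbrev Lam : Type := {p : ZMod 4 × ZMod 4 // 2 * p.1 ≠ p.2}

/-- The values of a representation `ρ` of `D` on the generators `a, b, c, d, x, g`. -/
structure ActsBy (hξ : IsPrimitiveRoot ξ 4) (r : k) {R : Type w} [Ring R] [Algebra k R]
    (ρ : D hξ →ₐ[k] R) (ra rb rc rd rx rg : R) : Prop where
  map_a : ρ (D.ofK (a hξ)) = ra
  map_b : ρ (D.ofK (b hξ)) = rb
  map_c : ρ (D.ofK (c hξ)) = rc
  map_d : ρ (D.ofK (d hξ)) = rd
  map_x : ρ (D.ofDual (xFun hξ r)) = rx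
  map_g : ρ (D.ofDual (gFun hξ)) = rg

/-- The character `χ` of an algebra, as a representation on the one-dimensional space `k`. -/
def charRep {A : Type v} [Ring A] [Algebra k A] (χ : A →ₐ[k] k) : A →ₐ[k] Module.End k k :=
  (Algebra.lmul k k).comp χ

/-- The representations of `D` that occur in the description of the projective covers. Operators on
`k^n` are given by their matrices in the standard basis, acting on column vectors. -/
structure RepFamily (hξ : IsPrimitiveRoot ξ 4) (r : k) where
  /-- the characters `χ^ℓ` -/
  χ : ZMod 4 → (D hξ →ₐ[k] k)
  /-- the two-dimensional representations `V_{i,j}` -/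
  V : Lam → (D hξ →ₐ[k] Module.End k (Fin 2 → k))
  /-- the four-dimensional representation `P` -/
  P : D hξ →ₐ[k] Module.End k (Fin 4 → k)
  /-- the tensor products `P ⊗ k_{χ^ℓ}` -/
  PT : ZMod 4 → (D hξ →ₐ[k] Module.End k ((Fin 4 → k) ⊗[k] k))
  χ_acts : ∀ ℓ, ActsBy hξ r (χ ℓ)
    (rootPow ξ ℓ) 0 0 (rootPow ξ (-ℓ)) 0 ((-1) ^ ℓ.val)
  V_acts : ∀ i j (h : 2 * i ≠ j), ActsBy hξ r (V ⟨(i, j), h⟩)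
    (Matrix.toLin' !![rootPow ξ i, 0; 0, rootPow ξ (i + 3)])
    (Matrix.toLin' !![0, (-1) ^ i.val; 0, 0])
    (Matrix.toLin' !![0, 1; 0, 0])
    (Matrix.toLin' !![rootPow ξ (-i), 0; 0, rootPow ξ (-i + 1)])
    (Matrix.toLin' !![0, r / 2 * ξ * (rootPow ξ i + rootPow ξ (3 * i + j));
      r * ξ * (rootPow ξ (3 * i) - rootPow ξ (i + j)), 0])
    (Matrix.toLin' !![rootPow ξ j, 0; 0, rootPow ξ (j + 2)])
  P_acts : ActsBy hξ r P
    (Matrix.toLin' !![1, 0, 0, 0; 0, -ξ, 0, 0; 0, 0, ξ, 0; 0, 0, 0, 1])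
    (Matrix.toLin' !![0, 0, 0, 0; 0, 0, 0, 0; 1, 0, 0, 0; 0, ξ, 0, 0])
    (Matrix.toLin' !![0, 0, 0, 0; 0, 0, 0, 0; -1, 0, 0, 0; 0, ξ, 0, 0])
    (Matrix.toLin' !![1, 0, 0, 0; 0, ξ, 0, 0; 0, 0, -ξ, 0; 0, 0, 0, 1])
    (Matrix.toLin' !![0, 0, 0, 0; 1, 0, 0, 0; r, 0, 0, 0; 0, -r, 1, 0])
    (Matrix.toLin' !![1, 0, 0, 0; 0, -1, 0, 0; 0, 0, -1, 0; 0, 0, 0, 1])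
  PT_apply : ∀ ℓ X, PT ℓ X = DoubleCop.tensorAct P (charRep (χ ℓ)) X

end HopfK

/-- The module over a `k`-algebra `A` given by a representation `ρ` of `A` on `M`. -/
def RepModule {k : Type u} [Field k] {A : Type v} [Ring A] [Algebra k A] {M : Type w}
    [AddCommGroup M] [Module k M] (_ : A →ₐ[k] Module.End k M) : Type w := M

namespace RepModule

variable {k : Type u} [Field k] {A : Type v} [Ring A] [Algebra k A] {M : Type w}
    [AddCommGroup M] [Module k M] (ρ : A →ₐ[k] Module.End k M)

instance : AddCommGroup (RepModule ρ) := inferInstanceAs (AddCommGroup M)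

instance : Module A (RepModule ρ) := Module.compHom M ρ.toRingHom

/-- The identity map from `M` to the module given by `ρ`. -/
def of : M ≃+ RepModule ρ := AddEquiv.refl M

lemma smul_def (x : A) (m : M) : x • of ρ m = of ρ (ρ x m) := rfl

end RepModule

/-- `P` is a projective cover of `S`: it is projective, and it has a surjection onto `S` whose
kernel is superfluous. -/
def IsProjectiveCover (A : Type u) [Ring A] (P : Type v) (S : Type w) [AddCommGroup P] [Module A P]
    [AddCommGroup S] [Module A S] : Prop :=
  Module.Projective A P ∧ ∃ π : P →ₗ[A] S, Function.Surjective π ∧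
    ∀ N : Submodule A P, N ⊔ LinearMap.ker π = ⊤ → N = ⊤

end

/-!
The double is generated by `a, c, g, x`, and any solution of ten relations between these in an
algebra `R` extends to an algebra map from the double to `R`: on `𝒦^*` the map is forced, since
`g` acts on `𝒦` diagonally in the basis `aⁿ`, `aⁿc`, and the cross relation between `𝒦^*` and `𝒦`
only has to be checked on generators. This gives the modules, and their uniqueness.

Since `a` and `g` commute and have order four, every module is the sum of its weight spaces, and
polynomials in `a` and `g` project onto them. Each `V_{i,j}` is simple and each `P ⊗ k_{χ^ℓ}` has a
largest proper submodule, because `c` and `x` produce from suitable vectors a basis vector that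
generates. Let `M` be the direct sum of the modules `P ⊗ k_{χ^ℓ}` and `V_{i,j}²`. The vector of `M`
made up of the first basis vectors, with the second basis vector in the second copy of each
`V_{i,j}`, generates `M`: a quotient map of `M` that kills it vanishes, as one sees by separating
weights and applying `c`. As `dim M = 64 ≥ dim D`, the map `D → M` it defines is bijective.

Hence the summands of `M` are projective, and projective covers of all their simple quotients; every
simple module is a quotient of `D ≃ M`. The weight of a vector annihilated by `c` tells apart the
simple modules with different covers.
-/

noncomputable section

/-! ### Projective covers and modules given by representations -/

namespace IsProjectiveCover

variable {A : Type u} [Ring A] {P : Type v} [AddCommGroup P] [Module A P]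
  {S : Type w} [AddCommGroup S] [Module A S]

lemma of_equiv {P' : Type*} [AddCommGroup P'] [Module A P'] (e : P ≃ₗ[A] P')
    (h : IsProjectiveCover A P S) : IsProjectiveCover A P' S := by
  obtain ⟨_, π, hπ, hsup⟩ := h
  refine ⟨.of_equiv e, π ∘ₗ e.symm.toLinearMap, hπ.comp e.symm.surjective, fun N hN => ?_⟩
  have hN' : N.map e.symm.toLinearMap ⊔ LinearMap.ker π = ⊤ := by
    have := congrArg (Submodule.map e.symm.toLinearMap) hN
    rwa [Submodule.map_sup, LinearMap.ker_comp,
      Submodule.map_comap_eq_of_surjective e.symm.surjective, Submodule.map_top,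
      LinearEquiv.range] at this
  have := congrArg (Submodule.comap e.symm.toLinearMap) (hsup _ hN')
  rwa [Submodule.comap_map_eq_of_injective e.symm.injective, Submodule.comap_top] at this

variable {N₀ : Submodule A P} (hN₀ : IsGreatest {N : Submodule A P | N ≠ ⊤} N₀)
include hN₀

/- All proper submodules of `P` lie in `N₀`, so two of them never span `P`. -/
lemma of_surjective [Module.Projective A P] [Nontrivial S] {f : P →ₗ[A] S}
    (hf : Function.Surjective f) : IsProjectiveCover A P S := by
  refine ⟨inferInstance, f, hf, fun N hN => by_contra fun hN_ne => hN₀.1 (top_le_iff.1 ?_)⟩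
  have hker : LinearMap.ker f ≠ ⊤ := by
    rw [Ne, LinearMap.ker_eq_top]
    rintro rfl
    obtain ⟨y, hy⟩ := exists_ne (0 : S)
    obtain ⟨_, rfl⟩ := hf y
    exact hy rfl
  exact hN.ge.trans (sup_le (hN₀.2 hN_ne) (hN₀.2 hker))

lemma ker_eq_of_isGreatest [IsSimpleModule A S] {f : P →ₗ[A] S} (hf : Function.Surjective f) :
    LinearMap.ker f = N₀ :=
  have hker : IsCoatom (LinearMap.ker f) := LinearMap.isCoatom_ker_of_surjective hf
  ((hker.le_iff.1 (hN₀.2 hker.1)).resolve_left hN₀.1).symm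

lemma nonempty_equiv {T : Type*} [AddCommGroup T] [Module A T] [IsSimpleModule A S]
    [IsSimpleModule A T] {f : P →ₗ[A] T} (hf : Function.Surjective f)
    (h : IsProjectiveCover A P S) : Nonempty (T ≃ₗ[A] S) := by
  obtain ⟨-, π, hπ, -⟩ := h
  have hker : LinearMap.ker f = LinearMap.ker π :=
    (ker_eq_of_isGreatest hN₀ hf).trans (ker_eq_of_isGreatest hN₀ hπ).symm
  exact ⟨(f.quotKerEquivOfSurjective hf).symm.trans
    ((Submodule.quotEquivOfEq _ _ hker).trans (π.quotKerEquivOfSurjective hπ))⟩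

end IsProjectiveCover

lemma isGreatest_bot_of_isSimpleModule (A : Type u) [Ring A] (P : Type v) [AddCommGroup P]
    [Module A P] [IsSimpleModule A P] : IsGreatest {N : Submodule A P | N ≠ ⊤} ⊥ :=
  ⟨bot_ne_top, fun _ hN => ((eq_bot_or_eq_top _).resolve_right hN).le⟩

lemma smul_mem_iff_of_ne_zero {k : Type u} [Field k] {A : Type v} [Ring A] [Algebra k A]
    {M : Type*} [AddCommGroup M] [Module k M] [Module A M] [IsScalarTower k A M]
    (N : Submodule A M) {s : k} (hs : s ≠ 0) {m : M} : s • m ∈ N ↔ m ∈ N :=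
  (N.restrictScalars k).smul_mem_iff hs

namespace RepModule

variable {k : Type u} [Field k] {A : Type v} [Ring A] [Algebra k A] {M N : Type*}
  [AddCommGroup M] [Module k M] [AddCommGroup N] [Module k N]
  (ρ : A →ₐ[k] Module.End k M) (σ : A →ₐ[k] Module.End k N)

instance : Module k (RepModule ρ) := inferInstanceAs (Module k M)

instance [Module.Finite k M] : Module.Finite k (RepModule ρ) := inferInstanceAs (Module.Finite k M)

lemma smul_of (s : k) (m : M) : s • of ρ m = of ρ (s • m) := rfl

lemma of_eq_sum {n : ℕ} (ρ : A →ₐ[k] Module.End k (Fin n → k)) (v : Fin n → k) :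
    of ρ v = ∑ m, v m • of ρ (Pi.single m 1) := by
  simp only [smul_of, ← map_sum]
  congr 1
  ext m
  simp [Finset.sum_apply, Pi.single_apply]

instance : IsScalarTower k A (RepModule ρ) where
  smul_assoc s X m := LinearMap.congr_fun (map_smul ρ s X) ((of ρ).symm m)

variable {ρ σ}

/-- A linear map that commutes with the actions of a set of algebra generators, as a map of
modules. -/
def hom (G : Set A) (hG : Algebra.adjoin k G = ⊤) (f : M →ₗ[k] N)
    (hf : ∀ X ∈ G, f ∘ₗ ρ X = σ X ∘ₗ f) : RepModule ρ →ₗ[A] RepModule σ where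
  toFun m := of σ (f ((of ρ).symm m))
  map_add' m n := by simp only [map_add]
  map_smul' X m := by
    have hX : f ∘ₗ ρ X = σ X ∘ₗ f := by
      induction (hG ▸ trivial : X ∈ Algebra.adjoin k G) using Algebra.adjoin_induction with
      | mem X hX => exact hf X hX
      | algebraMap s => ext; simp
      | add X Y _ _ hX hY => rw [map_add, map_add, LinearMap.comp_add, hX, hY, LinearMap.add_comp]
      | mul X Y _ _ hX hY =>
        rw [map_mul, map_mul, Module.End.mul_eq_comp, Module.End.mul_eq_comp,
          ← LinearMap.comp_assoc, hX, LinearMap.comp_assoc, hY, LinearMap.comp_assoc]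
    exact LinearMap.congr_fun hX ((of ρ).symm m)

/-- An equivalence of representations, as an equivalence of modules. -/
def equiv (e : M ≃ₗ[k] N) (he : ∀ X m, e (ρ X m) = σ X (e m)) : RepModule ρ ≃ₗ[A] RepModule σ where
  __ := (of ρ).symm.trans (e.toAddEquiv.trans (of σ))
  map_smul' X m := he X ((of ρ).symm m)

end RepModule

/-! ### Eigenspace projections -/

namespace HopfK

lemma pow_val_add {M : Type*} [Monoid M] {n : ℕ} [NeZero n] {x : M} (hx : x ^ n = 1)
    (i j : ZMod n) : x ^ (i + j).val = x ^ i.val * x ^ j.val := by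
  rw [ZMod.val_add, ← pow_eq_pow_mod _ hx, pow_add]

variable {k : Type u} [Field k] {ξ : k}

lemma xi_inv (hξ : IsPrimitiveRoot ξ 4) : ξ⁻¹ = -ξ :=
  inv_eq_of_mul_eq_one_right (by linear_combination -xi_sq hξ)

section rootPow

lemma rootPow_zero : rootPow ξ 0 = 1 := pow_zero ξ

lemma rootPow_one : rootPow ξ 1 = ξ := pow_one ξ

variable (hξ : IsPrimitiveRoot ξ 4)
include hξ

lemma rootPow_add (i j : ZMod 4) : rootPow ξ (i + j) = rootPow ξ i * rootPow ξ j :=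
  pow_val_add hξ.pow_eq_one i j

lemma rootPow_two : rootPow ξ 2 = -1 := xi_sq hξ

lemma rootPow_three : rootPow ξ 3 = -ξ := by
  rw [show (3 : ZMod 4) = 2 + 1 from rfl, rootPow_add hξ, rootPow_two hξ, rootPow_one, neg_one_mul]

lemma rootPow_neg_mul_self (i : ZMod 4) : rootPow ξ (-i) * rootPow ξ i = 1 := by
  rw [← rootPow_add hξ, neg_add_cancel, rootPow_zero]

lemma rootPow_neg (i : ZMod 4) : rootPow ξ (-i) = (rootPow ξ i)⁻¹ :=
  eq_inv_of_mul_eq_one_left (rootPow_neg_mul_self hξ i)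

lemma rootPow_ne_zero (i : ZMod 4) : rootPow ξ i ≠ 0 :=
  right_ne_zero_of_mul_eq_one (rootPow_neg_mul_self hξ i)

lemma rootPow_pow_four (i : ZMod 4) : rootPow ξ i ^ 4 = 1 := by
  rw [rootPow, ← pow_mul, mul_comm, pow_mul, hξ.pow_eq_one, one_pow]

lemma rootPow_two_mul (i : ZMod 4) : rootPow ξ (2 * i) = rootPow ξ i ^ 2 := by
  rw [two_mul, rootPow_add hξ, sq]

lemma rootPow_sq (i : ZMod 4) : rootPow ξ i ^ 2 = (-1) ^ i.val := by
  rw [rootPow, ← pow_mul, mul_comm, pow_mul, xi_sq hξ]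

lemma rootPow_injective : Function.Injective (rootPow ξ) := fun i j h =>
  ZMod.val_injective 4 (hξ.pow_inj (ZMod.val_lt i) (ZMod.val_lt j) h)

lemma two_ne_zero_of_isPrimitiveRoot : (2 : k) ≠ 0 := fun h2 =>
  hξ.pow_ne_one_of_pos_of_lt (by norm_num) (by norm_num : 2 < 4) <| by
    linear_combination xi_sq hξ - h2

lemma four_ne_zero_of_isPrimitiveRoot : (4 : k) ≠ 0 := by
  rw [show (4 : k) = 2 * 2 by norm_num]
  exact mul_self_ne_zero.2 (two_ne_zero_of_isPrimitiveRoot hξ)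

lemma geom_sum_rootPow (i : ZMod 4) :
    ∑ m ∈ Finset.range 4, rootPow ξ i ^ m = if i = 0 then 4 else 0 := by
  split_ifs with hi
  · simp [hi, rootPow_zero]
  · have hi' : rootPow ξ i - 1 ≠ 0 :=
      sub_ne_zero.2 fun h => hi (rootPow_injective hξ (h.trans rootPow_zero.symm))
    refine (mul_eq_zero.1 ?_).resolve_right hi'
    rw [geom_sum_mul, rootPow_pow_four hξ, sub_self]

end rootPow

section eigenProj

variable {R : Type v} [Ring R] [Algebra k R]

variable (ξ) in
/-- The projection onto the eigenspace of eigenvalue `ξⁿ` of an element `B` with `B⁴ = 1`. -/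
def eigenProj (B : R) (n : ZMod 4) : R :=
  (4 : k)⁻¹ • ∑ m ∈ Finset.range 4, (rootPow ξ (-n) • B) ^ m

variable (hξ : IsPrimitiveRoot ξ 4)
include hξ

lemma mul_eigenProj {B : R} (hB : B ^ 4 = 1) (n : ZMod 4) :
    B * eigenProj ξ B n = rootPow ξ n • eigenProj ξ B n := by
  have hu : (rootPow ξ (-n) • B) ^ 4 = 1 := by
    rw [smul_pow, rootPow_pow_four hξ, hB, one_smul]
  have hfix : (rootPow ξ (-n) • B) * eigenProj ξ B n = eigenProj ξ B n := by
    rw [← sub_eq_zero, ← sub_one_mul, eigenProj, mul_smul_comm, mul_geom_sum, hu, sub_self,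
      smul_zero]
  calc B * eigenProj ξ B n = rootPow ξ n • ((rootPow ξ (-n) • B) * eigenProj ξ B n) := by
        rw [smul_mul_assoc, smul_smul, mul_comm (rootPow ξ n), rootPow_neg_mul_self hξ, one_smul]
    _ = _ := by rw [hfix]

lemma sum_eigenProj (B : R) : ∑ n : ZMod 4, eigenProj ξ B n = 1 := by
  have hsum (m : ℕ) (hm : m ∈ Finset.range 4) :
      ∑ n : ZMod 4, rootPow ξ (-n) ^ m = if m = 0 then 4 else 0 := by
    have hval : (m : ZMod 4).val = m := ZMod.val_cast_of_lt (Finset.mem_range.1 hm)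
    have hswap (n : ZMod 4) : rootPow ξ (-n) ^ m = rootPow ξ (-m) ^ n.val := by
      rw [rootPow_neg hξ, rootPow_neg hξ, rootPow, rootPow, hval, inv_pow, inv_pow, ← pow_mul,
        ← pow_mul, mul_comm]
    calc ∑ n : ZMod 4, rootPow ξ (-n) ^ m = ∑ n : ZMod 4, rootPow ξ (-m) ^ n.val :=
          Finset.sum_congr rfl fun n _ => hswap n
      _ = ∑ j ∈ Finset.range 4, rootPow ξ (-m) ^ j := Fin.sum_univ_eq_sum_range _ 4
      _ = if m = 0 then 4 else 0 := by
          simp only [geom_sum_rootPow hξ, neg_eq_zero, ← ZMod.val_eq_zero, hval]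
  simp only [eigenProj, ← Finset.smul_sum]
  rw [Finset.sum_comm]
  simp only [smul_pow, ← Finset.sum_smul]
  rw [Finset.sum_congr rfl fun m hm => by rw [hsum m hm]]
  simp [four_ne_zero_of_isPrimitiveRoot hξ]

omit hξ in
lemma commute_eigenProj (B : R) (n : ZMod 4) : Commute B (eigenProj ξ B n) :=
  .smul_right (.sum_right _ _ _ fun _ _ => .pow_right (.smul_right (.refl B) _) _) _

lemma mul_eigenProj_of_anticommute {B X : R} (h : X * B = -(B * X)) (n : ZMod 4) :
    X * eigenProj ξ B n = eigenProj ξ B (n + 2) * X := by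
  have hsemi : SemiconjBy X (rootPow ξ (-n) • B) (rootPow ξ (-(n + 2)) • B) := by
    rw [SemiconjBy, neg_add, rootPow_add hξ, show -2 = (2 : ZMod 4) from rfl, rootPow_two hξ,
      mul_neg_one, mul_smul_comm, h, neg_smul, neg_mul, smul_mul_assoc, smul_neg]
  simp only [eigenProj, mul_smul_comm, smul_mul_assoc, Finset.mul_sum, Finset.sum_mul,
    (hsemi.pow_right _).eq]

lemma eigenProj_mul_sq {B X : R} (hB : B ^ 4 = 1) (hX : X ^ 2 = B ^ 2 - 1) (n : ZMod 4) :
    eigenProj ξ B n * X ^ 2 = (rootPow ξ (2 * n) - 1) • eigenProj ξ B n := by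
  rw [hX, mul_sub_one, ((commute_eigenProj B n).pow_left 2).symm.eq, sq, mul_assoc,
    mul_eigenProj hξ hB, mul_smul_comm, mul_eigenProj hξ hB, smul_smul, ← rootPow_add hξ,
    ← two_mul, sub_smul, one_smul]

lemma eigenProj_smul {M : Type w} [AddCommGroup M] [Module k M] [Module R M] [IsScalarTower k R M]
    {B : R} {v : M} {m : ZMod 4} (hv : B • v = rootPow ξ m • v) (n : ZMod 4) :
    eigenProj ξ B n • v = if m = n then v else 0 := by
  have hpow (j : ℕ) : (rootPow ξ (-n) • B) ^ j • v = rootPow ξ (m - n) ^ j • v := by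
    induction j with
    | zero => simp
    | succ j ih =>
      rw [pow_succ, mul_smul, smul_assoc, hv, smul_smul, ← rootPow_add hξ, neg_add_eq_sub,
        smul_algebra_smul_comm, ih, smul_smul, ← pow_succ']
  rw [eigenProj, smul_assoc, Finset.sum_smul, Finset.sum_congr rfl fun j _ => hpow j,
    ← Finset.sum_smul, geom_sum_rootPow hξ]
  simp only [sub_eq_zero]
  split_ifs
  · rw [smul_smul, inv_mul_cancel₀ (four_ne_zero_of_isPrimitiveRoot hξ), one_smul]
  · rw [zero_smul, smul_zero]

omit hξ in
lemma eigenProj_smul_mem {M : Type w} [AddCommGroup M] [Module k M] [Module R M]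
    [IsScalarTower k R M] {V : Submodule k M} {B : R} (hV : ∀ v ∈ V, B • v ∈ V) (n : ZMod 4)
    {v : M} (hv : v ∈ V) : eigenProj ξ B n • v ∈ V := by
  have hpow (j : ℕ) : (rootPow ξ (-n) • B) ^ j • v ∈ V := by
    induction j with
    | zero => rwa [pow_zero, one_smul]
    | succ j ih =>
      rw [pow_succ', mul_smul, smul_assoc]
      exact V.smul_mem _ (hV _ ih)
  rw [eigenProj, smul_assoc, Finset.sum_smul]
  exact V.smul_mem _ (V.sum_mem fun j _ => hpow j)

lemma eigenProj_rootPow_smul (B : R) (m n : ZMod 4) :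
    eigenProj ξ (rootPow ξ m • B) n = eigenProj ξ B (n - m) := by
  simp only [eigenProj, smul_smul, ← rootPow_add hξ, neg_sub, neg_add_eq_sub]

end eigenProj

end HopfK

/-! ### Algebra maps out of the Drinfeld double -/

namespace DoubleCop

open Coalgebra Module

variable {k : Type u} [Field k] {H : Type v} [Ring H] [HopfAlgebra k H]

section slice

/-- The right hit action `m ↦ ∑ f(m₍₂₎) m₍₁₎` of `H^*` on `H`; it is transpose to left
multiplication by `f` in the algebra `(H^cop)^*`. -/
def slice (f : Dual k H) : H →ₗ[k] H :=
  (TensorProduct.rid k H).toLinearMap ∘ₗ f.lTensor H ∘ₗ comul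

lemma dualMul_eq_comp_slice (f g : Dual k H) : dualMul f g = g ∘ₗ slice f := by
  ext m
  simp only [dualMul_apply, slice, LinearMap.comp_apply]
  induction comul (R := k) m using TensorProduct.induction_on with
  | zero => simp
  | tmul x y => simp
  | add x y hx hy => simp_all

lemma slice_counit (m : H) : slice (counit (R := k)) m = m := by
  simp [slice]

lemma slice_one (f : Dual k H) : slice f 1 = f 1 • 1 := by
  simp [slice, Algebra.TensorProduct.one_def]

lemma slice_mul {f f₁ f₂ g₁ g₂ : Dual k H}
    (hf : ∀ u v, f (u * v) = f₁ u * f₂ v + g₁ u * g₂ v) (m n : H) :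
    slice f (m * n) = slice f₁ m * slice f₂ n + slice g₁ m * slice g₂ n := by
  simp only [slice, LinearMap.comp_apply, Bialgebra.comul_mul]
  induction comul (R := k) m using TensorProduct.induction_on with
  | zero => simp
  | add x y hx hy => simp only [add_mul, map_add, hx, hy]; abel
  | tmul x y =>
    induction comul (R := k) n using TensorProduct.induction_on with
    | zero => simp
    | add x y hx hy => simp only [mul_add, map_add, hx, hy]; abel
    | tmul z w => simp [hf, add_smul, smul_smul, mul_comm]

end slice

section bowtie

lemma bowtie_counit_mul (h l : H) :
    (bowtie counit (h * l) : DoubleCop k H) = bowtie counit h * bowtie counit l := by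
  change _ = ofTensor (doubleMul (counit ⊗ₜ[k] h) (counit ⊗ₜ[k] l))
  simp [twist_counit, counit_dualMul, bowtie]

lemma bowtie_dualMul_one (f g : Dual k H) :
    bowtie (dualMul f g) 1 = bowtie f 1 * bowtie g 1 := by
  change _ = ofTensor (doubleMul (f ⊗ₜ[k] 1) (g ⊗ₜ[k] 1))
  simp [twist_one_left, bowtie]

lemma bowtie_eq_mul (f : Dual k H) (h : H) :
    bowtie f h = bowtie f 1 * bowtie counit h := by
  change _ = ofTensor (doubleMul (f ⊗ₜ[k] 1) (counit ⊗ₜ[k] h))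
  simp [twist_one_left, dualMul_counit, bowtie]

lemma induction_bowtie {motive : DoubleCop k H → Prop} (X : DoubleCop k H) (zero : motive 0)
    (bowtie : ∀ f h, motive (bowtie f h)) (add : ∀ X Y, motive X → motive Y → motive (X + Y)) :
    motive X :=
  TensorProduct.induction_on (motive := motive) X zero bowtie add

variable (k) in
/-- The inclusion `h ↦ ε ⋈ h` of `H` into its double. -/
def inclRight : H →ₐ[k] DoubleCop k H :=
  AlgHom.ofLinearMap (ofTensor.toLinearMap ∘ₗ TensorProduct.mk k (Dual k H) H counit) rfl
    bowtie_counit_mul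

variable (H) in
/-- The linear inclusion `f ↦ f ⋈ 1` of `H^*` into the double of `H^cop`. -/
def inclLeft : Dual k H →ₗ[k] DoubleCop k H :=
  ofTensor.toLinearMap ∘ₗ (TensorProduct.mk k (Dual k H) H).flip 1

end bowtie

section lift

variable {R : Type w} [Ring R] [Algebra k R]

/-- The linear map `f ⊗ h ↦ α(f) β(h)`. -/
def mulMap (α : Dual k H →ₗ[k] R) (β : H →ₐ[k] R) : Dual k H ⊗[k] H →ₗ[k] R :=
  LinearMap.mul' k R ∘ₗ TensorProduct.map α β.toLinearMap

@[simp] lemma mulMap_tmul (α : Dual k H →ₗ[k] R) (β : H →ₐ[k] R) (f : Dual k H) (h : H) :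
    mulMap α β (f ⊗ₜ h) = α f * β h := rfl

/-- The relation `β(h) α(f) = ∑ α(f(S(h₍₁₎) ? h₍₃₎)) β(h₍₂₎)` for all `h`, which holds for the
inclusions `α` of `H^*` and `β` of `H` into the double. -/
def CrossRelation (α : Dual k H →ₗ[k] R) (β : H →ₐ[k] R) (f : Dual k H) : Prop :=
  ∀ h, mulMap α β (twist h f) = β h * α f

/-- `α` is an algebra map on `(H^cop)^*`. -/
structure IsDualAlgHom (α : Dual k H →ₗ[k] R) : Prop where
  map_counit : α counit = 1
  map_dualMul : ∀ f g, α (dualMul f g) = α f * α g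

variable {α : Dual k H →ₗ[k] R} {β : H →ₐ[k] R} (hα : IsDualAlgHom α)
include hα

lemma mulMap_map_dualMul (f : Dual k H) (l : H) (Y : Dual k H ⊗[k] H) :
    mulMap α β (TensorProduct.map (dualMul f) (LinearMap.mulRight k l) Y) =
      α f * mulMap α β Y * β l := by
  induction Y using TensorProduct.induction_on with
  | zero => simp
  | add Y Z hY hZ => simp only [map_add, hY, hZ, mul_add, add_mul]
  | tmul g h => simp [hα.map_dualMul, mul_assoc]

lemma CrossRelation.counit : CrossRelation α β counit := fun h => by
  simp [twist_counit, hα.map_counit]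

lemma CrossRelation.dualMul {f g : Dual k H} (hf : CrossRelation α β f)
    (hg : CrossRelation α β g) : CrossRelation α β (dualMul f g) := fun h => by
  rw [twist_dualMul, hα.map_dualMul, ← mul_assoc, ← hf h]
  induction twist h f using TensorProduct.induction_on with
  | zero => simp
  | add Y Z hY hZ => simp only [map_add, LinearMap.add_apply, hY, hZ, add_mul]
  | tmul f' h' =>
    rw [doubleMul_tmul, mulMap_map_dualMul hα, hg h', mulMap_tmul, map_one, mul_one, mul_assoc]

lemma mulMap_doubleMul_counit_tmul {f : Dual k H} {h : H}
    (hf : mulMap α β (twist h f) = β h * α f) (l : H) :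
    mulMap α β (doubleMul (Coalgebra.counit ⊗ₜ h) (f ⊗ₜ l)) = β h * mulMap α β (f ⊗ₜ l) := by
  rw [doubleMul_tmul, mulMap_map_dualMul hα, hf, hα.map_counit, one_mul, mulMap_tmul, mul_assoc]

/-- The algebra map from the double that restricts to `α` on `H^*` and to `β` on `H`. -/
def lift (hαβ : ∀ f, CrossRelation α β f) : DoubleCop k H →ₐ[k] R :=
  AlgHom.ofLinearMap (mulMap α β ∘ₗ ofTensor.symm.toLinearMap)
    (by change mulMap α β (Coalgebra.counit ⊗ₜ 1) = 1; simp [hα.map_counit])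
    fun X Y => by
      induction X using induction_bowtie with
      | zero => simp
      | add X X' hX hX' => simp only [add_mul, map_add, hX, hX']
      | bowtie f h =>
      induction Y using induction_bowtie with
      | zero => simp
      | add Y Y' hY hY' => simp only [mul_add, map_add, hY, hY']
      | bowtie g l =>
        change mulMap α β (doubleMul (f ⊗ₜ h) (g ⊗ₜ l)) = α f * β h * (α g * β l)
        rw [doubleMul_tmul, mulMap_map_dualMul hα, hαβ g h]
        simp only [mul_assoc]

lemma lift_bowtie (hαβ : ∀ f, CrossRelation α β f) (f : Dual k H) (h : H) :
    lift hα hαβ (bowtie f h) = α f * β h := rfl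

end lift

section tensorAct

/-- The left winding map `h ↦ ∑ η(h₍₁₎) h₍₂₎` of a character `η`. -/
def wind (η : H →ₐ[k] k) : H →ₐ[k] H :=
  (Algebra.TensorProduct.lid k H).toAlgHom.comp
    ((Algebra.TensorProduct.map η (AlgHom.id k H)).comp (Bialgebra.comulAlgHom k H))

variable [Module.Finite k H]

lemma lid_map_dualComul (f : Dual k H) (t : H) :
    TensorProduct.lid k _ (TensorProduct.map (Dual.eval k _ t) LinearMap.id (dualComul f)) =
      f ∘ₗ LinearMap.mulLeft k t := by
  ext m
  rw [LinearMap.comp_apply, LinearMap.mulLeft_apply, ← dualComul_spec f t m]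
  induction dualComul f using TensorProduct.induction_on with
  | zero => simp
  | add Y Z hY hZ => simp_all
  | tmul f f' => simp

lemma tensorAct_charRep_bowtie {M : Type*} [AddCommGroup M] [Module k M]
    (ρ : DoubleCop k H →ₐ[k] End k M) {γ : DoubleCop k H →ₐ[k] k} {t : H} {η : H →ₐ[k] k}
    (hγ : ∀ f h, γ (bowtie f h) = f t * η h) (f : Dual k H) (h : H) (v : M) (s : k) :
    tensorAct ρ (HopfK.charRep γ) (bowtie f h) (v ⊗ₜ s) =
      ρ (bowtie (f ∘ₗ LinearMap.mulLeft k t) (wind η h)) v ⊗ₜ s := by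
  have key (F : Dual k H ⊗[k] Dual k H) (Y : H ⊗[k] H) :
      TensorProduct.homTensorHomMap (RingHom.id k) M k M k (TensorProduct.map
        ρ.toLinearMap (HopfK.charRep γ).toLinearMap
        (TensorProduct.map ofTensor.toLinearMap ofTensor.toLinearMap
          (TensorProduct.tensorTensorTensorComm k _ _ _ _
            (TensorProduct.comm k _ _ F ⊗ₜ[k] TensorProduct.comm k _ _ Y)))) (v ⊗ₜ s) =
      ρ (bowtie (TensorProduct.lid k _ (TensorProduct.map (Dual.eval k _ t) LinearMap.id F))
        (Algebra.TensorProduct.lid k H (Algebra.TensorProduct.map η (AlgHom.id k H) Y))) v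
          ⊗ₜ s := by
    induction F using TensorProduct.induction_on with
    | zero => simp [bowtie]
    | add F F' hF hF' =>
      simp only [bowtie, map_add, TensorProduct.add_tmul, LinearMap.add_apply] at hF hF' ⊢
      rw [hF, hF']
    | tmul f f' =>
    induction Y using TensorProduct.induction_on with
    | zero => simp [bowtie]
    | add Y Y' hY hY' =>
      simp only [bowtie, map_add, TensorProduct.tmul_add, TensorProduct.add_tmul,
        LinearMap.add_apply] at hY hY' ⊢
      rw [hY, hY']
    | tmul y y' =>
      change ρ (bowtie f' y') v ⊗ₜ[k] (γ (bowtie f y) * s) = _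
      rw [hγ, ← smul_eq_mul, TensorProduct.tmul_smul, TensorProduct.smul_tmul']
      simp [bowtie, smul_smul, mul_comm, ← TensorProduct.smul_tmul']
  rw [← lid_map_dualComul]
  exact key (dualComul f) (comul h)

end tensorAct

end DoubleCop

/-! ### The Drinfeld double of `𝒦^cop` by generators and relations -/

namespace HopfK

open Coalgebra DoubleCop

variable {k : Type u} [Field k] {ξ : k} (hξ : IsPrimitiveRoot ξ 4)

section generators

variable {hξ} in
lemma induction_left {P : KAlg hξ → Prop} (one : P 1) (add : ∀ x y, P x → P y → P (x + y))
    (smul : ∀ (r : k) x, P x → P (r • x))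
    (a_mul : ∀ x, P x → P (a hξ * x)) (c_mul : ∀ x, P x → P (c hξ * x)) (x : KAlg hξ) : P x := by
  induction x using HopfK.induction with
  | h1 => exact one
  | hadd x y hx hy => exact add x y hx hy
  | hsmul r x hx => exact smul r x hx
  | ha x hx => exact a_mul x hx
  | hb x hx => rw [b_eq, mul_assoc, mul_assoc]; exact a_mul _ (a_mul _ (c_mul _ hx))
  | hc x hx => exact c_mul x hx
  | hd x hx => rw [d_eq, mul_assoc, mul_assoc]; exact a_mul _ (a_mul _ (a_mul _ hx))

variable {hξ} in
lemma induction_right {P : KAlg hξ → Prop} (one : P 1) (add : ∀ x y, P x → P y → P (x + y))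
    (smul : ∀ (r : k) x, P x → P (r • x))
    (mul_a : ∀ x, P x → P (x * a hξ)) (mul_c : ∀ x, P x → P (x * c hξ)) (x : KAlg hξ) : P x := by
  suffices ∀ y, P y → P (y * x) by simpa using this 1 one
  induction x using induction_left with
  | one => intro y hy; rwa [mul_one]
  | add u v hu hv => intro y hy; rw [mul_add]; exact add _ _ (hu y hy) (hv y hy)
  | smul r u hu => intro y hy; rw [mul_smul_comm]; exact smul r _ (hu y hy)
  | a_mul u hu => intro y hy; rw [← mul_assoc]; exact hu _ (mul_a y hy)
  | c_mul u hu => intro y hy; rw [← mul_assoc]; exact hu _ (mul_c y hy)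

lemma algHom_ext_ac {R : Type w} [Ring R] [Algebra k R] {f g : KAlg hξ →ₐ[k] R}
    (ha : f (a hξ) = g (a hξ)) (hc : f (c hξ) = g (c hξ)) : f = g := by
  refine hom_ext ha ?_ hc ?_ <;> simp only [b_eq, d_eq, map_mul, ha, hc]

lemma adjoin_a_c : Algebra.adjoin k {a hξ, c hξ} = ⊤ := by
  refine eq_top_iff.2 fun h _ => ?_
  have ha : a hξ ∈ Algebra.adjoin k {a hξ, c hξ} := Algebra.subset_adjoin (.inl rfl)
  have hc : c hξ ∈ Algebra.adjoin k {a hξ, c hξ} := Algebra.subset_adjoin (.inr rfl)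
  induction h using induction_left with
  | one => exact one_mem _
  | add x y hx hy => exact add_mem (hx trivial) (hy trivial)
  | smul s x hx => exact Subalgebra.smul_mem _ (hx trivial) s
  | a_mul x hx => exact mul_mem ha (hx trivial)
  | c_mul x hx => exact mul_mem hc (hx trivial)

lemma a_pow_val_add (m n : ZMod 4) :
    a hξ ^ (m + n).val = a hξ ^ m.val * a hξ ^ n.val :=
  pow_val_add (relations hξ).aaaa m n

lemma a_pow_val_one : a hξ ^ ZMod.val (1 : ZMod 4) = a hξ := pow_one _

lemma span_a_pow_eq_top : Submodule.span k (Set.range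
    (Sum.elim (fun n : ZMod 4 => a hξ ^ n.val) fun n : ZMod 4 => a hξ ^ n.val * c hξ)) = ⊤ := by
  rw [eq_top_iff, ← span_eq_top]
  refine Submodule.span_mono ?_
  simp only [Set.insert_subset_iff, Set.singleton_subset_iff, b_eq, d_eq]
  refine ⟨⟨.inl 0, pow_zero _⟩, ⟨.inl 1, pow_one _⟩, ⟨.inr 2, ?_⟩, ⟨.inr 0, ?_⟩, ⟨.inl 3, ?_⟩,
    ⟨.inl 2, rfl⟩, ⟨.inr 3, ?_⟩, ⟨.inr 1, ?_⟩⟩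
  · change a hξ ^ 2 * c hξ = _
    rw [sq, mul_assoc]
  · change a hξ ^ 0 * c hξ = _
    rw [pow_zero, one_mul]
  · exact pow_three _
  · change a hξ ^ 3 * c hξ = _
    rw [pow_three]
    simp only [mul_assoc]
  · change a hξ ^ 1 * c hξ = _
    rw [pow_one]

lemma exists_coords (h : KAlg hξ) : ∃ s t : ZMod 4 → k,
    h = ∑ n, (s n • a hξ ^ n.val + t n • (a hξ ^ n.val * c hξ)) := by
  obtain ⟨s, hs⟩ := (Submodule.mem_span_range_iff_exists_fun k).1
    (span_a_pow_eq_top hξ ▸ Submodule.mem_top : h ∈ Submodule.span k _)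
  refine ⟨s ∘ .inl, s ∘ .inr, ?_⟩
  rw [← hs, Fintype.sum_sum_type, Finset.sum_add_distrib]
  rfl

lemma finrank_le : Module.finrank k (KAlg hξ) ≤ 8 := by
  rw [← finrank_top, ← span_a_pow_eq_top]
  exact finrank_range_le_card _

end generators

section functionals

lemma gFun_mul (m n : KAlg hξ) : gFun hξ (m * n) = gFun hξ m * gFun hξ n := by
  simp [gFun]

lemma gFun_one : gFun hξ 1 = 1 := by simp [gFun]

lemma lift_xRep_apply (r : k) (m : KAlg hξ) :
    lift hξ (xRep_relations hξ r) m = !![counit (R := k) m, xFun hξ r m; 0, gFun hξ m] := by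
  suffices lift hξ (xRep_relations hξ r) m 0 0 = counit (R := k) m ∧
      lift hξ (xRep_relations hξ r) m 1 0 = 0 ∧
      lift hξ (xRep_relations hξ r) m 1 1 = gFun hξ m by
    ext i j
    fin_cases i <;> fin_cases j
    exacts [this.1, rfl, this.2.1, this.2.2]
  have ha₁ : gFun hξ (a hξ) = ξ ^ 3 := lift_a hξ (gFun_relations hξ)
  induction m using induction_left with
  | one => simp [gFun_one]
  | add x y hx hy => simp [hx, hy]
  | smul r x hx => simp [hx]
  | a_mul x hx =>
    simp [Matrix.mul_apply, hx, Bialgebra.counit_mul, counit_a, gFun_mul, ha₁]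
  | c_mul x hx =>
    simp [Matrix.mul_apply, hx, Bialgebra.counit_mul, counit_c, gFun_mul, gFun_values]

lemma xFun_mul (r : k) (m n : KAlg hξ) :
    xFun hξ r (m * n) = counit (R := k) m * xFun hξ r n + xFun hξ r m * gFun hξ n := by
  have hmul := congrFun₂ (map_mul (lift hξ (xRep_relations hξ r)) m n) 0 1
  rwa [lift_xRep_apply, lift_xRep_apply, lift_xRep_apply, Matrix.mul_apply,
    Fin.sum_univ_two] at hmul

lemma slice_gFun_mul (m n : KAlg hξ) :
    slice (gFun hξ) (m * n) = slice (gFun hξ) m * slice (gFun hξ) n := by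
  simpa [slice] using slice_mul (f := gFun hξ) (f₁ := gFun hξ) (f₂ := gFun hξ) (g₁ := 0) (g₂ := 0)
    (by simp [gFun_mul]) m n

lemma slice_xFun_mul (r : k) (m n : KAlg hξ) :
    slice (xFun hξ r) (m * n) =
      m * slice (xFun hξ r) n + slice (xFun hξ r) m * slice (gFun hξ) n := by
  rw [slice_mul (xFun_mul hξ r), slice_counit]

lemma slice_gFun_a : slice (gFun hξ) (a hξ) = (-ξ) • a hξ := by
  simp [slice, comul_a, gFun_values, xi_inv hξ]

lemma slice_gFun_c : slice (gFun hξ) (c hξ) = (-ξ) • c hξ := by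
  simp [slice, comul_c, gFun_values, xi_inv hξ]

lemma slice_xFun_a (r : k) : slice (xFun hξ r) (a hξ) = (r * ξ) • b hξ := by
  simp [slice, comul_a, xFun_values]

lemma slice_xFun_c (r : k) : slice (xFun hξ r) (c hξ) = (r * ξ) • d hξ := by
  simp [slice, comul_c, xFun_values]

lemma slice_gFun_a_pow (n : ZMod 4) :
    slice (gFun hξ) (a hξ ^ n.val) = rootPow ξ (-n) • a hξ ^ n.val := by
  have hpow (m : ℕ) : slice (gFun hξ) (a hξ ^ m) = (-ξ) ^ m • a hξ ^ m := by
    induction m with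
    | zero => simp [slice_one, gFun_one]
    | succ m ih => rw [pow_succ, slice_gFun_mul, ih, slice_gFun_a, smul_mul_smul_comm, ← pow_succ]
  rw [hpow, rootPow_neg hξ, rootPow, ← inv_pow, xi_inv hξ]

lemma slice_gFun_a_pow_mul_c (n : ZMod 4) :
    slice (gFun hξ) (a hξ ^ n.val * c hξ) = rootPow ξ (-(n + 1)) • (a hξ ^ n.val * c hξ) := by
  rw [slice_gFun_mul, slice_gFun_a_pow, slice_gFun_c, smul_mul_smul_comm, neg_add,
    rootPow_add hξ, rootPow_neg hξ 1, rootPow_one, xi_inv hξ]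

lemma slice_xFun_a_pow (r : k) (n : ZMod 4) :
    slice (xFun hξ r) (a hξ ^ n.val) =
      (r * ξ / 2 * (1 - rootPow ξ (2 * n))) • (a hξ ^ (n + 1).val * c hξ) := by
  have hhalf : (1 / 2 + 1 / 2 : k) = 1 := by
    rw [← add_div, one_add_one_eq_two, div_self (two_ne_zero_of_isPrimitiveRoot hξ)]
  have hpow (m : ℕ) : slice (xFun hξ r) (a hξ ^ m) =
      (r * ξ / 2 * (1 - (-1) ^ m)) • (a hξ ^ (m + 1) * c hξ) := by
    induction m with
    | zero => simp [slice_one, xFun_values]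
    | succ m ih =>
      rw [pow_succ, slice_xFun_mul, ih, slice_xFun_a, slice_gFun_a, b_eq, smul_mul_smul_comm,
        mul_assoc _ (c hξ), c_mul_a, mul_smul_comm, mul_smul_comm, pow_succ _ (m + 1), pow_succ _ m]
      simp only [← mul_assoc, smul_smul, ← add_smul]
      congr 1
      linear_combination r * ξ / 2 * (1 - (-1) ^ m) * xi_sq hξ - r * ξ * hhalf
  rw [hpow, rootPow_two_mul hξ, rootPow_sq hξ, a_pow_val_add, a_pow_val_one, pow_succ]

lemma slice_xFun_a_pow_mul_c (r : k) (n : ZMod 4) :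
    slice (xFun hξ r) (a hξ ^ n.val * c hξ) = (r * ξ) • a hξ ^ (n + 3).val := by
  rw [slice_xFun_mul, slice_xFun_a_pow, slice_xFun_c, slice_gFun_c, smul_mul_smul_comm,
    mul_assoc _ (c hξ), (relations hξ).cc, mul_zero, smul_zero, add_zero, mul_smul_comm, d_eq,
    a_pow_val_add]
  simp only [← pow_three]
  rfl

end functionals

section dual

variable {r : k} (hr : r ^ 2 = 2)
include hr

lemma dual_induction (W : Submodule k (Module.Dual k (KAlg hξ)))
    (counit_mem : counit ∈ W) (gFun_mem : ∀ f ∈ W, dualMul (gFun hξ) f ∈ W)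
    (xFun_mem : ∀ f ∈ W, dualMul (xFun hξ r) f ∈ W) (f : Module.Dual k (KAlg hξ)) : f ∈ W := by
  suffices hV : W.dualCoannihilator = ⊥ by
    rw [← Subspace.dualCoannihilator_dualAnnihilator_eq (W := W), hV,
      Submodule.dualAnnihilator_bot]
    trivial
  have hrξ : r * ξ ≠ 0 := mul_ne_zero
    (fun h => two_ne_zero_of_isPrimitiveRoot hξ (by rw [← hr, h, zero_pow two_ne_zero]))
    (hξ.ne_zero four_ne_zero)
  have slice_mem {f} (hf : ∀ g ∈ W, dualMul f g ∈ W) :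
      ∀ h ∈ W.dualCoannihilator, slice f h ∈ W.dualCoannihilator := fun h hh => by
    simp only [Submodule.mem_dualCoannihilator, dualMul_eq_comp_slice] at hh hf ⊢
    exact fun g hg => hh _ (hf g hg)
  have counit_eq_zero {h} (hh : h ∈ W.dualCoannihilator) : counit (R := k) h = 0 :=
    (Submodule.mem_dualCoannihilator _).1 hh _ counit_mem
  refine eq_bot_iff.2 fun h hh => ?_
  obtain ⟨s, t, rfl⟩ := exists_coords hξ h
  have hproj (n : ZMod 4) : s n • a hξ ^ n.val + t (n - 1) • (a hξ ^ (n - 1).val * c hξ) ∈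
      W.dualCoannihilator := by
    have hE := eigenProj_smul_mem (ξ := ξ) (B := slice (gFun hξ)) (slice_mem gFun_mem) (-n) hh
    have h₁ (m : ZMod 4) :=
      eigenProj_smul (B := slice (gFun hξ)) (v := a hξ ^ m.val) hξ (slice_gFun_a_pow hξ m) (-n)
    have h₂ (m : ZMod 4) :=
      eigenProj_smul (B := slice (gFun hξ)) (v := a hξ ^ m.val * c hξ) hξ
        (slice_gFun_a_pow_mul_c hξ m) (-n)
    simpa only [Finset.smul_sum, smul_add, smul_algebra_smul_comm, h₁, h₂, neg_inj,
      ← eq_sub_iff_add_eq, smul_ite, smul_zero, Finset.sum_add_distrib, Finset.sum_ite_eq',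
      Finset.mem_univ, if_true] using hE
  have hs (n : ZMod 4) : s n = 0 := by
    simpa [Bialgebra.counit_mul, counit_a, counit_c, Bialgebra.counit_pow] using
      counit_eq_zero (hproj n)
  have ht (n : ZMod 4) : t n = 0 := by
    have := counit_eq_zero (slice_mem xFun_mem _ (hproj (n + 1)))
    simpa [hs, slice_xFun_a_pow_mul_c, Bialgebra.counit_mul, counit_a, Bialgebra.counit_pow,
      hrξ] using this
  simp [hs, ht]

end dual

section dualLift

variable {R : Type w} [Ring R] [Algebra k R]

/-- The candidate for the algebra map `(𝒦^cop)^* → R` with `g ↦ G` and `x ↦ X`, as a linear map.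
The functionals `g`, `x` act on `𝒦` through the hit action; decomposing `f` into the functionals
dual to the basis `aⁿ`, `aⁿc`, which are eigenvectors of `g`, gives the formula. -/
def dualLift (r : k) (G X : R) : Module.Dual k (KAlg hξ) →ₗ[k] R :=
  ∑ n : ZMod 4, ((Module.Dual.eval k _ (a hξ ^ n.val)).smulRight (eigenProj ξ G (-n)) -
    (r * ξ / 2) • (Module.Dual.eval k _ (a hξ ^ n.val * c hξ)).smulRight
      (eigenProj ξ G (-(n + 1)) * X))

variable {r : k} {G X : R}

lemma dualLift_apply (f : Module.Dual k (KAlg hξ)) : dualLift hξ r G X f =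
    ∑ n : ZMod 4, (f (a hξ ^ n.val) • eigenProj ξ G (-n) -
      (r * ξ / 2 * f (a hξ ^ n.val * c hξ)) • (eigenProj ξ G (-(n + 1)) * X)) := by
  simp [dualLift, LinearMap.sum_apply, smul_smul]

lemma counit_a_pow (n : ℕ) : counit (R := k) (a hξ ^ n) = 1 := by
  rw [Bialgebra.counit_pow, counit_a, one_pow]

lemma counit_mul_c (h : KAlg hξ) : counit (R := k) (h * c hξ) = 0 := by
  rw [Bialgebra.counit_mul, counit_c, mul_zero]

lemma dualLift_counit : dualLift hξ r G X counit = 1 := by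
  simp only [dualLift_apply, counit_a_pow, counit_mul_c, mul_zero, zero_smul, sub_zero, one_smul]
  rw [← sum_eigenProj hξ G]
  exact Equiv.sum_comp (Equiv.neg _) _

lemma dualLift_gFun_mul (hG : G ^ 4 = 1) (f : Module.Dual k (KAlg hξ)) :
    dualLift hξ r G X (dualMul (gFun hξ) f) = G * dualLift hξ r G X f := by
  simp only [dualLift_apply, dualMul_eq_comp_slice, LinearMap.comp_apply, slice_gFun_a_pow,
    slice_gFun_a_pow_mul_c, map_smul, smul_eq_mul, Finset.mul_sum, mul_sub, mul_smul_comm,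
    ← mul_assoc G, mul_eigenProj hξ hG, smul_mul_assoc, smul_smul]
  refine Finset.sum_congr rfl fun n _ => ?_
  ring_nf

/- Both sides are sums of terms in `eigenProj` and in `eigenProj * X`; the former are matched by
the shift `n ↦ n + 1`, the latter by `n ↦ n + 3`. -/
lemma dualLift_xFun_mul (hr : r ^ 2 = 2) (hG : G ^ 4 = 1) (hX : X ^ 2 = G ^ 2 - 1)
    (hXG : X * G = -(G * X)) (f : Module.Dual k (KAlg hξ)) :
    dualLift hξ r G X (dualMul (xFun hξ r) f) = X * dualLift hξ r G X f := by
  have hrξ : r * ξ / 2 * (r * ξ) = -1 := by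
    rw [div_mul_eq_mul_div, div_eq_iff (two_ne_zero_of_isPrimitiveRoot hξ)]
    linear_combination ξ ^ 2 * hr + 2 * xi_sq hξ
  have hXEX (n : ZMod 4) : X * (eigenProj ξ G (-(n + 1)) * X) =
      (rootPow ξ (2 * (1 - n)) - 1) • eigenProj ξ G (1 - n) := by
    rw [← mul_assoc, mul_eigenProj_of_anticommute hξ hXG, mul_assoc, ← sq,
      show -(n + 1) + 2 = 1 - n by ring, eigenProj_mul_sq hξ hG hX]
  have hshift₁ : ∑ n : ZMod 4, (r * ξ / 2 * (1 - rootPow ξ (2 * n)) *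
        f (a hξ ^ (n + 1).val * c hξ)) • eigenProj ξ G (-n) =
      -∑ n : ZMod 4, (r * ξ / 2 * f (a hξ ^ n.val * c hξ)) •
        (rootPow ξ (2 * (1 - n)) - 1) • eigenProj ξ G (1 - n) := by
    rw [← Finset.sum_neg_distrib]
    refine Fintype.sum_equiv (Equiv.addRight 1) _ _ fun n => ?_
    rw [Equiv.coe_addRight, show 2 * (1 - (n + 1)) = 2 * n by revert n; decide,
      show 1 - (n + 1) = -n by ring, smul_smul, ← neg_smul]
    ring_nf
  have hshift₂ : ∑ n : ZMod 4, f (a hξ ^ (n + 3).val) • (eigenProj ξ G (-(n + 1)) * X) =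
      ∑ n : ZMod 4, f (a hξ ^ n.val) • (X * eigenProj ξ G (-n)) := by
    refine Fintype.sum_equiv (Equiv.addRight 3) _ _ fun n => ?_
    rw [Equiv.coe_addRight, mul_eigenProj_of_anticommute hξ hXG,
      show -(n + 3) + 2 = -(n + 1) by ring]
  calc dualLift hξ r G X (dualMul (xFun hξ r) f)
    _ = ∑ n : ZMod 4, (r * ξ / 2 * (1 - rootPow ξ (2 * n)) * f (a hξ ^ (n + 1).val * c hξ)) •
          eigenProj ξ G (-n) +
        ∑ n : ZMod 4, f (a hξ ^ (n + 3).val) • (eigenProj ξ G (-(n + 1)) * X) := by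
      simp only [dualLift_apply, dualMul_eq_comp_slice, LinearMap.comp_apply, slice_xFun_a_pow,
        slice_xFun_a_pow_mul_c, map_smul, smul_eq_mul, ← mul_assoc, hrξ, neg_one_mul, neg_smul,
        sub_neg_eq_add, Finset.sum_add_distrib]
    _ = X * dualLift hξ r G X f := by
      rw [hshift₁, hshift₂, dualLift_apply, Finset.mul_sum, neg_add_eq_sub,
        ← Finset.sum_sub_distrib]
      refine Finset.sum_congr rfl fun n _ => ?_
      rw [mul_sub X, mul_smul_comm, mul_smul_comm, hXEX]

lemma isDualAlgHom_dualLift (hr : r ^ 2 = 2) (hG : G ^ 4 = 1) (hX : X ^ 2 = G ^ 2 - 1)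
    (hXG : X * G = -(G * X)) : IsDualAlgHom (dualLift hξ r G X) where
  map_counit := dualLift_counit hξ
  map_dualMul f f' := by
    let W : Submodule k (Module.Dual k (KAlg hξ)) :=
      LinearMap.eqLocus (dualLift hξ r G X ∘ₗ dualMul.flip f')
        (LinearMap.mulRight k (dualLift hξ r G X f') ∘ₗ dualLift hξ r G X)
    have mem_W (f) : f ∈ W ↔
        dualLift hξ r G X (dualMul f f') = dualLift hξ r G X f * dualLift hξ r G X f' := Iff.rfl
    refine dual_induction hξ hr W ?_ (fun f hf => ?_) (fun f hf => ?_) f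
    · rw [mem_W, counit_dualMul, dualLift_counit, one_mul]
    · rw [mem_W] at hf ⊢
      rw [dualMul_assoc, dualLift_gFun_mul hξ hG, hf, dualLift_gFun_mul hξ hG, mul_assoc]
    · rw [mem_W] at hf ⊢
      rw [dualMul_assoc, dualLift_xFun_mul hξ hr hG hX hXG, hf,
        dualLift_xFun_mul hξ hr hG hX hXG, mul_assoc]

end dualLift

section twist

variable (r : k)

lemma comul₃_a : comul₃ (k := k) (a hξ) = a hξ ⊗ₜ[k] (a hξ ⊗ₜ[k] a hξ) +
    a hξ ⊗ₜ[k] (b hξ ⊗ₜ[k] c hξ) + b hξ ⊗ₜ[k] (c hξ ⊗ₜ[k] a hξ) +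
    b hξ ⊗ₜ[k] (d hξ ⊗ₜ[k] c hξ) := by
  simp only [comul₃, LinearMap.comp_apply, comul_a, comul_c, map_add, LinearMap.lTensor_tmul,
    TensorProduct.tmul_add]
  abel

lemma comul₃_c : comul₃ (k := k) (c hξ) = c hξ ⊗ₜ[k] (a hξ ⊗ₜ[k] a hξ) +
    c hξ ⊗ₜ[k] (b hξ ⊗ₜ[k] c hξ) + d hξ ⊗ₜ[k] (c hξ ⊗ₜ[k] a hξ) +
    d hξ ⊗ₜ[k] (d hξ ⊗ₜ[k] c hξ) := by
  simp only [comul₃, LinearMap.comp_apply, comul_a, comul_c, map_add, LinearMap.lTensor_tmul,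
    TensorProduct.tmul_add]
  abel

lemma coad_gFun (u v : KAlg hξ) : coad u v (gFun hξ) =
    (gFun hξ (antipodeMap hξ u) * gFun hξ v) • gFun hξ := by
  ext m
  change gFun hξ (antipodeMap hξ u * (m * v)) = _
  simp only [gFun_mul, LinearMap.smul_apply, smul_eq_mul]
  ring

lemma coad_xFun (u v : KAlg hξ) : coad u v (xFun hξ r) =
    (counit (R := k) u * xFun hξ r v) • counit + (counit (R := k) u * gFun hξ v) • xFun hξ r +
      (xFun hξ r (antipodeMap hξ u) * gFun hξ v) • gFun hξ := by
  ext m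
  change xFun hξ r (antipodeMap hξ u * (m * v)) = _
  have hu : counit (R := k) (antipodeMap hξ u) = counit (R := k) u :=
    HopfAlgebra.counit_antipode (R := k) u
  simp only [xFun_mul, gFun_mul, hu, LinearMap.add_apply, LinearMap.smul_apply, smul_eq_mul]
  ring

lemma twist_a_gFun : twist (a hξ) (gFun hξ) = gFun hξ ⊗ₜ[k] a hξ := by
  simp [twist_apply, comul₃_a, coad_gFun, antipodeMap_a, antipodeMap_b, gFun_values, xi_inv hξ,
    ← pow_two, xi_sq hξ]

lemma twist_c_gFun : twist (c hξ) (gFun hξ) = (-1 : k) • (gFun hξ ⊗ₜ[k] c hξ) := by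
  simp [twist_apply, comul₃_c, coad_gFun, antipodeMap_c, antipodeMap_d, gFun_values, xi_inv hξ,
    ← pow_two, xi_sq hξ, ← TensorProduct.smul_tmul']

lemma twist_a_xFun : twist (a hξ) (xFun hξ r) = -ξ • (xFun hξ r ⊗ₜ[k] a hξ) +
    (r * ξ) • (counit (R := k) ⊗ₜ[k] b hξ) + (r * ξ) • (gFun hξ ⊗ₜ[k] c hξ) := by
  simp only [twist_apply, comul₃_a, coad_xFun, antipodeMap_a, antipodeMap_b, map_add, map_smul,
    twistCore_tmul, gFun_values, xFun_values, counit_a, counit_b, xi_inv hξ, smul_eq_mul,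
    mul_zero, zero_mul, zero_smul, add_zero, zero_add, TensorProduct.zero_tmul,
    ← TensorProduct.smul_tmul', one_mul]
  match_scalars <;> grind [xi_sq hξ]

lemma twist_c_xFun : twist (c hξ) (xFun hξ r) = -ξ • (xFun hξ r ⊗ₜ[k] c hξ) +
    (r * ξ) • (counit (R := k) ⊗ₜ[k] d hξ) - (r * ξ) • (gFun hξ ⊗ₜ[k] a hξ) := by
  simp only [twist_apply, comul₃_c, coad_xFun, antipodeMap_c, antipodeMap_d, map_add, map_smul,
    twistCore_tmul, gFun_values, xFun_values, counit_c, counit_d, xi_inv hξ, smul_eq_mul,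
    mul_zero, zero_mul, zero_smul, add_zero, zero_add, TensorProduct.zero_tmul,
    ← TensorProduct.smul_tmul', one_mul]
  match_scalars <;> grind [xi_sq hξ]

end twist

section presentation

variable {R : Type w} [Ring R] [Algebra k R] {r : k} {A C G X : R}

/-- The relations between the generators `a, c, g, x` of the double of `𝒦^cop`; the other two
generators of `𝒦` are `b = a²c` and `d = a³`. -/
structure DoubleRelations (ξ r : k) (A C G X : R) : Prop where
  aaaa : A ^ 4 = 1
  cc : C * C = 0
  ac : A * C = ξ • (C * A)
  gggg : G ^ 4 = 1
  xx : X ^ 2 = G ^ 2 - 1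
  xg : X * G = -(G * X)
  ag : A * G = G * A
  cg : C * G = -(G * C)
  ax : A * X = -ξ • (X * A) + (r * ξ) • (A ^ 2 * C) + (r * ξ) • (G * C)
  cx : C * X = -ξ • (X * C) + (r * ξ) • A ^ 3 - (r * ξ) • (G * A)

lemma Relations.of_a_c (hξ : IsPrimitiveRoot ξ 4) (hA : A ^ 4 = 1) (hC : C * C = 0)
    (hAC : A * C = ξ • (C * A)) : Relations ξ A (A ^ 2 * C) C (A ^ 3) := by
  have hA₄ (Y : R) : A * (A * (A * (A * Y))) = Y := by
    simpa only [pow_succ, pow_zero, one_mul, mul_assoc] using congrArg (· * Y) hA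
  have hCA : C * A = -ξ • (A * C) := by
    rw [hAC, smul_smul]
    match_scalars
    linear_combination xi_sq hξ
  have hCA' (Y : R) : C * (A * Y) = -ξ • (A * (C * Y)) := by
    rw [← mul_assoc, hCA, smul_mul_assoc, mul_assoc]
  have hA' : A * (A * (A * A)) = 1 := by rw [← hA₄ 1, mul_one]
  constructor
  all_goals
    simp only [pow_succ, pow_zero, one_mul, mul_assoc, hCA, hCA', hC, hA', hA₄, mul_smul_comm,
      smul_smul, mul_zero, smul_zero]
  all_goals match_scalars; grind [xi_sq hξ]

/-- The restriction to `𝒦` of the algebra map that a solution of the relations of the double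
defines. -/
def algLift (h : DoubleRelations ξ r A C G X) : KAlg hξ →ₐ[k] R :=
  lift hξ (Relations.of_a_c hξ h.aaaa h.cc h.ac)

variable (h : DoubleRelations ξ r A C G X)

lemma algLift_a : algLift hξ h (a hξ) = A := lift_a ..

lemma algLift_b : algLift hξ h (b hξ) = A ^ 2 * C := lift_b ..

lemma algLift_c : algLift hξ h (c hξ) = C := lift_c ..

lemma algLift_d : algLift hξ h (d hξ) = A ^ 3 := lift_d ..

include h

lemma dualLift_gFun : dualLift hξ r G X (gFun hξ) = G := by
  rw [← dualMul_counit (gFun hξ), dualLift_gFun_mul hξ h.gggg, dualLift_counit, mul_one]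

variable (hr : r ^ 2 = 2)
include hr

lemma dualLift_xFun : dualLift hξ r G X (xFun hξ r) = X := by
  rw [← dualMul_counit (xFun hξ r), dualLift_xFun_mul hξ hr h.gggg h.xx h.xg, dualLift_counit,
    mul_one]

lemma DoubleRelations.isDualAlgHom : IsDualAlgHom (dualLift hξ r G X) :=
  isDualAlgHom_dualLift hξ hr h.gggg h.xx h.xg

lemma crossRelation_gFun : CrossRelation (dualLift hξ r G X) (algLift hξ h) (gFun hξ) := by
  have hα := h.isDualAlgHom hξ hr
  intro y
  induction y using induction_right with
  | one => simp [twist_one_left]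
  | add x y hx hy => simp only [map_add, LinearMap.add_apply, hx, hy, add_mul]
  | smul s x hx => simp only [map_smul, LinearMap.smul_apply, hx, smul_mul_assoc]
  | mul_a y hy =>
    rw [twist_mul, twist_a_gFun, mulMap_doubleMul_counit_tmul hα hy, map_mul, mulMap_tmul,
      mul_assoc, algLift_a, dualLift_gFun hξ h, h.ag]
  | mul_c y hy =>
    rw [twist_mul, twist_c_gFun, map_smul, map_smul, mulMap_doubleMul_counit_tmul hα hy, map_mul,
      mulMap_tmul, mul_assoc, algLift_c, dualLift_gFun hξ h, h.cg, mul_neg, neg_one_smul]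

lemma crossRelation_xFun : CrossRelation (dualLift hξ r G X) (algLift hξ h) (xFun hξ r) := by
  have hα := h.isDualAlgHom hξ hr
  have hcounit := CrossRelation.counit hα (β := algLift hξ h)
  have hg := crossRelation_gFun hξ h hr
  intro y
  induction y using induction_right with
  | one => simp [twist_one_left]
  | add x y hx hy => simp only [map_add, LinearMap.add_apply, hx, hy, add_mul]
  | smul s x hx => simp only [map_smul, LinearMap.smul_apply, hx, smul_mul_assoc]
  | mul_a y hy =>
    rw [twist_mul, twist_a_xFun]
    simp only [map_add, map_smul, mulMap_doubleMul_counit_tmul hα, hy, hcounit y, hg y,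
      mulMap_tmul, map_mul, algLift_a, algLift_b, algLift_c, dualLift_gFun hξ h,
      dualLift_xFun hξ h hr, dualLift_counit, one_mul, mul_assoc _ A, h.ax, mul_add, mul_smul_comm]
  | mul_c y hy =>
    rw [twist_mul, twist_c_xFun]
    simp only [map_add, map_sub, map_smul, mulMap_doubleMul_counit_tmul hα, hy, hcounit y, hg y,
      mulMap_tmul, map_mul, algLift_a, algLift_c, algLift_d, dualLift_gFun hξ h,
      dualLift_xFun hξ h hr, dualLift_counit, one_mul, mul_assoc _ C, h.cx, mul_add, mul_sub,
      mul_smul_comm]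

lemma crossRelation (f : Module.Dual k (KAlg hξ)) :
    CrossRelation (dualLift hξ r G X) (algLift hξ h) f := by
  have hα := h.isDualAlgHom hξ hr
  let W : Submodule k (Module.Dual k (KAlg hξ)) := ⨅ y : KAlg hξ, LinearMap.eqLocus
    (mulMap (dualLift hξ r G X) (algLift hξ h) ∘ₗ twist y)
    (LinearMap.mulLeft k (algLift hξ h y) ∘ₗ dualLift hξ r G X)
  have mem_W (f) : f ∈ W ↔ CrossRelation (dualLift hξ r G X) (algLift hξ h) f := by
    simp [W, Submodule.mem_iInf, LinearMap.mem_eqLocus, CrossRelation]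
  refine (mem_W f).1 (dual_induction hξ hr W ((mem_W _).2 (.counit hα)) ?_ ?_ f)
  · exact fun f hf => (mem_W _).2 (.dualMul hα (crossRelation_gFun hξ h hr) ((mem_W f).1 hf))
  · exact fun f hf => (mem_W _).2 (.dualMul hα (crossRelation_xFun hξ h hr) ((mem_W f).1 hf))

omit h in
/-- The algebra map from the double with `a ↦ A`, `c ↦ C`, `g ↦ G` and `x ↦ X`. -/
def D.lift (h : DoubleRelations ξ r A C G X) : D hξ →ₐ[k] R :=
  DoubleCop.lift (h.isDualAlgHom hξ hr) (crossRelation hξ h hr)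

lemma D.lift_bowtie (f : Module.Dual k (KAlg hξ)) (y : KAlg hξ) :
    D.lift hξ hr h (bowtie f y) = dualLift hξ r G X f * algLift hξ h y := rfl

lemma D.lift_ofK (y : KAlg hξ) : D.lift hξ hr h (D.ofK y) = algLift hξ h y := by
  rw [D.ofK, D.lift_bowtie, dualLift_counit, one_mul]

lemma D.lift_ofDual (f : Module.Dual k (KAlg hξ)) :
    D.lift hξ hr h (D.ofDual f) = dualLift hξ r G X f := by
  rw [D.ofDual, D.lift_bowtie, map_one, mul_one]

lemma D.lift_actsBy : ActsBy hξ r (D.lift hξ hr h) A (A ^ 2 * C) C (A ^ 3) X G where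
  map_a := by rw [D.lift_ofK, algLift_a]
  map_b := by rw [D.lift_ofK, algLift_b]
  map_c := by rw [D.lift_ofK, algLift_c]
  map_d := by rw [D.lift_ofK, algLift_d]
  map_x := by rw [D.lift_ofDual, dualLift_xFun hξ h hr]
  map_g := by rw [D.lift_ofDual, dualLift_gFun hξ h]

end presentation

section generators

variable (r : k)

/-- The generators `a, c, g, x` of the double. -/
def D.gens : Set (D hξ) :=
  {D.ofK (a hξ), D.ofK (c hξ), D.ofDual (gFun hξ), D.ofDual (xFun hξ r)}

variable {r} (hr : r ^ 2 = 2)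
include hr

lemma D.adjoin_gens : Algebra.adjoin k (D.gens hξ r) = ⊤ := by
  set S := Algebra.adjoin k (D.gens hξ r)
  have hgens : D.gens hξ r ⊆ S := Algebra.subset_adjoin
  have hK (y : KAlg hξ) : inclRight k y ∈ S := by
    have : (⊤ : Subalgebra k (KAlg hξ)) ≤ S.comap (inclRight k) := by
      rw [← adjoin_a_c, Algebra.adjoin_le_iff]
      rintro _ (rfl | rfl)
      exacts [hgens (.inl rfl), hgens (.inr (.inl rfl))]
    exact this trivial
  have hDual (f : Module.Dual k (KAlg hξ)) : inclLeft (KAlg hξ) f ∈ S := by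
    refine dual_induction hξ hr (S.toSubmodule.comap (inclLeft (KAlg hξ))) S.one_mem
      (fun f hf => ?_) (fun f hf => ?_) f
    all_goals
      change bowtie _ 1 ∈ S
      rw [bowtie_dualMul_one]
    exacts [S.mul_mem (hgens (by simp [D.gens, D.ofDual])) hf,
      S.mul_mem (hgens (by simp [D.gens, D.ofDual])) hf]
  refine eq_top_iff.2 fun Y _ => ?_
  induction Y using induction_bowtie with
  | zero => exact S.zero_mem
  | add Y Z hY hZ => exact S.add_mem (hY trivial) (hZ trivial)
  | bowtie f y => exact bowtie_eq_mul f y ▸ S.mul_mem (hDual f) (hK y)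

lemma ActsBy.ext {R : Type w} [Ring R] [Algebra k R] {ρ σ : D hξ →ₐ[k] R} {A B C E X G : R}
    (hρ : ActsBy hξ r ρ A B C E X G) (hσ : ActsBy hξ r σ A B C E X G) : ρ = σ := by
  refine AlgHom.ext_of_adjoin_eq_top (D.adjoin_gens hξ hr) ?_
  rintro _ (rfl | rfl | rfl | rfl)
  exacts [hρ.map_a.trans hσ.map_a.symm, hρ.map_c.trans hσ.map_c.symm,
    hρ.map_g.trans hσ.map_g.symm, hρ.map_x.trans hσ.map_x.symm]

omit hr in
lemma ActsBy.comp {R : Type w} {S : Type v} [Ring R] [Algebra k R] [Ring S] [Algebra k S]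
    {ρ : D hξ →ₐ[k] R} {A B C E X G : R} (h : ActsBy hξ r ρ A B C E X G) (φ : R →ₐ[k] S) :
    ActsBy hξ r (φ.comp ρ) (φ A) (φ B) (φ C) (φ E) (φ X) (φ G) where
  map_a := congrArg φ h.map_a
  map_b := congrArg φ h.map_b
  map_c := congrArg φ h.map_c
  map_d := congrArg φ h.map_d
  map_x := congrArg φ h.map_x
  map_g := congrArg φ h.map_g

end generators

/-! ### The modules -/

section tensor

variable {R : Type w} [Ring R] [Algebra k R] {r : k} {A C G X : R}

lemma doubleRelations_character (hξ : IsPrimitiveRoot ξ 4) (ℓ : ZMod 4) :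
    DoubleRelations ξ r (rootPow ξ ℓ) 0 (rootPow ξ (2 * ℓ)) 0 := by
  have hℓ := rootPow_pow_four hξ ℓ
  rw [rootPow_two_mul hξ]
  constructor <;> (try simp only [smul_eq_mul]) <;> grind

lemma DoubleRelations.rootPow_smul (hξ : IsPrimitiveRoot ξ 4) (h : DoubleRelations ξ r A C G X)
    (ℓ : ZMod 4) :
    DoubleRelations ξ r (rootPow ξ ℓ • A) (rootPow ξ (-ℓ) • C) (rootPow ξ (2 * ℓ) • G) X := by
  have hℓ := rootPow_pow_four hξ ℓ
  have hinv := rootPow_neg_mul_self hξ ℓ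
  rw [rootPow_two_mul hξ]
  constructor <;>
    simp only [smul_mul_assoc, mul_smul_comm, smul_smul, smul_pow, h.aaaa, h.cc, h.ac, h.gggg, h.xx,
      h.xg, h.ag, h.cg, h.ax, h.cx, smul_zero] <;>
    match_scalars <;> grind

lemma dualLift_rootPow_smul (m : ZMod 4) (f : Module.Dual k (KAlg hξ)) :
    dualLift hξ r (rootPow ξ m • G) X f =
      dualLift hξ r G X (f ∘ₗ LinearMap.mulLeft k (a hξ ^ (-m).val)) := by
  simp only [dualLift_apply, eigenProj_rootPow_smul hξ]
  refine (Fintype.sum_equiv (Equiv.addLeft (-m)) _ _ fun n => ?_).symm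
  rw [Equiv.coe_addLeft, show -(-m + n) - m = -n by ring,
    show -(-m + n + 1) - m = -(n + 1) by ring]
  simp only [LinearMap.comp_apply, LinearMap.mulLeft_apply, a_pow_val_add, mul_assoc]

lemma dualLift_rootPow (m : ZMod 4) (f : Module.Dual k (KAlg hξ)) :
    dualLift hξ r (rootPow ξ m) 0 f = f (a hξ ^ (-m).val) := by
  have hproj (n : ZMod 4) : eigenProj ξ (1 : k) (-n) = if n = 0 then 1 else 0 := by
    simpa [eq_comm] using eigenProj_smul hξ (B := (1 : k)) (v := (1 : k)) (m := 0)
      (by simp [rootPow_zero]) (-n)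
  have h := dualLift_rootPow_smul hξ (r := r) (G := (1 : k)) (X := 0) m f
  rw [smul_eq_mul, mul_one] at h
  simp [h, dualLift_apply, hproj]

variable (hr : r ^ 2 = 2)

/-- The character `χ^ℓ` of the double. -/
def character (ℓ : ZMod 4) : D hξ →ₐ[k] k := D.lift hξ hr (doubleRelations_character hξ ℓ)

lemma character_actsBy (ℓ : ZMod 4) : ActsBy hξ r (character hξ hr ℓ)
    (rootPow ξ ℓ) 0 0 (rootPow ξ (-ℓ)) 0 ((-1) ^ ℓ.val) := by
  have hinv := rootPow_neg_mul_self hξ ℓ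
  have hℓ := rootPow_pow_four hξ ℓ
  convert D.lift_actsBy hξ (doubleRelations_character hξ ℓ) hr using 1
  · rfl
  · simp
  · linear_combination rootPow ξ ℓ ^ 3 * hinv - rootPow ξ (-ℓ) * hℓ
  · rw [rootPow_two_mul hξ, rootPow_sq hξ]

lemma comp_wind_algLift (h : DoubleRelations ξ r A C G X) (ℓ : ZMod 4) :
    (algLift hξ h).comp (wind (algLift hξ (doubleRelations_character (r := r) hξ ℓ))) =
      algLift hξ (h.rootPow_smul hξ ℓ) := by
  have hℓ := rootPow_pow_four hξ ℓ
  have hinv := rootPow_neg_mul_self hξ ℓ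
  refine algHom_ext_ac hξ ?_ ?_
  · simp [wind, comul_a, algLift_a, algLift_b]
  · have hcube : rootPow ξ ℓ ^ 3 = rootPow ξ (-ℓ) := by
      linear_combination rootPow ξ (-ℓ) * hℓ - rootPow ξ ℓ ^ 3 * hinv
    simp [wind, comul_c, algLift_c, algLift_d, hcube]

lemma tensorAct_character {M : Type v} [AddCommGroup M] [Module k M] (φ : R →ₐ[k] Module.End k M)
    (h : DoubleRelations ξ r A C G X) (ℓ : ZMod 4) (Y : D hξ) (v : M) (s : k) :
    tensorAct (φ.comp (D.lift hξ hr h)) (charRep (character hξ hr ℓ)) Y (v ⊗ₜ s) =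
      φ (D.lift hξ hr (h.rootPow_smul hξ ℓ) Y) v ⊗ₜ s := by
  induction Y using induction_bowtie with
  | zero => simp
  | add Y Z hY hZ => simp only [map_add, LinearMap.add_apply, hY, hZ, TensorProduct.add_tmul]
  | bowtie f y =>
    have hχ (f y) : character hξ hr ℓ (bowtie f y) =
        f (a hξ ^ (-(2 * ℓ)).val) * algLift hξ (doubleRelations_character (r := r) hξ ℓ) y := by
      rw [character, D.lift_bowtie, dualLift_rootPow]
    rw [tensorAct_charRep_bowtie _ hχ, AlgHom.comp_apply, D.lift_bowtie, D.lift_bowtie,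
      dualLift_rootPow_smul, ← comp_wind_algLift, AlgHom.comp_apply]

end tensor

section matrices

lemma doubleRelations_twoDim (hξ : IsPrimitiveRoot ξ 4) {r : k} (hr : r ^ 2 = 2) {s t : k}
    (hs : s ^ 4 = 1) (ht : t ^ 4 = 1) :
    DoubleRelations ξ r (R := Matrix (Fin 2) (Fin 2) k)
      !![s, 0; 0, -ξ * s] !![0, 1; 0, 0] !![t, 0; 0, -t]
      !![0, r / 2 * ξ * (s + s ^ 3 * t); r * ξ * (s ^ 3 - s * t), 0] := by
  have h2 := two_ne_zero_of_isPrimitiveRoot hξ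
  have hξ2 := xi_sq hξ
  have hhalf : r * (r / 2) = 1 := by
    rw [← mul_div_assoc, ← sq, hr, div_self h2]
  have hone : (1 : Matrix (Fin 2) (Fin 2) k) = !![1, 0; 0, 1] := Matrix.one_fin_two
  constructor <;> simp [pow_succ, hone, funext_iff, Fin.forall_fin_succ, ← Matrix.ext_iff] <;>
    grind

lemma doubleRelations_fourDim (hξ : IsPrimitiveRoot ξ 4) (r : k) :
    DoubleRelations ξ r (R := Matrix (Fin 4) (Fin 4) k)
      !![1, 0, 0, 0; 0, -ξ, 0, 0; 0, 0, ξ, 0; 0, 0, 0, 1]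
      !![0, 0, 0, 0; 0, 0, 0, 0; -1, 0, 0, 0; 0, ξ, 0, 0]
      !![1, 0, 0, 0; 0, -1, 0, 0; 0, 0, -1, 0; 0, 0, 0, 1]
      !![0, 0, 0, 0; 1, 0, 0, 0; r, 0, 0, 0; 0, -r, 1, 0] := by
  have hξ2 := xi_sq hξ
  have hone : (1 : Matrix (Fin 4) (Fin 4) k) =
      !![1, 0, 0, 0; 0, 1, 0, 0; 0, 0, 1, 0; 0, 0, 0, 1] := by
    ext i j; fin_cases i <;> fin_cases j <;> rfl
  constructor <;> simp [pow_succ, hone, funext_iff, Fin.forall_fin_succ, ← Matrix.ext_iff] <;>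
    grind

end matrices

section weight

variable {M : Type w} [AddCommGroup M] [Module k M] [Module (D hξ) M]

/-- `HasWeight hξ (i, j) v`: the group-likes `a` and `g` act on `v` by `ξⁱ` and `ξʲ`. The zero
vector has every weight. -/
structure HasWeight (p : ZMod 4 × ZMod 4) (v : M) : Prop where
  a_smul : D.ofK (a hξ) • v = rootPow ξ p.1 • v
  g_smul : D.ofDual (gFun hξ) • v = rootPow ξ p.2 • v

/-- The element of the double that projects every module onto its vectors of weight `p`. -/
def weightProj (p : ZMod 4 × ZMod 4) : D hξ :=
  eigenProj ξ (D.ofK (a hξ)) p.1 * eigenProj ξ (D.ofDual (gFun hξ)) p.2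

variable {hξ} [IsScalarTower k (D hξ) M] {p : ZMod 4 × ZMod 4} {v : M}

lemma HasWeight.weightProj_smul (h : HasWeight hξ p v) (q : ZMod 4 × ZMod 4) :
    weightProj hξ q • v = if p = q then v else 0 := by
  rw [weightProj, mul_smul, eigenProj_smul hξ h.g_smul]
  by_cases hq : p.2 = q.2
  · simp [hq, eigenProj_smul hξ h.a_smul, Prod.ext_iff]
  · simp [hq, Prod.ext_iff]

lemma HasWeight.map {M' : Type v} [AddCommGroup M'] [Module k M'] [Module (D hξ) M']
    [IsScalarTower k (D hξ) M'] (h : HasWeight hξ p v) (f : M →ₗ[D hξ] M') :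
    HasWeight hξ p (f v) := by
  have hf (s : k) : f (s • v) = s • f v := f.map_smul_of_tower s v
  exact ⟨by rw [← map_smul, h.a_smul, hf], by rw [← map_smul, h.g_smul, hf]⟩

end weight

variable {r : k} (hr : r ^ 2 = 2)

section matRep

variable {n : ℕ} {A C G X : Matrix (Fin n) (Fin n) k}

/-- The representation of the double on column vectors given by matrices for `a`, `c`, `g`, `x`. -/
def matRep (h : DoubleRelations ξ r A C G X) : D hξ →ₐ[k] Module.End k (Fin n → k) :=
  Matrix.toLinAlgEquiv'.toAlgHom.comp (D.lift hξ hr h)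

variable (h : DoubleRelations ξ r A C G X)

lemma matRep_actsBy : ActsBy hξ r (matRep hξ hr h) (Matrix.toLin' A) (Matrix.toLin' (A ^ 2 * C))
    (Matrix.toLin' C) (Matrix.toLin' (A ^ 3)) (Matrix.toLin' X) (Matrix.toLin' G) :=
  (D.lift_actsBy hξ h hr).comp hξ _

variable {hξ hr h}

lemma hasWeight_matRep {p : ZMod 4 × ZMod 4} {m : Fin n}
    (hA : A.col m = rootPow ξ p.1 • Pi.single m 1) (hG : G.col m = rootPow ξ p.2 • Pi.single m 1) :
    HasWeight hξ p (RepModule.of (matRep hξ hr h) (Pi.single m 1)) where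
  a_smul := by
    rw [RepModule.smul_def, (matRep_actsBy hξ hr h).map_a, Matrix.toLin'_apply,
      Matrix.mulVec_single_one, hA, RepModule.smul_of]
  g_smul := by
    rw [RepModule.smul_def, (matRep_actsBy hξ hr h).map_g, Matrix.toLin'_apply,
      Matrix.mulVec_single_one, hG, RepModule.smul_of]

lemma c_smul_matRep (m : Fin n) : D.ofK (c hξ) • RepModule.of (matRep hξ hr h) (Pi.single m 1) =
    RepModule.of (matRep hξ hr h) (C.col m) := by
  rw [RepModule.smul_def, (matRep_actsBy hξ hr h).map_c, Matrix.toLin'_apply,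
    Matrix.mulVec_single_one]

lemma x_smul_matRep (m : Fin n) :
    D.ofDual (xFun hξ r) • RepModule.of (matRep hξ hr h) (Pi.single m 1) =
      RepModule.of (matRep hξ hr h) (X.col m) := by
  rw [RepModule.smul_def, (matRep_actsBy hξ hr h).map_x, Matrix.toLin'_apply,
    Matrix.mulVec_single_one]

end matRep

section family

/-- The representation `V_{i,j}` of the double, for `t = (i, j)`. -/
def twoDim (t : ZMod 4 × ZMod 4) : D hξ →ₐ[k] Module.End k (Fin 2 → k) :=
  matRep hξ hr (doubleRelations_twoDim hξ hr (rootPow_pow_four hξ t.1) (rootPow_pow_four hξ t.2))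

/-- The representation `P` of the double. -/
def fourDim : D hξ →ₐ[k] Module.End k (Fin 4 → k) := matRep hξ hr (doubleRelations_fourDim hξ r)

/-- The representation `P ⊗ k_{χ^ℓ}` of the double, on the underlying space of `P`. -/
def fourDimTwist (ℓ : ZMod 4) : D hξ →ₐ[k] Module.End k (Fin 4 → k) :=
  matRep hξ hr ((doubleRelations_fourDim hξ r).rootPow_smul hξ ℓ)

lemma twoDim_actsBy (i j : ZMod 4) : ActsBy hξ r (twoDim hξ hr (i, j))
    (Matrix.toLin' !![rootPow ξ i, 0; 0, rootPow ξ (i + 3)])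
    (Matrix.toLin' !![0, (-1) ^ i.val; 0, 0])
    (Matrix.toLin' !![0, 1; 0, 0])
    (Matrix.toLin' !![rootPow ξ (-i), 0; 0, rootPow ξ (-i + 1)])
    (Matrix.toLin' !![0, r / 2 * ξ * (rootPow ξ i + rootPow ξ (3 * i + j));
      r * ξ * (rootPow ξ (3 * i) - rootPow ξ (i + j)), 0])
    (Matrix.toLin' !![rootPow ξ j, 0; 0, rootPow ξ (j + 2)]) := by
  have hξ2 := xi_sq hξ
  have hinv := rootPow_neg_mul_self hξ i
  have hi := rootPow_pow_four hξ i
  have hthree : rootPow ξ (3 * i) = rootPow ξ i ^ 3 := by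
    rw [show 3 * i = 2 * i + i by ring, rootPow_add hξ, rootPow_two_mul hξ, ← pow_succ]
  unfold twoDim
  convert matRep_actsBy hξ hr (doubleRelations_twoDim hξ hr hi (rootPow_pow_four hξ j)) using 2 <;>
    simp [pow_succ, rootPow_add hξ, rootPow_one, rootPow_two hξ, rootPow_three hξ, hthree,
      ← rootPow_sq hξ] <;>
    grind

lemma fourDim_actsBy : ActsBy hξ r (fourDim hξ hr)
    (Matrix.toLin' !![1, 0, 0, 0; 0, -ξ, 0, 0; 0, 0, ξ, 0; 0, 0, 0, 1])
    (Matrix.toLin' !![0, 0, 0, 0; 0, 0, 0, 0; 1, 0, 0, 0; 0, ξ, 0, 0])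
    (Matrix.toLin' !![0, 0, 0, 0; 0, 0, 0, 0; -1, 0, 0, 0; 0, ξ, 0, 0])
    (Matrix.toLin' !![1, 0, 0, 0; 0, ξ, 0, 0; 0, 0, -ξ, 0; 0, 0, 0, 1])
    (Matrix.toLin' !![0, 0, 0, 0; 1, 0, 0, 0; r, 0, 0, 0; 0, -r, 1, 0])
    (Matrix.toLin' !![1, 0, 0, 0; 0, -1, 0, 0; 0, 0, -1, 0; 0, 0, 0, 1]) := by
  have hξ2 := xi_sq hξ
  unfold fourDim
  convert matRep_actsBy hξ hr (doubleRelations_fourDim hξ r) using 2 <;> simp [pow_succ] <;> grind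

/-- The family of representations of the double. -/
def repFamily : RepFamily hξ r where
  χ := character hξ hr
  V t := twoDim hξ hr t.1
  P := fourDim hξ hr
  PT ℓ := ((TensorProduct.rid k (Fin 4 → k)).symm.conjAlgEquiv k).toAlgHom.comp
    (fourDimTwist hξ hr ℓ)
  χ_acts := character_actsBy hξ hr
  V_acts i j _ := twoDim_actsBy hξ hr i j
  P_acts := fourDim_actsBy hξ hr
  PT_apply ℓ Y := by
    refine TensorProduct.ext' fun v s => ?_
    refine Eq.trans ?_ (tensorAct_character hξ hr _ (doubleRelations_fourDim hξ r) ℓ Y v s).symm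
    simp [fourDimTwist, matRep, ← TensorProduct.tmul_smul]

lemma repFamily_unique (M : RepFamily hξ r) : M = repFamily hξ hr := by
  have hχ : M.χ = (repFamily hξ hr).χ :=
    funext fun ℓ => ActsBy.ext hξ hr (M.χ_acts ℓ) ((repFamily hξ hr).χ_acts ℓ)
  have hV : M.V = (repFamily hξ hr).V := funext fun t =>
    ActsBy.ext hξ hr (M.V_acts t.1.1 t.1.2 t.2) ((repFamily hξ hr).V_acts t.1.1 t.1.2 t.2)
  have hP : M.P = (repFamily hξ hr).P := ActsBy.ext hξ hr M.P_acts (repFamily hξ hr).P_acts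
  have hPT : M.PT = (repFamily hξ hr).PT := by
    ext1 ℓ; ext1 Y
    rw [M.PT_apply, (repFamily hξ hr).PT_apply, hχ, hP]
  generalize repFamily hξ hr = M' at *
  cases M; cases M'
  simp only at hχ hV hP hPT
  subst hχ hV hP hPT
  rfl

end family

section modules

/-- The module `V_{i,j}`, for `t = (i, j)`. -/
abbrev TwoDim (t : ZMod 4 × ZMod 4) : Type u := RepModule (twoDim hξ hr t)

/-- The module `P ⊗ k_{χ^ℓ}`, on the underlying space of `P`. -/
abbrev FourDim (ℓ : ZMod 4) : Type u := RepModule (fourDimTwist hξ hr ℓ)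

/-- The module `k_{χ^ℓ}`. -/
abbrev OneDim (ℓ : ZMod 4) : Type u := RepModule (charRep (character hξ hr ℓ))

/-- The standard basis of `V_{i,j}`. -/
def TwoDim.e (t : ZMod 4 × ZMod 4) (n : Fin 2) : TwoDim hξ hr t := RepModule.of _ (Pi.single n 1)

/-- The basis of `P ⊗ k_{χ^ℓ}` that is the standard basis `p₁, p₂, p₃, p₄` of `P`, numbered from
`0`. -/
def FourDim.p (ℓ : ZMod 4) (n : Fin 4) : FourDim hξ hr ℓ := RepModule.of _ (Pi.single n 1)

variable {hξ hr}

namespace TwoDim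

variable {t : ZMod 4 × ZMod 4}

lemma eq_add (y : TwoDim hξ hr t) : ∃ s₀ s₁ : k, y = s₀ • e hξ hr t 0 + s₁ • e hξ hr t 1 := by
  obtain ⟨v, rfl⟩ := (RepModule.of (twoDim hξ hr t)).surjective y
  exact ⟨v 0, v 1, (RepModule.of_eq_sum _ v).trans (Fin.sum_univ_two _)⟩

lemma hasWeight_e_zero : HasWeight hξ t (e hξ hr t 0) :=
  hasWeight_matRep (by ext n; fin_cases n <;> simp) (by ext n; fin_cases n <;> simp)

lemma hasWeight_e_one : HasWeight hξ (t + (3, 2)) (e hξ hr t 1) := by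
  refine hasWeight_matRep ?_ ?_
  · rw [Prod.fst_add, rootPow_add hξ, rootPow_three hξ]
    ext n; fin_cases n <;> simp [mul_comm]
  · rw [Prod.snd_add, rootPow_add hξ, rootPow_two hξ]
    ext n; fin_cases n <;> simp

lemma c_smul_e_zero : D.ofK (c hξ) • e hξ hr t 0 = 0 :=
  (c_smul_matRep 0).trans (congrArg (RepModule.of _) (by ext n; fin_cases n <;> rfl))

lemma c_smul_e_one : D.ofK (c hξ) • e hξ hr t 1 = e hξ hr t 0 :=
  (c_smul_matRep 1).trans (congrArg (RepModule.of _) (by ext n; fin_cases n <;> simp))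

lemma x_smul_e_zero : D.ofDual (xFun hξ r) • e hξ hr t 0 =
    (r * ξ * (rootPow ξ t.1 ^ 3 - rootPow ξ t.1 * rootPow ξ t.2)) • e hξ hr t 1 := by
  refine (x_smul_matRep 0).trans ?_
  rw [e, RepModule.smul_of]
  congr 1; ext n; fin_cases n <;> simp

lemma eq_top_of_e_zero_mem (ht : 2 * t.1 ≠ t.2) {N : Submodule (D hξ) (TwoDim hξ hr t)}
    (h₀ : e hξ hr t 0 ∈ N) : N = ⊤ := by
  have hr₀ : r ≠ 0 := fun h =>
    two_ne_zero_of_isPrimitiveRoot hξ (by rw [← hr, h, zero_pow two_ne_zero])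
  have hκ : r * ξ * (rootPow ξ t.1 ^ 3 - rootPow ξ t.1 * rootPow ξ t.2) ≠ 0 := by
    refine mul_ne_zero (mul_ne_zero hr₀ (hξ.ne_zero four_ne_zero)) (sub_ne_zero.2 fun h => ht ?_)
    refine rootPow_injective hξ ((rootPow_two_mul hξ t.1).trans ?_)
    exact mul_left_cancel₀ (rootPow_ne_zero hξ t.1) (by rw [← h, ← pow_succ'])
  have h₁ : e hξ hr t 1 ∈ N := by
    have := N.smul_mem (D.ofDual (xFun hξ r)) h₀
    rwa [x_smul_e_zero, smul_mem_iff_of_ne_zero N hκ] at this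
  refine eq_top_iff.2 fun y _ => ?_
  obtain ⟨s₀, s₁, rfl⟩ := eq_add y
  exact N.add_mem (N.smul_of_tower_mem s₀ h₀) (N.smul_of_tower_mem s₁ h₁)

lemma isSimpleModule (ht : 2 * t.1 ≠ t.2) : IsSimpleModule (D hξ) (TwoDim hξ hr t) := by
  have : Nontrivial (TwoDim hξ hr t) := inferInstanceAs (Nontrivial (Fin 2 → k))
  refine (isSimpleModule_iff ..).2
    ⟨fun N => or_iff_not_imp_left.2 fun hN => eq_top_of_e_zero_mem ht ?_⟩
  obtain ⟨y, hy, hy₀⟩ := N.exists_mem_ne_zero_of_ne_bot hN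
  obtain ⟨s₀, s₁, rfl⟩ := eq_add y
  rcases eq_or_ne s₁ 0 with rfl | hs₁
  · have hs₀ : s₀ ≠ 0 := by rintro rfl; simp at hy₀
    rwa [zero_smul, add_zero, smul_mem_iff_of_ne_zero N hs₀] at hy
  · have := N.smul_mem (D.ofK (c hξ)) hy
    rwa [smul_add, smul_algebra_smul_comm, smul_algebra_smul_comm, c_smul_e_zero, c_smul_e_one,
      smul_zero, zero_add, smul_mem_iff_of_ne_zero N hs₁] at this

end TwoDim

namespace FourDim

variable {ℓ : ZMod 4}

lemma eq_add (y : FourDim hξ hr ℓ) : ∃ s : Fin 4 → k, y = s 0 • p hξ hr ℓ 0 + s 1 • p hξ hr ℓ 1 +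
    s 2 • p hξ hr ℓ 2 + s 3 • p hξ hr ℓ 3 := by
  obtain ⟨v, rfl⟩ := (RepModule.of (fourDimTwist hξ hr ℓ)).surjective y
  exact ⟨v, (RepModule.of_eq_sum _ v).trans (Fin.sum_univ_four _)⟩

lemma hasWeight_p_zero : HasWeight hξ (ℓ, 2 * ℓ) (p hξ hr ℓ 0) :=
  hasWeight_matRep (by ext n; fin_cases n <;> simp) (by ext n; fin_cases n <;> simp)

lemma hasWeight_p_one : HasWeight hξ (ℓ + 3, 2 * ℓ + 2) (p hξ hr ℓ 1) := by
  refine hasWeight_matRep ?_ ?_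
  · rw [rootPow_add hξ, rootPow_three hξ]
    ext n; fin_cases n <;> simp
  · rw [rootPow_add hξ, rootPow_two hξ]
    ext n; fin_cases n <;> simp

lemma hasWeight_p_two : HasWeight hξ (ℓ + 1, 2 * ℓ + 2) (p hξ hr ℓ 2) := by
  refine hasWeight_matRep ?_ ?_
  · rw [rootPow_add hξ, rootPow_one]
    ext n; fin_cases n <;> simp
  · rw [rootPow_add hξ, rootPow_two hξ]
    ext n; fin_cases n <;> simp

lemma hasWeight_p_three : HasWeight hξ (ℓ, 2 * ℓ) (p hξ hr ℓ 3) :=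
  hasWeight_matRep (by ext n; fin_cases n <;> simp) (by ext n; fin_cases n <;> simp)

lemma c_smul_p_zero : D.ofK (c hξ) • p hξ hr ℓ 0 = -rootPow ξ (-ℓ) • p hξ hr ℓ 2 := by
  refine (c_smul_matRep 0).trans ?_
  rw [p, RepModule.smul_of]
  congr 1; ext n; fin_cases n <;> simp

lemma c_smul_p_three : D.ofK (c hξ) • p hξ hr ℓ 3 = 0 :=
  (c_smul_matRep 3).trans (congrArg (RepModule.of _) (by ext n; fin_cases n <;> simp))

lemma x_smul_p_zero : D.ofDual (xFun hξ r) • p hξ hr ℓ 0 = p hξ hr ℓ 1 + r • p hξ hr ℓ 2 := by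
  refine (x_smul_matRep 0).trans ?_
  rw [p, p, RepModule.smul_of, ← map_add]
  congr 1; ext n; fin_cases n <;> simp

lemma x_smul_p_two : D.ofDual (xFun hξ r) • p hξ hr ℓ 2 = p hξ hr ℓ 3 :=
  (x_smul_matRep 2).trans (congrArg (RepModule.of _) (by ext n; fin_cases n <;> simp))

variable {N : Submodule (D hξ) (FourDim hξ hr ℓ)}

lemma p_three_mem (h₂ : p hξ hr ℓ 2 ∈ N) : p hξ hr ℓ 3 ∈ N := by
  simpa only [x_smul_p_two] using N.smul_mem (D.ofDual (xFun hξ r)) h₂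

lemma eq_top_of_p_zero_mem (h₀ : p hξ hr ℓ 0 ∈ N) : N = ⊤ := by
  have h₂ : p hξ hr ℓ 2 ∈ N := by
    have := N.smul_mem (D.ofK (c hξ)) h₀
    rwa [c_smul_p_zero, smul_mem_iff_of_ne_zero N (neg_ne_zero.2 (rootPow_ne_zero hξ _))] at this
  have h₁ : p hξ hr ℓ 1 ∈ N := by
    have := N.smul_mem (D.ofDual (xFun hξ r)) h₀
    rwa [x_smul_p_zero, N.add_mem_iff_left (N.smul_of_tower_mem r h₂)] at this
  refine eq_top_iff.2 fun y _ => ?_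
  obtain ⟨s, rfl⟩ := eq_add y
  exact N.add_mem (N.add_mem (N.add_mem (N.smul_of_tower_mem _ h₀) (N.smul_of_tower_mem _ h₁))
    (N.smul_of_tower_mem _ h₂)) (N.smul_of_tower_mem _ (p_three_mem h₂))

lemma weightProj_smul (s : Fin 4 → k) : weightProj hξ (ℓ, 2 * ℓ) • (s 0 • p hξ hr ℓ 0 +
    s 1 • p hξ hr ℓ 1 + s 2 • p hξ hr ℓ 2 + s 3 • p hξ hr ℓ 3) =
      s 0 • p hξ hr ℓ 0 + s 3 • p hξ hr ℓ 3 := by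
  have h₁ : ℓ + 1 ≠ ℓ := by rw [Ne, add_eq_left]; decide
  have h₃ : ℓ + 3 ≠ ℓ := by rw [Ne, add_eq_left]; decide
  simp only [smul_add, smul_algebra_smul_comm _ (weightProj hξ (ℓ, 2 * ℓ)),
    hasWeight_p_zero.weightProj_smul, hasWeight_p_one.weightProj_smul,
    hasWeight_p_two.weightProj_smul, hasWeight_p_three.weightProj_smul, Prod.mk.injEq, h₁, h₃,
    false_and, if_true, if_false, smul_zero, add_zero]

lemma eq_top_of_mem (s : Fin 4 → k) (hs : s 0 ≠ 0) (hN : s 0 • p hξ hr ℓ 0 + s 1 • p hξ hr ℓ 1 +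
    s 2 • p hξ hr ℓ 2 + s 3 • p hξ hr ℓ 3 ∈ N) : N = ⊤ := by
  have hproj := N.smul_mem (weightProj hξ (ℓ, 2 * ℓ)) hN
  rw [weightProj_smul] at hproj
  have h₂ : p hξ hr ℓ 2 ∈ N := by
    have := N.smul_mem (D.ofK (c hξ)) hproj
    rwa [smul_add, smul_algebra_smul_comm, smul_algebra_smul_comm, c_smul_p_zero, c_smul_p_three,
      smul_zero, add_zero, smul_mem_iff_of_ne_zero N hs,
      smul_mem_iff_of_ne_zero N (neg_ne_zero.2 (rootPow_ne_zero hξ _))] at this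
  rw [N.add_mem_iff_left (N.smul_of_tower_mem _ (p_three_mem h₂)),
    smul_mem_iff_of_ne_zero N hs] at hproj
  exact eq_top_of_p_zero_mem hproj

end FourDim

lemma OneDim.isSimpleModule (ℓ : ZMod 4) : IsSimpleModule (D hξ) (OneDim hξ hr ℓ) := by
  have hsimple : IsSimpleModule k (OneDim hξ hr ℓ) := inferInstanceAs (IsSimpleModule k k)
  have := IsSimpleModule.nontrivial k (OneDim hξ hr ℓ)
  exact (isSimpleModule_iff ..).2 ⟨fun N => (eq_bot_or_eq_top (N.restrictScalars k)).imp
    (Submodule.restrictScalars_eq_bot_iff ..).1 (Submodule.restrictScalars_eq_top_iff ..).1⟩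

lemma OneDim.hasWeight (ℓ : ZMod 4) (y : OneDim hξ hr ℓ) : HasWeight hξ (ℓ, 2 * ℓ) y := by
  obtain ⟨s, rfl⟩ := (RepModule.of (charRep (character hξ hr ℓ))).surjective y
  have h := character_actsBy hξ hr ℓ
  constructor
  · rw [RepModule.smul_of, ← h.map_a]; rfl
  · rw [RepModule.smul_of, rootPow_two_mul hξ, rootPow_sq hξ, ← h.map_g]; rfl

lemma OneDim.c_smul (ℓ : ZMod 4) (y : OneDim hξ hr ℓ) : D.ofK (c hξ) • y = 0 := by
  change character hξ hr ℓ (D.ofK (c hξ)) * (RepModule.of _).symm y = 0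
  rw [(character_actsBy hξ hr ℓ).map_c, zero_mul]

variable (hξ hr) in
/-- The projection from `P ⊗ k_{χ^ℓ}` onto `k_{χ^ℓ}`. -/
def FourDim.π (ℓ : ZMod 4) : FourDim hξ hr ℓ →ₗ[D hξ] OneDim hξ hr ℓ :=
  RepModule.hom (D.gens hξ r) (D.adjoin_gens hξ hr) (LinearMap.proj 0) fun Y hY => by
    have h₄ := matRep_actsBy hξ hr ((doubleRelations_fourDim hξ r).rootPow_smul hξ ℓ)
    have h₁ := D.lift_actsBy hξ (doubleRelations_character (r := r) hξ ℓ) hr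
    change LinearMap.proj 0 ∘ₗ matRep hξ hr _ Y =
      Algebra.lmul k k (D.lift hξ hr (doubleRelations_character hξ ℓ) Y) ∘ₗ LinearMap.proj 0
    rcases hY with rfl | rfl | rfl | rfl
    · rw [h₄.map_a, h₁.map_a]; ext n; fin_cases n <;> simp
    · rw [h₄.map_c, h₁.map_c]; ext n; fin_cases n <;> simp
    · rw [h₄.map_g, h₁.map_g]; ext n; fin_cases n <;> simp
    · rw [h₄.map_x, h₁.map_x]; ext n; fin_cases n <;> simp

lemma FourDim.π_surjective (ℓ : ZMod 4) : Function.Surjective (π hξ hr ℓ) :=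
  LinearMap.proj_surjective (R := k) (φ := fun _ : Fin 4 => k) 0

lemma FourDim.isGreatest_ker_π (ℓ : ZMod 4) :
    IsGreatest {N : Submodule (D hξ) (FourDim hξ hr ℓ) | N ≠ ⊤} (LinearMap.ker (π hξ hr ℓ)) := by
  refine ⟨fun h => ?_, fun N hN y hy => ?_⟩
  · obtain ⟨y, hy⟩ := π_surjective (hξ := hξ) (hr := hr) ℓ (RepModule.of _ 1)
    rw [LinearMap.ker_eq_top.1 h] at hy
    exact zero_ne_one (α := k) hy
  · obtain ⟨v, rfl⟩ := (RepModule.of (fourDimTwist hξ hr ℓ)).surjective y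
    by_contra hv
    rw [(RepModule.of_eq_sum _ v).trans (Fin.sum_univ_four _)] at hy
    exact hN (eq_top_of_mem v hv hy)

end modules

end HopfK

/-! ### The regular module and the simple modules -/

namespace HopfK

open Coalgebra DoubleCop

variable {k : Type u} [Field k] {ξ : k} {hξ : IsPrimitiveRoot ξ 4} {r : k} {hr : r ^ 2 = 2}

/-- The permutation of `Λ` for which the second basis vector of `V_{Lam.shift t}` has weight `t`. -/
def Lam.shift : Lam ≃ Lam := (Equiv.addRight (1, 2)).subtypeEquiv (by decide)

lemma Lam.shift_val_add (t : Lam) : (Lam.shift t).1 + (3, 2) = t.1 := by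
  change t.1 + (1, 2) + (3, 2) = t.1
  rw [add_assoc, add_eq_left]
  rfl

section hom

variable {Q : Type w} [AddCommGroup Q] [Module (D hξ) Q]

lemma FourDim.hom_eq_zero {ℓ : ZMod 4} {f : FourDim hξ hr ℓ →ₗ[D hξ] Q}
    (h : f (p hξ hr ℓ 0) = 0) : f = 0 :=
  LinearMap.ker_eq_top.1 (eq_top_of_p_zero_mem h)

lemma TwoDim.hom_eq_zero {t : ZMod 4 × ZMod 4} (ht : 2 * t.1 ≠ t.2)
    {f : TwoDim hξ hr t →ₗ[D hξ] Q} (h : f (e hξ hr t 0) = 0) : f = 0 :=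
  LinearMap.ker_eq_top.1 (eq_top_of_e_zero_mem ht h)

variable [Module k Q] [IsScalarTower k (D hξ) Q]
  {f₁ : ∀ ℓ, FourDim hξ hr ℓ →ₗ[D hξ] Q} {f₂ : ∀ t : Lam, Fin 2 → TwoDim hξ hr t.1 →ₗ[D hξ] Q}

lemma weightProj_smul_sum (q : ZMod 4 × ZMod 4) :
    weightProj hξ q • (∑ ℓ, f₁ ℓ (FourDim.p hξ hr ℓ 0) +
      ∑ t : Lam, ∑ n, f₂ t n (TwoDim.e hξ hr t.1 n)) =
    (∑ ℓ, if (ℓ, 2 * ℓ) = q then f₁ ℓ (FourDim.p hξ hr ℓ 0) else 0) +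
      ∑ t : Lam, if t.1 = q then f₂ t 0 (TwoDim.e hξ hr t.1 0) +
        f₂ (Lam.shift t) 1 (TwoDim.e hξ hr (Lam.shift t).1 1) else 0 := by
  have h₁ (t : Lam) :
      HasWeight hξ t.1 (f₂ (Lam.shift t) 1 (TwoDim.e hξ hr (Lam.shift t).1 1)) := by
    have := (TwoDim.hasWeight_e_one (hr := hr) (t := (Lam.shift t).1)).map (f₂ (Lam.shift t) 1)
    rwa [Lam.shift_val_add] at this
  simp only [Fin.sum_univ_two, Finset.sum_add_distrib, ite_add_zero]
  rw [← Lam.shift.sum_comp fun t => f₂ t 1 (TwoDim.e hξ hr t.1 1)]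
  simp only [smul_add, Finset.smul_sum, (FourDim.hasWeight_p_zero.map _).weightProj_smul,
    (TwoDim.hasWeight_e_zero.map _).weightProj_smul, (h₁ _).weightProj_smul]

lemma hom_eq_zero_of_sum_eq_zero (h : ∑ ℓ, f₁ ℓ (FourDim.p hξ hr ℓ 0) +
    ∑ t : Lam, ∑ n, f₂ t n (TwoDim.e hξ hr t.1 n) = 0) : f₁ = 0 ∧ f₂ = 0 := by
  have hw (q : ZMod 4 × ZMod 4) := weightProj_smul_sum (f₁ := f₁) (f₂ := f₂) q
  simp only [h, smul_zero] at hw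
  have hTwo (t : Lam) : f₂ t 0 (TwoDim.e hξ hr t.1 0) +
      f₂ (Lam.shift t) 1 (TwoDim.e hξ hr (Lam.shift t).1 1) = 0 := by
    have hne (ℓ : ZMod 4) : (ℓ, 2 * ℓ) ≠ t.1 := fun h => t.2 (by rw [← h])
    simpa [hne, Subtype.val_inj] using (hw t.1).symm
  have hOne (t : Lam) : f₂ (Lam.shift t) 1 = 0 := by
    refine TwoDim.hom_eq_zero (Lam.shift t).2 ?_
    have := congrArg (D.ofK (c hξ) • ·) (hTwo t)
    simpa only [smul_add, ← map_smul, TwoDim.c_smul_e_zero, TwoDim.c_smul_e_one, map_zero,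
      zero_add, smul_zero] using this
  refine ⟨funext fun ℓ => FourDim.hom_eq_zero ?_, funext fun t => funext <| Fin.forall_fin_two.2
    ⟨TwoDim.hom_eq_zero t.2 ?_, ?_⟩⟩
  · have hne (t : Lam) : t.1 ≠ (ℓ, 2 * ℓ) := fun h => t.2 (by rw [h])
    have heq (m : ZMod 4) : (m, 2 * m) = (ℓ, 2 * ℓ) ↔ m = ℓ :=
      ⟨congrArg Prod.fst, congrArg fun m => (m, 2 * m)⟩
    simpa [hne, heq] using (hw (ℓ, 2 * ℓ)).symm
  · simpa only [hOne, LinearMap.zero_apply, add_zero] using hTwo t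
  · exact Lam.shift.surjective.forall (p := fun t => f₂ t 1 = 0) |>.2 hOne t

end hom

section regular

variable (hξ hr)

/-- The direct sum of the modules `P ⊗ k_{χ^ℓ}` and of two copies of each `V_{i,j}`. -/
abbrev CoverSum : Type u :=
  (∀ ℓ : ZMod 4, FourDim hξ hr ℓ) × (∀ t : Lam, Fin 2 → TwoDim hξ hr t.1)

namespace CoverSum

/-- The vector that generates the direct sum: the sum of the first basis vectors of the modules
`P ⊗ k_{χ^ℓ}`, of the first basis vectors of the first copies of the `V_{i,j}` and of the second
basis vectors of the second copies. -/
def gen : CoverSum hξ hr := (fun ℓ => FourDim.p hξ hr ℓ 0, fun t => TwoDim.e hξ hr t.1)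

variable {hξ hr}

/-- The inclusion of `P ⊗ k_{χ^ℓ}` into the direct sum. -/
def inFour (ℓ : ZMod 4) : FourDim hξ hr ℓ →ₗ[D hξ] CoverSum hξ hr :=
  LinearMap.inl _ _ _ ∘ₗ LinearMap.single (D hξ) (fun ℓ => FourDim hξ hr ℓ) ℓ

/-- The inclusions of `V_{i,j}` into the direct sum. -/
def inTwo (t : Lam) (n : Fin 2) : TwoDim hξ hr t.1 →ₗ[D hξ] CoverSum hξ hr :=
  LinearMap.inr _ _ _ ∘ₗ
    LinearMap.single (D hξ) (fun t : Lam => Fin 2 → TwoDim hξ hr t.1) t ∘ₗ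
      LinearMap.single (D hξ) (fun _ => TwoDim hξ hr t.1) n

lemma hom_eq_zero {S : Type w} [AddCommGroup S] [Module (D hξ) S]
    {f : CoverSum hξ hr →ₗ[D hξ] S} (h₁ : ∀ ℓ, f ∘ₗ inFour ℓ = 0)
    (h₂ : ∀ t n, f ∘ₗ inTwo t n = 0) : f = 0 :=
  LinearMap.prod_ext (LinearMap.pi_ext' h₁)
    (LinearMap.pi_ext' fun t => LinearMap.pi_ext' fun n => h₂ t n)

lemma gen_eq_sum : gen hξ hr = ∑ ℓ, inFour ℓ (FourDim.p hξ hr ℓ 0) +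
    ∑ t : Lam, ∑ n, inTwo t n (TwoDim.e hξ hr t.1 n) := by
  have hTwo (t : Lam) : Pi.single 0 (TwoDim.e hξ hr t.1 0) + Pi.single 1 (TwoDim.e hξ hr t.1 1) =
      TwoDim.e hξ hr t.1 := by
    rw [← Fin.sum_univ_two fun n => Pi.single n (TwoDim.e hξ hr t.1 n), Finset.univ_sum_single]
  refine Prod.ext ?_ ?_
  · simp [gen, inFour, inTwo, Prod.fst_sum, Finset.univ_sum_single]
  · simp [gen, inFour, inTwo, Prod.snd_sum, ← Pi.single_add, hTwo, Finset.univ_sum_single]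

variable (hξ hr) in
lemma span_gen : Submodule.span (D hξ) {gen hξ hr} = ⊤ := by
  set N := Submodule.span (D hξ) {gen hξ hr}
  have hgen : N.mkQ (gen hξ hr) = 0 :=
    (Submodule.Quotient.mk_eq_zero N).2 (Submodule.mem_span_singleton_self _)
  rw [gen_eq_sum] at hgen
  simp only [map_add, map_sum] at hgen
  obtain ⟨h₁, h₂⟩ := hom_eq_zero_of_sum_eq_zero (f₁ := fun ℓ => N.mkQ ∘ₗ inFour ℓ)
    (f₂ := fun t n => N.mkQ ∘ₗ inTwo t n) hgen
  rw [← N.ker_mkQ, hom_eq_zero (congrFun h₁) fun t => congrFun (congrFun h₂ t), LinearMap.ker_zero]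

lemma finrank_eq : Module.finrank k (CoverSum hξ hr) = 64 := by
  have hFour (ℓ : ZMod 4) : Module.finrank k (FourDim hξ hr ℓ) = 4 :=
    Module.finrank_fin_fun k
  have hTwo (t : ZMod 4 × ZMod 4) : Module.finrank k (TwoDim hξ hr t) = 2 :=
    Module.finrank_fin_fun k
  have hLam : Fintype.card Lam = 12 := by decide
  simp [Module.finrank_pi_fintype, hFour, hTwo, hLam]

end CoverSum

instance : Module.Finite k (D hξ) :=
  inferInstanceAs (Module.Finite k (Module.Dual k (KAlg hξ) ⊗[k] KAlg hξ))

lemma D.finrank_le : Module.finrank k (D hξ) ≤ 64 := by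
  change Module.finrank k (Module.Dual k (KAlg hξ) ⊗[k] KAlg hξ) ≤ 64
  rw [Module.finrank_tensorProduct, Subspace.dual_finrank_eq]
  exact Nat.mul_le_mul (HopfK.finrank_le hξ) (HopfK.finrank_le hξ)

lemma bijective_smul_gen :
    Function.Bijective (LinearMap.toSpanSingleton (D hξ) _ (CoverSum.gen hξ hr)) := by
  have hs : Function.Surjective (LinearMap.toSpanSingleton (D hξ) _ (CoverSum.gen hξ hr)) := by
    rw [← LinearMap.range_eq_top, LinearMap.range_toSpanSingleton, CoverSum.span_gen]
  let f := (LinearMap.toSpanSingleton (D hξ) _ (CoverSum.gen hξ hr)).restrictScalars k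
  have hfr : Module.finrank k (D hξ) = Module.finrank k (CoverSum hξ hr) :=
    (CoverSum.finrank_eq (hr := hr) ▸ D.finrank_le hξ).antisymm
      (f.finrank_le_finrank_of_surjective hs)
  exact ⟨(LinearMap.injective_iff_surjective_of_finrank_eq_finrank (f := f) hfr).2 hs, hs⟩

/-- The decomposition of the left regular module. -/
def regularEquiv : D hξ ≃ₗ[D hξ] CoverSum hξ hr :=
  LinearEquiv.ofBijective _ (bijective_smul_gen hξ hr)

instance : Module.Projective (D hξ) (CoverSum hξ hr) :=
  Module.Projective.of_equiv (regularEquiv hξ hr)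

variable {hξ hr}

instance (ℓ : ZMod 4) : Module.Projective (D hξ) (FourDim hξ hr ℓ) :=
  Module.Projective.of_split (CoverSum.inFour ℓ) (LinearMap.proj ℓ ∘ₗ LinearMap.fst _ _ _)
    (by ext y; simp [CoverSum.inFour])

instance (t : Lam) : Module.Projective (D hξ) (TwoDim hξ hr t.1) :=
  Module.Projective.of_split (CoverSum.inTwo t 0)
    (LinearMap.proj (0 : Fin 2) ∘ₗ LinearMap.proj t ∘ₗ LinearMap.snd _ _ _)
    (by ext y; simp [CoverSum.inTwo])

end regular

variable {S : Type w} [AddCommGroup S] [Module (D hξ) S]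

section highestWeight

/-- `HasHighestWeight p S`: the module `S` contains a nonzero vector of weight `p` that is
annihilated by `c`. -/
def HasHighestWeight (p : ZMod 4 × ZMod 4) (S : Type w) [AddCommGroup S] [Module (D hξ) S] :
    Prop :=
  ∃ y : S, y ≠ 0 ∧ D.ofK (c hξ) • y = 0 ∧ weightProj hξ p • y = y

variable {p : ZMod 4 × ZMod 4}

lemma HasHighestWeight.of_equiv {S' : Type v} [AddCommGroup S'] [Module (D hξ) S']
    (e : S ≃ₗ[D hξ] S') : HasHighestWeight (hξ := hξ) p S → HasHighestWeight (hξ := hξ) p S' := by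
  rintro ⟨y, hy₀, hc, hp⟩
  exact ⟨e y, e.map_ne_zero_iff.2 hy₀, by rw [← map_smul, hc, map_zero], by rw [← map_smul, hp]⟩

lemma OneDim.hasHighestWeight_iff {ℓ : ZMod 4} :
    HasHighestWeight (hξ := hξ) p (OneDim hξ hr ℓ) ↔ (ℓ, 2 * ℓ) = p := by
  constructor
  · rintro ⟨y, hy₀, -, hp⟩
    rw [(OneDim.hasWeight ℓ y).weightProj_smul] at hp
    exact by_contra fun h => hy₀ (by rw [← hp, if_neg h])
  · intro h
    refine ⟨RepModule.of _ 1, one_ne_zero (α := k), OneDim.c_smul _ _, ?_⟩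
    rw [(OneDim.hasWeight ℓ _).weightProj_smul, if_pos h]

lemma TwoDim.hasHighestWeight_iff {t : ZMod 4 × ZMod 4} :
    HasHighestWeight (hξ := hξ) p (TwoDim hξ hr t) ↔ t = p := by
  have he₀ : e hξ hr t 0 ≠ 0 := Pi.single_ne_zero_iff.2 (one_ne_zero (α := k))
  constructor
  · rintro ⟨y, hy₀, hc, hp⟩
    obtain ⟨s₀, s₁, rfl⟩ := eq_add y
    have hs₁ : s₁ = 0 := by
      rw [smul_add, smul_algebra_smul_comm, smul_algebra_smul_comm, c_smul_e_zero, c_smul_e_one,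
        smul_zero, zero_add] at hc
      by_contra hs₁
      exact he₀ ((smul_mem_iff_of_ne_zero (⊥ : Submodule (D hξ) _) hs₁).1 hc)
    rw [hs₁, zero_smul, add_zero, smul_algebra_smul_comm, hasWeight_e_zero.weightProj_smul] at hp
    exact by_contra fun h => hy₀ (by rw [hs₁, zero_smul, add_zero, ← hp, if_neg h, smul_zero])
  · intro h
    refine ⟨e hξ hr t 0, he₀, c_smul_e_zero, ?_⟩
    rw [hasWeight_e_zero.weightProj_smul, if_pos h]

end highestWeight

section covers

instance (t : Lam) : IsSimpleModule (D hξ) (TwoDim hξ hr t.1) := TwoDim.isSimpleModule t.2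

variable (hξ hr) in
/-- The module `P ⊗ k_{χ^ℓ}` on the underlying space of `P`. -/
def tensorEquiv (ℓ : ZMod 4) : FourDim hξ hr ℓ ≃ₗ[D hξ] RepModule ((repFamily hξ hr).PT ℓ) :=
  RepModule.equiv (TensorProduct.rid k (Fin 4 → k)).symm fun Y m => by simp [repFamily]

variable (hξ hr S) in
/-- The modules `P ⊗ k_{χ^ℓ}` and `V_{i,j}` as candidates for the projective cover of `S`. -/
def IsCoveredBy : ZMod 4 ⊕ Lam → Prop :=
  Sum.elim (fun ℓ => IsProjectiveCover (D hξ) (RepModule ((repFamily hξ hr).PT ℓ)) S)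
    (fun t => IsProjectiveCover (D hξ) (RepModule ((repFamily hξ hr).V t)) S)

lemma isCoveredBy_inl_of_surjective [Nontrivial S] {ℓ : ZMod 4} {f : FourDim hξ hr ℓ →ₗ[D hξ] S}
    (hf : Function.Surjective f) : IsCoveredBy hξ hr S (.inl ℓ) :=
  (IsProjectiveCover.of_surjective (FourDim.isGreatest_ker_π ℓ) hf).of_equiv (tensorEquiv hξ hr ℓ)

lemma isCoveredBy_inr_of_surjective [Nontrivial S] {t : Lam} {f : TwoDim hξ hr t.1 →ₗ[D hξ] S}
    (hf : Function.Surjective f) : IsCoveredBy hξ hr S (.inr t) := by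
  have hTwo : IsProjectiveCover (D hξ) (TwoDim hξ hr t.1) S :=
    .of_surjective (isGreatest_bot_of_isSimpleModule ..) hf
  exact hTwo

/-- The highest weight of the simple module with a given projective cover. -/
def coverWeight : ZMod 4 ⊕ Lam → ZMod 4 × ZMod 4 := Sum.elim (fun ℓ => (ℓ, 2 * ℓ)) Subtype.val

lemma coverWeight_injective : Function.Injective coverWeight :=
  Function.Injective.sumElim (fun _ _ h => congrArg Prod.fst h) Subtype.val_injective
    fun _ t h => t.2 (h ▸ rfl)

variable [IsSimpleModule (D hξ) S]

lemma IsCoveredBy.hasHighestWeight_iff {s : ZMod 4 ⊕ Lam} (h : IsCoveredBy hξ hr S s)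
    {p : ZMod 4 × ZMod 4} : HasHighestWeight (hξ := hξ) p S ↔ coverWeight s = p := by
  rcases s with ℓ | t
  · have := OneDim.isSimpleModule (hξ := hξ) (hr := hr) ℓ
    have hFour : IsProjectiveCover (D hξ) (FourDim hξ hr ℓ) S :=
      .of_equiv (tensorEquiv hξ hr ℓ).symm h
    obtain ⟨e⟩ := hFour.nonempty_equiv (FourDim.isGreatest_ker_π ℓ) (FourDim.π_surjective ℓ)
    exact ⟨fun hS => OneDim.hasHighestWeight_iff.1 (hS.of_equiv e.symm),
      fun hp => (OneDim.hasHighestWeight_iff.2 hp).of_equiv e⟩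
  · have hTwo : IsProjectiveCover (D hξ) (TwoDim hξ hr t.1) S := h
    obtain ⟨e⟩ := hTwo.nonempty_equiv (isGreatest_bot_of_isSimpleModule ..)
      (f := LinearMap.id) Function.surjective_id
    exact ⟨fun hS => TwoDim.hasHighestWeight_iff.1 (hS.of_equiv e.symm),
      fun hp => (TwoDim.hasHighestWeight_iff.2 hp).of_equiv e⟩

variable (hξ hr S)

lemma exists_isCoveredBy : ∃ s, IsCoveredBy hξ hr S s := by
  have := IsSimpleModule.nontrivial (D hξ) S
  obtain ⟨y, hy⟩ := exists_ne (0 : S)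
  let f : CoverSum hξ hr →ₗ[D hξ] S :=
    LinearMap.toSpanSingleton (D hξ) S y ∘ₗ (regularEquiv hξ hr).symm.toLinearMap
  have hf : f (regularEquiv hξ hr 1) ≠ 0 := by simpa [f] using hy
  by_contra! hS
  refine hf (LinearMap.congr_fun (CoverSum.hom_eq_zero (fun ℓ => ?_) fun t n => ?_) _)
  · exact by_contra fun h =>
      hS (.inl ℓ) (isCoveredBy_inl_of_surjective (LinearMap.surjective_of_ne_zero h))
  · exact by_contra fun h =>
      hS (.inr t) (isCoveredBy_inr_of_surjective (LinearMap.surjective_of_ne_zero h))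

lemma existsUnique_isCoveredBy : ∃! s, IsCoveredBy hξ hr S s := by
  obtain ⟨s, hs⟩ := exists_isCoveredBy hξ hr S
  exact ⟨s, hs, fun s' hs' =>
    coverWeight_injective (hs'.hasHighestWeight_iff.1 (hs.hasHighestWeight_iff.2 rfl))⟩

end covers

end HopfK

end

theorem mainTheorem4_general {k : Type u} [Field k] (ξ r : k)
    (hξ : IsPrimitiveRoot ξ 4) (hr : r ^ 2 = 2) :
    ∃ M : HopfK.RepFamily hξ r, (∀ M' : HopfK.RepFamily hξ r, M' = M) ∧
      (∀ ℓ : ZMod 4,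
        IsSimpleModule (HopfK.D hξ) (RepModule (HopfK.charRep (M.χ ℓ))) ∧
        IsProjectiveCover (HopfK.D hξ) (RepModule (M.PT ℓ))
          (RepModule (HopfK.charRep (M.χ ℓ)))) ∧
      (∀ t : HopfK.Lam,
        IsSimpleModule (HopfK.D hξ) (RepModule (M.V t)) ∧
        IsProjectiveCover (HopfK.D hξ) (RepModule (M.V t)) (RepModule (M.V t))) ∧
      (∀ (S : Type w) [AddCommGroup S] [Module (HopfK.D hξ) S],
        IsSimpleModule (HopfK.D hξ) S →
          ∃! s : ZMod 4 ⊕ HopfK.Lam, Sum.elim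
            (fun ℓ => IsProjectiveCover (HopfK.D hξ) (RepModule (M.PT ℓ)) S)
            (fun t => IsProjectiveCover (HopfK.D hξ) (RepModule (M.V t)) S) s) ∧
      Nonempty (HopfK.D hξ ≃ₗ[HopfK.D hξ]
        ((∀ ℓ : ZMod 4, RepModule (M.PT ℓ)) ×
          (∀ t : HopfK.Lam, Fin 2 → RepModule (M.V t)))) := by
  refine ⟨HopfK.repFamily hξ hr, HopfK.repFamily_unique hξ hr, fun ℓ => ?_, fun t => ?_,
    fun S _ _ _ => HopfK.existsUnique_isCoveredBy hξ hr S, ?_⟩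
  · have hsimple := HopfK.OneDim.isSimpleModule (hξ := hξ) (hr := hr) ℓ
    have := IsSimpleModule.nontrivial (HopfK.D hξ) (HopfK.OneDim hξ hr ℓ)
    exact ⟨hsimple, HopfK.isCoveredBy_inl_of_surjective (S := HopfK.OneDim hξ hr ℓ)
      (HopfK.FourDim.π_surjective ℓ)⟩
  · have hsimple := HopfK.TwoDim.isSimpleModule (hξ := hξ) (hr := hr) t.2
    have := IsSimpleModule.nontrivial (HopfK.D hξ) (HopfK.TwoDim hξ hr t.1)
    exact ⟨hsimple, HopfK.isCoveredBy_inr_of_surjective (S := HopfK.TwoDim hξ hr t.1) (hr := hr)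
      (f := LinearMap.id) Function.surjective_id⟩
  · exact ⟨(HopfK.regularEquiv hξ hr).trans (.prodCongr
      (.piCongrRight (HopfK.tensorEquiv hξ hr)) (.refl _ _))⟩

theorem mainTheorem4 {k : Type u} [Field k] [IsAlgClosed k] [CharZero k] (ξ r : k)
    (hξ : IsPrimitiveRoot ξ 4) (hr : r ^ 2 = 2) :
    ∃ M : HopfK.RepFamily hξ r, (∀ M' : HopfK.RepFamily hξ r, M' = M) ∧
      -- `P ⊗ k_{χ^ℓ}` is the projective cover of the simple module `k_{χ^ℓ}`
      (∀ ℓ : ZMod 4,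
        IsSimpleModule (HopfK.D hξ) (RepModule (HopfK.charRep (M.χ ℓ))) ∧
        IsProjectiveCover (HopfK.D hξ) (RepModule (M.PT ℓ))
          (RepModule (HopfK.charRep (M.χ ℓ)))) ∧
      -- `V_{i,j}` is simple and is its own projective cover
      (∀ t : HopfK.Lam,
        IsSimpleModule (HopfK.D hξ) (RepModule (M.V t)) ∧
        IsProjectiveCover (HopfK.D hξ) (RepModule (M.V t)) (RepModule (M.V t))) ∧
      -- every simple module has exactly one of these modules as its projective cover
      (∀ (S : Type w) [AddCommGroup S] [Module (HopfK.D hξ) S],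
        IsSimpleModule (HopfK.D hξ) S →
          ∃! s : ZMod 4 ⊕ HopfK.Lam, Sum.elim
            (fun ℓ => IsProjectiveCover (HopfK.D hξ) (RepModule (M.PT ℓ)) S)
            (fun t => IsProjectiveCover (HopfK.D hξ) (RepModule (M.V t)) S) s) ∧
      -- the decomposition of the left regular module
      Nonempty (HopfK.D hξ ≃ₗ[HopfK.D hξ]
        ((∀ ℓ : ZMod 4, RepModule (M.PT ℓ)) ×
          (∀ t : HopfK.Lam, Fin 2 → RepModule (M.V t)))) :=
  mainTheorem4_general ξ r hξ hr
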